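/- **Setting.** Let $T\in\{0,1\}$ be a treatment, $Y_1,Y_0$ real potential outcomes, $X=(U,Z)$ covariates, $Y=TY_1+(1-T)Y_0$, and $W=(T,Y,X)$ the observed data, with $E(Y^2)<\infty$. The assignment model is $\mathrm{pr}(T=1\mid Y_0,X)=\pi(Y_0,U;\theta^0)$ with $\theta^0$ known, $0<\pi(\cdot,\cdot;\theta^0)<1$, and for some constant $c>0$, $c<\pi(Y_0,U;\theta^0)<1-c$ almost surely. Write $\pi=\pi(y_0,u;\theta^0)$, $p=\mathrm{pr}(T=1)$, $\Delta^0=E(Y_1-Y_0\mid T=1)$, $w(x)=\mathrm{pr}(T=1\mid x)$; let $E_0(\cdot\mid x)$ be the expectation under the law of $Y_0$ given $X=x$, and $E_t(\cdot\mid x,t)$ that under the law of $Y_t$ given $X=x$, $T=t$. Put $B(x)=E_0\{\pi/(1-\pi)\mid x\}$ and $$V(x)=w(x)E_1(Y_1\mid x,1)-w(x)\Delta^0+\{1-w(x)\}E_0\{Y_0\pi^2/(1-\pi)^2\mid x,0\}.$$ Define $$\phi_{\rm alt}=p^{-1}\Big\{ty_1-(1-t)\frac{\pi}{1-\pi}y_0-t\Delta^0\Big\},$$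 $$\phi=p^{-1}\Big\{\frac{t-\pi}{1-\pi}y-\frac{t-\pi}{1-\pi}\frac1{B(x)}\Big(w(x)E_1(Y_1\mid x,1)+\{1-w(x)\}E_0\Big[\frac{\pi^2}{(1-\pi)^2}Y_0\,\Big|\,x,0\Big]\Big)-\Delta^0\Big(t-\frac{t-\pi}{1-\pi}\frac{w(x)}{B(x)}\Big)\Big\}.$$ Let $\mathcal H$ be the Hilbert space of mean-zero square-integrable functions of $W$. Consider the semiparametric model with $\theta^0$ fixed, whose likelihood is $w(x)^t\{1-w(x)\}^{1-t}f_1(y\mid x,1)^tf_0(y\mid x,0)^{1-t}g(x)$, where $\{1-w(x)\}^{-1}=\int f_0(y\mid x,0)/\{1-\pi(y,u;\theta^0)\}\,dy$ and $f_0,f_1,g$ are unrestricted nuisances (except that $w<1$). Let $\Lambda\subseteq\mathcal H$ be its nuisance tangent space, i.e. the mean-squared closure of the span of the scores of all regular parametric submodels, and $\Lambda^\perp$ its orthogonal complement in $\mathcal H$. Let $W_1,W_2,\dots$ be i.i.d. copies of $W$ and $$\widehat\Delta_{\rm alt}(\theta^0)=\frac{n^{-1}\sum_i\{t_iy_{1i}-(1-t_i)\frac{\pi_i}{1-\pi_i}y_{0i}\}}{n^{-1}\sum_it_i}.$$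 Let $\widehat\Delta_{\rm eff}(\theta^0)$ be the solution in $\Delta$ of $\sum_i\phi(W_i;\Delta,\hat\eta)=0$, where $\phi(\cdot;\Delta,\hat\eta)$ is $\phi$ with $\Delta^0$ replaced by $\Delta$ and the nuisance quantities replaced as follows. The indices $1,\dots,n$ are partitioned randomly, independently of the data, into $K$ folds ($K$ fixed). For $i$ in fold $k$, the functions $e_1=E_0\{(1-\pi)^{-1}\mid x,0\}$, $e_2=E_0\{(1-\pi)^{-2}\pi\mid x,0\}$, $e_3=E_0\{Y_0(1-\pi)^{-2}\pi^2\mid x,0\}$ and $m_1=E_1(Y_1\mid x,1)$ are replaced by (measurable) estimates computed from the observations outside fold $k$, and $w=1-e_1^{-1}$, $B=(1-w)e_2$ accordingly. Assume that for every $k$ these four estimates are consistent in probability, uniformly in $x$ (up to null sets of the law of $X$). **Lemma.** (1) $\phi_{\rm alt},\phi\in\mathcal H$ and $$\phi_{\rm alt}=\phi+\frac{t-\pi}{1-\pi}\,p^{-1}B(x)^{-1}V(x),$$ where $\phi=\Pi(\phi_{\rm alt}\mid\Lambda)$ and the last term is $\Pi(\phi_{\rm alt}\mid\Lambda^\perp)$.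 This last term is nonzero, equivalently $\phi_{\rm alt}\notin\Lambda$, if and only if $V(X)$ is not almost surely zero; a sufficient condition is $E\{Y_0\pi/(1-\pi)\}\neq0$. (2) $E(\phi_{\rm alt}^2)=E(\phi^2)+E[\Pi(\phi_{\rm alt}\mid\Lambda^\perp)^2]$, and $E(\phi_{\rm alt}^2)>E(\phi^2)$ if and only if $V(X)$ is not almost surely zero. (3) As $n\to\infty$, $$\sqrt n\{\widehat\Delta_{\rm alt}(\theta^0)-\Delta^0\}=n^{-1/2}\sum_{i=1}^n\phi_{\rm alt}(W_i)+o_p(1)\to N(0,E\phi_{\rm alt}^2),$$ $$\sqrt n\{\widehat\Delta_{\rm eff}(\theta^0)-\Delta^0\}=n^{-1/2}\sum_{i=1}^n\phi(W_i)+o_p(1)\to N(0,E\phi^2)$$ in distribution. Hence, if $V(X)$ is not almost surely zero, $\widehat\Delta_{\rm alt}(\theta^0)$ has strictly larger asymptotic variance than $\widehat\Delta_{\rm eff}(\theta^0)$, i.e. it is less efficient. -/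

import Mathlib

open MeasureTheory ProbabilityTheory Filter Topology
open scoped ENNReal NNReal

noncomputable section

namespace ATT

/-- Observed data `w = (t, y, (u, z))`: treatment, observed outcome, covariates `x = (u, z)`. -/
abbrev Obs (𝒰 𝒵 : Type*) := Bool × ℝ × (𝒰 × 𝒵)

/-- The treatment indicator as a real number. -/
def ind (t : Bool) : ℝ := if t then 1 else 0

/-! ### Full data, observed data, and the target parameter -/

/-- The random variables of one subject: treatment `T`, potential outcomes `Y0`, `Y1`,
covariates `X = (U, Z)`. -/
structure FullData (Ω 𝒰 𝒵 : Type*) where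
  T : Ω → Bool
  Y0 : Ω → ℝ
  Y1 : Ω → ℝ
  U : Ω → 𝒰
  Z : Ω → 𝒵

section FullData

variable {Ω 𝒰 𝒵 : Type*} [MeasurableSpace Ω] [MeasurableSpace 𝒰] [MeasurableSpace 𝒵]

/-- The covariates `X = (U, Z)`. -/
def FullData.X (D : FullData Ω 𝒰 𝒵) (ω : Ω) : 𝒰 × 𝒵 := (D.U ω, D.Z ω)

/-- The observed outcome `Y = T Y₁ + (1 - T) Y₀`. -/
def FullData.Y (D : FullData Ω 𝒰 𝒵) (ω : Ω) : ℝ :=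
  ind (D.T ω) * D.Y1 ω + (1 - ind (D.T ω)) * D.Y0 ω

/-- The observed data `W = (T, Y, X)`. -/
def FullData.W (D : FullData Ω 𝒰 𝒵) (ω : Ω) : Obs 𝒰 𝒵 := (D.T ω, D.Y ω, D.X ω)

/-- The event `T = t`. -/
def FullData.ev (D : FullData Ω 𝒰 𝒵) (t : Bool) : Set Ω := D.T ⁻¹' {t}

/-- `p = pr(T = 1)`. -/
def FullData.p (D : FullData Ω 𝒰 𝒵) (P : Measure Ω) : ℝ := P.real (D.ev true)

/-- The average treatment effect on the treated, `Δ⁰ = E(Y₁ - Y₀ ∣ T = 1)`. -/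
def FullData.att (D : FullData Ω 𝒰 𝒵) (P : Measure Ω) : ℝ :=
  ∫ ω, (D.Y1 ω - D.Y0 ω) ∂(ProbabilityTheory.cond P (D.ev true))

/-- `w(x) = pr(T = 1 ∣ x)`. -/
def FullData.w (D : FullData Ω 𝒰 𝒵) (P : Measure Ω) [IsFiniteMeasure P] (x : 𝒰 × 𝒵) : ℝ :=
  (condDistrib D.T D.X P x).real {true}

/-- `E₀{h(Y₀) ∣ x}`: expectation under the conditional law of `Y₀` given `X = x`. -/
def FullData.E0 (D : FullData Ω 𝒰 𝒵) (P : Measure Ω) [IsFiniteMeasure P]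
    (h : ℝ → ℝ) (x : 𝒰 × 𝒵) : ℝ :=
  ∫ y, h y ∂(condDistrib D.Y0 D.X P x)

/-- `E₀{h(Y₀) ∣ x, 0}`: expectation under the conditional law of `Y₀` given `X = x, T = 0`. -/
def FullData.E00 (D : FullData Ω 𝒰 𝒵) (P : Measure Ω)
    (h : ℝ → ℝ) (x : 𝒰 × 𝒵) : ℝ :=
  ∫ y, h y ∂(condDistrib D.Y0 D.X (ProbabilityTheory.cond P (D.ev false)) x)

/-- `E₁{h(Y₁) ∣ x, 1}`: expectation under the conditional law of `Y₁` given `X = x, T = 1`. -/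
def FullData.E11 (D : FullData Ω 𝒰 𝒵) (P : Measure Ω)
    (h : ℝ → ℝ) (x : 𝒰 × 𝒵) : ℝ :=
  ∫ y, h y ∂(condDistrib D.Y1 D.X (ProbabilityTheory.cond P (D.ev true)) x)

/-! In what follows `ps y u` stands for `π(y, u; θ)` at a fixed `θ`. -/

/-- `B(x) = E₀[{1 - π}⁻¹ π ∣ x]`. -/
def FullData.B (D : FullData Ω 𝒰 𝒵) (P : Measure Ω) [IsFiniteMeasure P]
    (ps : ℝ → 𝒰 → ℝ) (x : 𝒰 × 𝒵) : ℝ :=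
  D.E0 P (fun y => (1 - ps y x.1)⁻¹ * ps y x.1) x

/-- `V(x) = w(x) E₁(Y₁ ∣ x, 1) - w(x) Δ + {1 - w(x)} E₀[Y₀ {1 - π}⁻² π² ∣ x, 0]`. -/
def FullData.V (D : FullData Ω 𝒰 𝒵) (P : Measure Ω) [IsFiniteMeasure P]
    (ps : ℝ → 𝒰 → ℝ) (x : 𝒰 × 𝒵) : ℝ :=
  D.w P x * D.E11 P (fun y => y) x - D.w P x * D.att P
    + (1 - D.w P x) * D.E00 P (fun y => y * ((1 - ps y x.1) ^ 2)⁻¹ * ps y x.1 ^ 2) x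

end FullData

/-! ### Influence functions -/

section Influence

variable {Ω 𝒰 𝒵 : Type*} [MeasurableSpace Ω] [MeasurableSpace 𝒰] [MeasurableSpace 𝒵]

/-- The residual `{t - π(y, u)} / {1 - π(y, u)}`; for `t = 1` it equals `1` whatever `y` is, and for
`t = 0` the observed `y` is `y₀`. -/
def resid (ps : ℝ → 𝒰 → ℝ) (o : Obs 𝒰 𝒵) : ℝ :=
  (ind o.1 - ps o.2.1 o.2.2.1) / (1 - ps o.2.1 o.2.2.1)

/-- The inverse probability weighted outcome `t y₁ - (1 - t) {π / (1 - π)} y₀`. -/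
def ipw (ps : ℝ → 𝒰 → ℝ) (o : Obs 𝒰 𝒵) : ℝ :=
  ind o.1 * o.2.1 - (1 - ind o.1) * (ps o.2.1 o.2.2.1 / (1 - ps o.2.1 o.2.2.1)) * o.2.1

/-- `φ_alt(w) = p⁻¹ {t y₁ - (1 - t) {π / (1 - π)} y₀ - t Δ}`. -/
def phiAlt (D : FullData Ω 𝒰 𝒵) (P : Measure Ω) (ps : ℝ → 𝒰 → ℝ) (o : Obs 𝒰 𝒵) : ℝ :=
  (D.p P)⁻¹ * (ipw ps o - ind o.1 * D.att P)

/-- The influence function `φ(w)` of the estimator `Δ̂_eff(θ)` at known `θ`. -/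
def phi (D : FullData Ω 𝒰 𝒵) (P : Measure Ω) [IsFiniteMeasure P]
    (ps : ℝ → 𝒰 → ℝ) (o : Obs 𝒰 𝒵) : ℝ :=
  let x := o.2.2
  (D.p P)⁻¹ *
    (resid ps o * o.2.1
      - resid ps o * (1 / D.B P ps x) *
          (D.w P x * D.E11 P (fun y => y) x
            + (1 - D.w P x) * D.E00 P (fun y => ps y x.1 ^ 2 / (1 - ps y x.1) ^ 2 * y) x)
      - D.att P * (ind o.1 - resid ps o * (D.w P x / D.B P ps x)))

/-- The component `{(t - π) / (1 - π)} p⁻¹ B(x)⁻¹ V(x)`. -/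
def phiPerp (D : FullData Ω 𝒰 𝒵) (P : Measure Ω) [IsFiniteMeasure P]
    (ps : ℝ → 𝒰 → ℝ) (o : Obs 𝒰 𝒵) : ℝ :=
  resid ps o * (D.p P)⁻¹ * (D.B P ps o.2.2)⁻¹ * D.V P ps o.2.2

end Influence

/-! ### The semiparametric model for the observed data and its nuisance tangent space -/

section Tangent

variable {𝒰 𝒵 : Type*} [MeasurableSpace 𝒰] [MeasurableSpace 𝒵]

/-- `1 - w(x) = [∫ f₀(y ∣ x, 0) / {1 - π(y, u)} dy]⁻¹`. -/
def controlProb (ps : ℝ → 𝒰 → ℝ) (f0 : Kernel (𝒰 × 𝒵) ℝ) (x : 𝒰 × 𝒵) : ℝ≥0∞ :=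
  (∫⁻ y, ENNReal.ofReal (1 - ps y x.1)⁻¹ ∂(f0 x))⁻¹

/-- `Q` belongs to the model with known `π`: for some law `g` of `X` and some conditional laws `f₀`
of `Y₀` given `x, T = 0` and `f₁` of `Y₁` given `x, T = 1` (all three unrestricted, except that
`w(x) < 1`), `Q` is the law on observed data with likelihood
`w(x)^t {1 - w(x)}^(1-t) f₁(y ∣ x, 1)^t f₀(y ∣ x, 0)^(1-t) g(x)`, where
`{1 - w(x)}⁻¹ = ∫ f₀(y ∣ x, 0) / {1 - π(y, u)} dy`. -/
def InModel (ps : ℝ → 𝒰 → ℝ) (Q : Measure (Obs 𝒰 𝒵)) : Prop :=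
  ∃ (g : Measure (𝒰 × 𝒵)) (f0 f1 : Kernel (𝒰 × 𝒵) ℝ),
    IsProbabilityMeasure g ∧ IsMarkovKernel f0 ∧ IsMarkovKernel f1 ∧
    (∀ᵐ x ∂g, ∫⁻ y, ENNReal.ofReal (1 - ps y x.1)⁻¹ ∂(f0 x) ≠ ∞) ∧
    ∀ h : Obs 𝒰 𝒵 → ℝ≥0∞, Measurable h →
      ∫⁻ o, h o ∂Q = ∫⁻ x, ((1 - controlProb ps f0 x) * ∫⁻ y, h (true, y, x) ∂(f1 x)
        + controlProb ps f0 x * ∫⁻ y, h (false, y, x) ∂(f0 x)) ∂g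

/-- The Hilbert space of mean zero functions of the observed data with finite variance:
the orthogonal complement of the constants in `L²(P)`. -/
abbrev Hilb (P : Measure (Obs 𝒰 𝒵)) [IsFiniteMeasure P] : Submodule ℝ (Lp ℝ 2 P) :=
  (Submodule.span ℝ {Lp.const 2 P (1 : ℝ)})ᗮ

/-- `S` is the score at `γ = 0` of a parametric submodel `γ ↦ q_γ · P` through the truth `P` along
which `π` stays fixed and the nuisances `g, f₀, f₁` may vary; the submodel is smooth in the usual
sense of differentiability in quadratic mean of its root density. -/
def IsNuisanceScore (ps : ℝ → 𝒰 → ℝ) (P : Measure (Obs 𝒰 𝒵)) [IsFiniteMeasure P]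
    (S : Hilb P) : Prop :=
  ∃ (q : ℝ → Obs 𝒰 𝒵 → ℝ) (δ : ℝ), 0 < δ ∧
    (∀ γ, Measurable (q γ)) ∧ (∀ γ o, 0 ≤ q γ o) ∧ (∀ᵐ o ∂P, q 0 o = 1) ∧
    (∀ γ, |γ| < δ → InModel ps (P.withDensity fun o => ENNReal.ofReal (q γ o))) ∧
    Tendsto (fun γ : ℝ => (γ ^ 2)⁻¹ *
        ∫ o, (√(q γ o) - 1 - γ / 2 * (S : Lp ℝ 2 P) o) ^ 2 ∂P) (𝓝[≠] 0) (𝓝 0)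

/-- The nuisance tangent space `Λ`: the mean squared closure of the span of the scores of all
parametric submodels of the nuisance. -/
abbrev nuisanceTangent (ps : ℝ → 𝒰 → ℝ) (P : Measure (Obs 𝒰 𝒵)) [IsFiniteMeasure P] :
    Submodule ℝ (Hilb P) :=
  (Submodule.span ℝ {S | IsNuisanceScore ps P S}).topologicalClosure

end Tangent

/-! ### Estimators -/

section Estimators

variable {Ω 𝒰 𝒵 : Type*} [MeasurableSpace Ω] [MeasurableSpace 𝒰] [MeasurableSpace 𝒵]

/-- `Δ̂_alt(θ)` computed from a sample of size `n`. -/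
def deltaAlt (ps : ℝ → 𝒰 → ℝ) (n : ℕ) (s : Fin n → Obs 𝒰 𝒵) : ℝ :=
  ((n : ℝ)⁻¹ * ∑ i, ipw ps (s i)) / ((n : ℝ)⁻¹ * ∑ i, ind (s i).1)

/-- (Estimated or true) nuisance components: `e1(x)` for `E₀[{1 - π}⁻¹ ∣ x, 0]`, `e2(x)` for
`E₀[{1 - π}⁻² π ∣ x, 0]`, `e3(x)` for `E₀[Y₀ {1 - π}⁻² π² ∣ x, 0]`, `m1(x)` for `E₁(Y₁ ∣ x, 1)`. -/
structure Nuisance (𝒳 : Type*) where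
  e1 : 𝒳 → ℝ
  e2 : 𝒳 → ℝ
  e3 : 𝒳 → ℝ
  m1 : 𝒳 → ℝ

/-- `w(x)` obtained from `{1 - w(x)}⁻¹ = E₀[{1 - π}⁻¹ ∣ x, 0]`. -/
def Nuisance.w {𝒳 : Type*} (η : Nuisance 𝒳) (x : 𝒳) : ℝ := 1 - (η.e1 x)⁻¹

/-- `B(x)` obtained from `B(x) = {1 - w(x)} E₀[{1 - π}⁻² π ∣ x, 0]`. -/
def Nuisance.B {𝒳 : Type*} (η : Nuisance 𝒳) (x : 𝒳) : ℝ := (1 - η.w x) * η.e2 x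

/-- The true nuisance components. -/
def FullData.nuisance (D : FullData Ω 𝒰 𝒵) (P : Measure Ω) (ps : ℝ → 𝒰 → ℝ) :
    Nuisance (𝒰 × 𝒵) where
  e1 x := D.E00 P (fun y => (1 - ps y x.1)⁻¹) x
  e2 x := D.E00 P (fun y => ((1 - ps y x.1) ^ 2)⁻¹ * ps y x.1) x
  e3 x := D.E00 P (fun y => y * ((1 - ps y x.1) ^ 2)⁻¹ * ps y x.1 ^ 2) x
  m1 x := D.E11 P (fun y => y) x

/-- `η̂` is within `ε` of `η` at `x`, in every component. -/
def Nuisance.Close {𝒳 : Type*} (η' η : Nuisance 𝒳) (ε : ℝ) (x : 𝒳) : Prop :=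
  |η'.e1 x - η.e1 x| ≤ ε ∧ |η'.e2 x - η.e2 x| ≤ ε ∧ |η'.e3 x - η.e3 x| ≤ ε ∧ |η'.m1 x - η.m1 x| ≤ ε

/-- A method of estimating the nuisance components: at sample size `n`, from the observations with
indices in `s`. -/
abbrev Learner (𝒰 𝒵 : Type*) :=
  (n : ℕ) → (s : Finset (Fin n)) → (s → Obs 𝒰 𝒵) → Nuisance (𝒰 × 𝒵)

/-- The estimated nuisance components are jointly measurable in the data and in `x`. -/
def Learner.Meas (L : Learner 𝒰 𝒵) : Prop :=
  ∀ (n : ℕ) (s : Finset (Fin n)),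
    Measurable (fun q : (s → Obs 𝒰 𝒵) × (𝒰 × 𝒵) => (L n s q.1).e1 q.2) ∧
    Measurable (fun q : (s → Obs 𝒰 𝒵) × (𝒰 × 𝒵) => (L n s q.1).e2 q.2) ∧
    Measurable (fun q : (s → Obs 𝒰 𝒵) × (𝒰 × 𝒵) => (L n s q.1).e3 q.2) ∧
    Measurable (fun q : (s → Obs 𝒰 𝒵) × (𝒰 × 𝒵) => (L n s q.1).m1 q.2)

/-- The indices outside the `k`-th fold `I_k = {i : fold i = k}`. -/
def trainSet {n K : ℕ} (fold : Fin n → Fin K) (k : Fin K) : Finset (Fin n) :=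
  Finset.univ.filter fun i => fold i ≠ k

/-- The cross-fitted nuisance estimate `η̂^[-k]`, computed from the data outside the `k`-th fold. -/
def crossFit (L : Learner 𝒰 𝒵) {n K : ℕ} (fold : Fin n → Fin K) (s : Fin n → Obs 𝒰 𝒵) (k : Fin K) :
    Nuisance (𝒰 × 𝒵) :=
  L n (trainSet fold k) fun i => s i

/-- `Δ̂_eff(θ)` computed from a sample of size `n` with cross-fitted nuisance estimates. -/
def deltaEff (ps : ℝ → 𝒰 → ℝ) (L : Learner 𝒰 𝒵) {n K : ℕ} (fold : Fin n → Fin K)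
    (s : Fin n → Obs 𝒰 𝒵) : ℝ :=
  ((n : ℝ)⁻¹ * ∑ i, (resid ps (s i) * (s i).2.1
      - resid ps (s i) * (1 / (crossFit L fold s (fold i)).B (s i).2.2) *
        ((crossFit L fold s (fold i)).w (s i).2.2 * (crossFit L fold s (fold i)).m1 (s i).2.2
          + (1 - (crossFit L fold s (fold i)).w (s i).2.2)
            * (crossFit L fold s (fold i)).e3 (s i).2.2)))
  / ((n : ℝ)⁻¹ * ∑ i, (ind (s i).1
      - resid ps (s i) * ((crossFit L fold s (fold i)).w (s i).2.2
          / (crossFit L fold s (fold i)).B (s i).2.2)))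

/-- `√n (Δ̂ₙ - Δ) = n^(-1/2) ∑ ψ(Wᵢ) + o_p(1)`. -/
def HasInfluenceFunction (μ : Measure Ω) (W : ℕ → Ω → Obs 𝒰 𝒵) (est : ℕ → Ω → ℝ) (Δ : ℝ)
    (ψ : Obs 𝒰 𝒵 → ℝ) : Prop :=
  TendstoInMeasure μ
    (fun (n : ℕ) ω => √(n : ℝ) * (est n ω - Δ) - (√(n : ℝ))⁻¹ * ∑ i ∈ Finset.range n, ψ (W i ω))
    atTop (fun _ => 0)

/-- `√n (Δ̂ₙ - Δ)` converges in distribution to `N(0, v)`. -/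
def HasAsymptoticVariance (μ : Measure Ω) [IsProbabilityMeasure μ] (est : ℕ → Ω → ℝ) (Δ : ℝ)
    (v : ℝ≥0) : Prop :=
  TendstoInDistribution (fun (n : ℕ) ω => √(n : ℝ) * (est n ω - Δ)) atTop (fun z : ℝ => z)
    (fun _ => μ) (gaussianReal 0 v)

/-- Both estimators are `√n`-consistent and asymptotically normal, and `est` has strictly larger
asymptotic variance than `est'`. -/
def LessEfficient (μ : Measure Ω) [IsProbabilityMeasure μ] (est est' : ℕ → Ω → ℝ) (Δ : ℝ) : Prop :=
  ∃ v v' : ℝ≥0, HasAsymptoticVariance μ est Δ v ∧ HasAsymptoticVariance μ est' Δ v' ∧ v' < v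

end Estimators

end ATT

end

/-!
Write `r = (t - π) / (1 - π) = 1 - (1 - t) / (1 - π)` for the residual. Everything rests on three
conditional moments under the law of the observed data: `E(r ∣ x) = 0`, `E(r² ∣ x) = B(x)` and
`E(r φ_alt ∣ x) = p⁻¹ V(x)` (`Setting.condExp_resid`, `Setting.condExp_resid_sq`,
`Setting.condExp_phiAlt_mul_resid`). They follow by iterated expectations from the assignment
model: given `Y₀` and `X`, the indicator `t` may be replaced by `π`.

*The tangent space.* A probability law `Q` belongs to the model if and only if the controls weighted
by `1 / (1 - π)` have the same covariate law as the whole population, that is, `Q(r ∣ x) = 0`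
(`InModel.balanced`, `Balanced.inModel`). This condition is linear in `Q`. So a score `s` of a
submodel satisfies `E(s r ∣ x) = 0` (`IsNuisanceScore.condExp_mul_resid`), and conversely a bounded
mean zero `s` with this property is the score of the path `1 + γ s`, which does not leave the model
(`isNuisanceScore_of_bounded`). Hence `r h(x)` belongs to `Λ^⊥` whenever it is square integrable
(`mem_orthogonal_nuisanceTangent`), and `b` belongs to `Λ` whenever `E(b r ∣ x) = 0`
(`mem_nuisanceTangent`). Since `φ_perp = r p⁻¹ B⁻¹ V` and `E(r² ∣ x) = B`, the difference
`φ = φ_alt - φ_perp` satisfies `E(φ r ∣ x) = 0`; thus `φ` and `φ_perp` are the two projections of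
`φ_alt` (`Setting.exists_projections`). The second moments add up by Pythagoras' theorem, and
`E(φ_perp r ∣ x) = p⁻¹ V(x)` shows that `φ_perp` vanishes exactly when `V(X)` does. As
`E{V(X)} = E{Y₀ π / (1 - π)}` (`Setting.integral_V`), the latter being nonzero is sufficient for
`V(X)` not to vanish.

*The estimators.* Both are ratios `N / D` with `D → p` in probability and
`√n (N - Δ⁰ D) = n^(-1/2) ∑ p ψ(Wᵢ) + o_p(1)`, which gives the influence function `ψ`
(`tendstoInMeasure_ratio`); asymptotic normality is then the central limit theorem with Slutsky's
theorem. For the inverse probability weighted estimator the remainder is zero. For the cross-fitted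
estimator it is `n^(-1/2) ∑ rᵢ {ĥ(Xᵢ) - h(Xᵢ)}` with a regression function `h` of `x` computed from
the nuisances. Given the partition and the data outside a fold, the terms of that fold are
independent, and centered because `E(r ∣ x) = 0`; their variance is small because `ĥ` is close to
`h`. Chebyshev's inequality then shows that the remainder vanishes, with no rate of convergence
required of the nuisance estimates (`tendstoInMeasure_crossFit`).
-/

set_option linter.unusedSectionVars false

noncomputable section

namespace ATT

/-! ### Conditional expectations -/

section CondExp

variable {α β γ : Type*} [MeasurableSpace β] [MeasurableSpace γ]

lemma integral_mul_condExp {m m₀ : MeasurableSpace α} {ν : Measure α} [IsFiniteMeasure ν]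
    (hm : m ≤ m₀) {f g : α → ℝ} (hg : AEStronglyMeasurable[m] g ν)
    (hgf : Integrable (fun a => g a * f a) ν) (hf : Integrable f ν) :
    ∫ a, g a * (ν[f|m]) a ∂ν = ∫ a, g a * f a ∂ν := by
  rw [← integral_condExp (f := fun a => g a * f a) hm]
  exact integral_congr_ae (condExp_mul_of_aestronglyMeasurable_left hg hgf hf).symm

/-- A conditional expectation given a function `x` of `W`, computed before passing to the law of
`W`, is a conditional expectation under that law. -/
lemma condExp_map_ae_eq [MeasurableSpace α] {P : Measure α} [IsFiniteMeasure P] {W : α → β}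
    (hW : Measurable W) {x : β → γ} (hx : Measurable x) {f : β → ℝ} {g : γ → ℝ}
    (hf : Integrable f (P.map W)) (hg : Measurable g)
    (h : P[fun a => f (W a)|MeasurableSpace.comap (fun a => x (W a)) inferInstance]
      =ᵐ[P] fun a => g (x (W a))) :
    (P.map W)[f|MeasurableSpace.comap x inferInstance] =ᵐ[P.map W] fun b => g (x b) := by
  have hfW : Integrable (fun a => f (W a)) P := hf.comp_measurable hW
  have hgW : Integrable (fun a => g (x (W a))) P := integrable_condExp.congr h
  have hgi : Integrable (fun b => g (x b)) (P.map W) :=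
    (integrable_map_measure (hg.comp hx).aestronglyMeasurable hW.aemeasurable).2 hgW
  refine (ae_eq_condExp_of_forall_setIntegral_eq hx.comap_le hf (fun s _ _ => hgi.integrableOn)
    ?_ ?_).symm
  · rintro s ⟨A, hA, rfl⟩ -
    rw [setIntegral_map (hx hA) hgi.1 hW.aemeasurable, setIntegral_map (hx hA) hf.1 hW.aemeasurable]
    have hm : MeasurableSpace.comap (fun a => x (W a)) inferInstance ≤ (inferInstance : MeasurableSpace α) :=
      (hx.comp hW).comap_le
    rw [← setIntegral_condExp hm hfW (s := W ⁻¹' (x ⁻¹' A)) ⟨A, hA, rfl⟩]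
    exact (setIntegral_congr_ae (hW (hx hA)) (h.mono fun a ha _ => ha)).symm
  · exact (hg.comp (comap_measurable x)).aestronglyMeasurable

end CondExp

/-! ### The model as a balance condition -/

section Model

variable {𝒰 𝒵 : Type*}

/-- The inverse probability weight `(1 - t) / (1 - π)` of a control. -/
def ctrlWeight (ps : ℝ → 𝒰 → ℝ) (o : Obs 𝒰 𝒵) : ℝ :=
  (1 - ind o.1) * (1 - ps o.2.1 o.2.2.1)⁻¹

lemma ctrlWeight_nonneg {ps : ℝ → 𝒰 → ℝ} (hps01 : ∀ y u, 0 < ps y u ∧ ps y u < 1)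
    (o : Obs 𝒰 𝒵) : 0 ≤ ctrlWeight ps o := by
  have := hps01 o.2.1 o.2.2.1
  refine mul_nonneg ?_ (inv_nonneg.2 (by linarith))
  unfold ind; split_ifs <;> norm_num

lemma resid_eq_one_sub {ps : ℝ → 𝒰 → ℝ} (hps01 : ∀ y u, 0 < ps y u ∧ ps y u < 1)
    (o : Obs 𝒰 𝒵) : resid ps o = 1 - ctrlWeight ps o := by
  have := hps01 o.2.1 o.2.2.1
  have h : 1 - ps o.2.1 o.2.2.1 ≠ 0 := by linarith
  unfold resid ctrlWeight
  field_simp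
  ring

variable [MeasurableSpace 𝒰] [MeasurableSpace 𝒵]

/-- The covariates of an observation. -/
def obsX (o : Obs 𝒰 𝒵) : 𝒰 × 𝒵 := o.2.2

lemma measurable_obsX : Measurable (obsX : Obs 𝒰 𝒵 → 𝒰 × 𝒵) := measurable_snd.comp measurable_snd

/-- The `σ`-algebra generated by the covariates of an observation. -/
abbrev sigmaX (𝒰 𝒵 : Type*) [MeasurableSpace 𝒰] [MeasurableSpace 𝒵] :
    MeasurableSpace (Obs 𝒰 𝒵) :=
  MeasurableSpace.comap obsX inferInstance

lemma sigmaX_le : sigmaX 𝒰 𝒵 ≤ (inferInstance : MeasurableSpace (Obs 𝒰 𝒵)) := measurable_obsX.comap_le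

lemma measurable_ind : Measurable ind := measurable_from_top

lemma measurable_ps {ps : ℝ → 𝒰 → ℝ} (hps : Measurable fun q : ℝ × 𝒰 => ps q.1 q.2) :
    Measurable fun o : Obs 𝒰 𝒵 => ps o.2.1 o.2.2.1 :=
  hps.comp (measurable_snd.fst.prodMk measurable_snd.snd.fst)

lemma measurable_resid {ps : ℝ → 𝒰 → ℝ} (hps : Measurable fun q : ℝ × 𝒰 => ps q.1 q.2) :
    Measurable (resid ps : Obs 𝒰 𝒵 → ℝ) :=
  ((measurable_ind.comp measurable_fst).sub (measurable_ps hps)).div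
    (measurable_const.sub (measurable_ps hps))

lemma measurable_ctrlWeight {ps : ℝ → 𝒰 → ℝ} (hps : Measurable fun q : ℝ × 𝒰 => ps q.1 q.2) :
    Measurable (ctrlWeight ps : Obs 𝒰 𝒵 → ℝ) :=
  (measurable_const.sub (measurable_ind.comp measurable_fst)).mul
    (measurable_const.sub (measurable_ps hps)).inv

/-- Under `Q` the weighted controls have the same covariate law as the whole population. This
characterises the model. -/
def Balanced (ps : ℝ → 𝒰 → ℝ) (Q : Measure (Obs 𝒰 𝒵)) : Prop :=
  ∀ A : Set (𝒰 × 𝒵), MeasurableSet A →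
    ∫⁻ o in obsX ⁻¹' A, ENNReal.ofReal (ctrlWeight ps o) ∂Q = Q (obsX ⁻¹' A)

lemma one_le_lintegral_inv {ps : ℝ → 𝒰 → ℝ} (hps01 : ∀ y u, 0 < ps y u ∧ ps y u < 1)
    (f0 : Kernel (𝒰 × 𝒵) ℝ) [IsMarkovKernel f0] (x : 𝒰 × 𝒵) :
    1 ≤ ∫⁻ y, ENNReal.ofReal (1 - ps y x.1)⁻¹ ∂(f0 x) := by
  calc (1 : ℝ≥0∞) = ∫⁻ _, 1 ∂(f0 x) := by simp
    _ ≤ _ := lintegral_mono fun y => by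
      rw [ENNReal.one_le_ofReal]
      have := hps01 y x.1
      exact (one_le_inv₀ (by linarith)).2 (by linarith)

lemma InModel.isProbabilityMeasure {ps : ℝ → 𝒰 → ℝ}
    (hps01 : ∀ y u, 0 < ps y u ∧ ps y u < 1) {Q : Measure (Obs 𝒰 𝒵)} (hQ : InModel ps Q) :
    IsProbabilityMeasure Q := by
  obtain ⟨g, f0, f1, hg, hf0, hf1, -, h⟩ := hQ
  have := h (fun _ => 1) measurable_const
  simp only [lintegral_const, one_mul, measure_univ, mul_one] at this
  refine ⟨this.trans ?_⟩
  have e : ∀ x, 1 - controlProb ps f0 x + controlProb ps f0 x = 1 := fun x =>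
    tsub_add_cancel_of_le (ENNReal.inv_le_one.2 (one_le_lintegral_inv hps01 f0 x))
  simp [e]

/-- In the model the weighted controls at `x` have total mass
`{1 - w(x)} ∫ f₀(y ∣ x, 0) / {1 - π(y, u)} dy = 1`. -/
lemma InModel.balanced {ps : ℝ → 𝒰 → ℝ} (hps : Measurable fun q : ℝ × 𝒰 => ps q.1 q.2)
    (hps01 : ∀ y u, 0 < ps y u ∧ ps y u < 1) {Q : Measure (Obs 𝒰 𝒵)} (hQ : InModel ps Q) :
    Balanced ps Q := by
  obtain ⟨g, f0, f1, hg, hf0, hf1, hfin, h⟩ := hQ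
  intro A hA
  have hcA : MeasurableSet (obsX ⁻¹' A : Set (Obs 𝒰 𝒵)) := measurable_obsX hA
  rw [← lintegral_indicator hcA, ← lintegral_indicator_one hcA,
    h _ ((measurable_ctrlWeight hps).ennreal_ofReal.indicator hcA),
    h _ (measurable_one.indicator hcA)]
  refine lintegral_congr_ae ?_
  filter_upwards [hfin] with x hx
  have hI := one_le_lintegral_inv hps01 f0 x
  by_cases hxA : x ∈ A
  · have e1 : ∀ t y, ((t, y, x) : Obs 𝒰 𝒵) ∈ (obsX ⁻¹' A : Set (Obs 𝒰 𝒵)) := fun _ _ => hxA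
    have e2 : 1 - controlProb ps f0 x + controlProb ps f0 x = 1 :=
      tsub_add_cancel_of_le (ENNReal.inv_le_one.2 hI)
    simp only [Set.indicator_of_mem (e1 _ _), Pi.one_apply, lintegral_const, measure_univ, mul_one]
    rw [e2]
    simp only [ctrlWeight, ind, if_true, sub_self, zero_mul, ENNReal.ofReal_zero, lintegral_zero,
      mul_zero, zero_add, Bool.false_eq_true, if_false, sub_zero, one_mul]
    exact ENNReal.inv_mul_cancel (by positivity) hx
  · have e1 : ∀ t y, ((t, y, x) : Obs 𝒰 𝒵) ∉ (obsX ⁻¹' A : Set (Obs 𝒰 𝒵)) := fun _ _ => hxA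
    simp [Set.indicator_of_notMem (e1 _ _)]

/-- Conversely, a balanced law is in the model, with `f₀` and `f₁` its conditional laws of the
outcome given `x` in the two treatment arms: balance forces the conditional probability of `T = 0`
given `x` to be the reciprocal of `∫ f₀(y ∣ x, 0) / {1 - π(y, u)} dy`. -/
lemma Balanced.inModel {ps : ℝ → 𝒰 → ℝ} (hps : Measurable fun q : ℝ × 𝒰 => ps q.1 q.2)
    {Q : Measure (Obs 𝒰 𝒵)}
    [IsProbabilityMeasure Q] (hQ : Balanced ps Q) : InModel ps Q := by
  have hX : Measurable (obsX : Obs 𝒰 𝒵 → 𝒰 × 𝒵) := measurable_obsX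
  let g := Q.map (obsX : Obs 𝒰 𝒵 → 𝒰 × 𝒵)
  have hg : IsProbabilityMeasure g := Measure.isProbabilityMeasure_map hX.aemeasurable
  let E : Bool → Set (Obs 𝒰 𝒵) := fun t => Prod.fst ⁻¹' {t}
  have hE : ∀ t, MeasurableSet (E t) := fun t => measurable_fst (measurableSet_singleton t)
  let R : Bool → Measure (Obs 𝒰 𝒵) := fun t => Q.restrict (E t)
  let f : Bool → Kernel (𝒰 × 𝒵) ℝ := fun t => condDistrib (fun o : Obs 𝒰 𝒵 => o.2.1) obsX (R t)
  let a : Bool → 𝒰 × 𝒵 → ℝ≥0∞ := fun t => ((R t).map obsX).rnDeriv g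
  have hY : Measurable fun o : Obs 𝒰 𝒵 => o.2.1 := measurable_snd.fst
  have hle : ∀ t, (R t).map obsX ≤ g := fun t => Measure.map_mono Measure.restrict_le_self hX
  have hfin : ∀ t, IsFiniteMeasure ((R t).map obsX) := fun t => inferInstance
  have hdens : ∀ t, g.withDensity (a t) = (R t).map obsX := fun t =>
    Measure.withDensity_rnDeriv_eq _ _ (Measure.absolutelyContinuous_of_le (hle t))
  have ha : ∀ t, Measurable (a t) := fun t => Measure.measurable_rnDeriv _ _
  -- disintegration of the law of arm `t`: `a t` is the conditional probability of `T = t` given `x`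
  have key : ∀ t (h : (𝒰 × 𝒵) × ℝ → ℝ≥0∞), Measurable h →
      ∫⁻ o, h (obsX o, o.2.1) ∂(R t) = ∫⁻ x, a t x * ∫⁻ y, h (x, y) ∂(f t x) ∂g := by
    intro t h hh
    rw [← lintegral_map (f := h) (g := fun o : Obs 𝒰 𝒵 => (obsX o, o.2.1)) hh (hX.prodMk hY),
      ← compProd_map_condDistrib hY.aemeasurable, Measure.lintegral_compProd hh, ← hdens t,
      lintegral_withDensity_eq_lintegral_mul _ (ha t)
        (hh.lintegral_kernel_prod_right')]
    rfl
  have hsum : Q = R true + R false := by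
    have : E false = (E true)ᶜ := by ext o; simp [E]
    simp only [R, this]
    exact (Measure.restrict_add_restrict_compl (hE true)).symm
  have hRae : ∀ t, ∀ᵐ o ∂(R t), o.1 = t := fun t =>
    (ae_restrict_iff' (hE t)).2 (ae_of_all _ fun o ho => ho)
  -- the two conditional treatment probabilities add up to one
  have hone : ∀ᵐ x ∂g, a true x + a false x = 1 := by
    refine (ae_eq_of_forall_setLIntegral_eq_of_sigmaFinite ((ha true).add (ha false))
      (measurable_one (α := ℝ≥0∞)) fun A hA _ => ?_)
    rw [lintegral_add_left (ha true), ← withDensity_apply _ hA, ← withDensity_apply _ hA, hdens,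
      hdens, setLIntegral_one, ← Measure.add_apply,
      ← Measure.map_add _ _ hX, ← hsum]
  have hI : Measurable fun q : (𝒰 × 𝒵) × ℝ => ENNReal.ofReal (1 - ps q.2 q.1.1)⁻¹ :=
    (measurable_const.sub (hps.comp (measurable_snd.prodMk measurable_fst.fst))).inv.ennreal_ofReal
  -- balance, localized at `x`
  have hbal : ∀ᵐ x ∂g, a false x * ∫⁻ y, ENNReal.ofReal (1 - ps y x.1)⁻¹ ∂(f false x) = 1 := by
    refine (ae_eq_of_forall_setLIntegral_eq_of_sigmaFinite
      ((ha false).mul hI.lintegral_kernel_prod_right')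
      (measurable_one (α := ℝ≥0∞)) fun A hA _ => ?_)
    have hA' : MeasurableSet {q : (𝒰 × 𝒵) × ℝ | q.1 ∈ A} := measurable_fst hA
    have h1 := key false _ (hI.indicator hA')
    have h2 : ∀ x, (∫⁻ y, {q : (𝒰 × 𝒵) × ℝ | q.1 ∈ A}.indicator
        (fun q => ENNReal.ofReal (1 - ps q.2 q.1.1)⁻¹) (x, y) ∂(f false x))
        = A.indicator (fun x => ∫⁻ y, ENNReal.ofReal (1 - ps y x.1)⁻¹ ∂(f false x)) x := by
      intro x
      by_cases hx : x ∈ A <;> simp [Set.indicator, hx]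
    simp only [h2] at h1
    have h3 : ∀ x, a false x *
        A.indicator (fun x => ∫⁻ y, ENNReal.ofReal (1 - ps y x.1)⁻¹ ∂(f false x)) x
        = A.indicator (fun x => a false x *
          ∫⁻ y, ENNReal.ofReal (1 - ps y x.1)⁻¹ ∂(f false x)) x := by
      intro x
      by_cases hx : x ∈ A <;> simp [hx]
    simp only [h3] at h1
    rw [lintegral_indicator hA] at h1
    rw [setLIntegral_one, ← h1, Measure.map_apply hX hA, ← hQ A hA, ← lintegral_indicator (hX hA), hsum,
      lintegral_add_measure]
    have h4 : ∫⁻ o, (obsX ⁻¹' A).indicator (fun o => ENNReal.ofReal (ctrlWeight ps o)) o ∂(R true)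
        = 0 := by
      rw [lintegral_eq_zero_iff
        ((measurable_ctrlWeight hps).ennreal_ofReal.indicator (hX hA))]
      filter_upwards [hRae true] with o ho
      simp [Set.indicator, ctrlWeight, ind, ho]
    rw [h4, zero_add]
    refine lintegral_congr_ae ?_
    filter_upwards [hRae false] with o ho
    by_cases hx : obsX o ∈ A
    · have hx' : o ∈ obsX ⁻¹' A := hx
      simp [Set.indicator, ctrlWeight, ind, ho, hx, hx']
      rfl
    · have hx' : o ∉ obsX ⁻¹' A := hx
      simp [Set.indicator, hx, hx']
  refine ⟨g, f false, f true, hg, inferInstance, inferInstance, ?_, ?_⟩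
  · -- an infinite integral is excluded since its product with `a false x` is `0` or `∞`, not `1`
    filter_upwards [hbal] with x hx htop
    rw [htop] at hx
    by_cases h0 : a false x = 0
    · simp [h0] at hx
    · simp [ENNReal.mul_top h0] at hx
  · intro h hh
    have hswap : ∀ t, Measurable fun q : (𝒰 × 𝒵) × ℝ => h (t, q.2, q.1) := fun t =>
      hh.comp (measurable_const.prodMk (measurable_snd.prodMk measurable_fst))
    have hpart : ∀ t, ∫⁻ o, h o ∂(R t) = ∫⁻ x, a t x * ∫⁻ y, h (t, y, x) ∂(f t x) ∂g := by
      intro t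
      rw [← key t _ (hswap t)]
      refine lintegral_congr_ae ?_
      filter_upwards [hRae t] with o ho
      rw [← ho]; rfl
    have hm : ∀ t, Measurable fun x => a t x * ∫⁻ y, h (t, y, x) ∂(f t x) := fun t =>
      (ha t).mul (hswap t).lintegral_kernel_prod_right'
    conv_lhs => rw [hsum]
    rw [lintegral_add_measure, hpart, hpart, ← lintegral_add_left (hm true)]
    refine lintegral_congr_ae ?_
    filter_upwards [hone, hbal] with x h1 h2
    have h3 : a false x = controlProb ps (f false) x := ENNReal.eq_inv_of_mul_eq_one_left h2
    have h4 : a true x = 1 - controlProb ps (f false) x := by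
      rw [← h3]
      refine ENNReal.eq_sub_of_add_eq ?_ h1
      exact ne_top_of_le_ne_top ENNReal.one_ne_top (h1 ▸ le_add_self)
    rw [h3, h4]

end Model

/-! ### Scores of submodels that are differentiable in quadratic mean -/

section DQM

/-- If a bounded `f` has mean zero under every density `q γ` of a path through the constant density
`1`, then the score of the path at `0` is orthogonal to `f`. With `√q = 1 + γ S / 2 + γ r` one has
`q - 1 = γ S + 2 γ r + γ² (S / 2 + r)²`, and `r → 0` in mean square. -/
lemma integral_score_mul_eq_zero {α : Type*} [MeasurableSpace α] {ν : Measure α}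
    [IsProbabilityMeasure ν] {q : ℝ → α → ℝ} {S f : α → ℝ} {M δ : ℝ} (hδ : 0 < δ)
    (hS : MemLp S 2 ν) (hf : AEStronglyMeasurable f ν) (hfM : ∀ᵐ a ∂ν, |f a| ≤ M)
    (hq0 : ∀ γ a, 0 ≤ q γ a) (hqi : ∀ γ, |γ| < δ → Integrable (q γ) ν)
    (hf0 : ∫ a, f a ∂ν = 0) (hqf : ∀ γ, |γ| < δ → ∫ a, q γ a * f a ∂ν = 0)
    (hlim : Tendsto (fun γ : ℝ => (γ ^ 2)⁻¹ * ∫ a, (√(q γ a) - 1 - γ / 2 * S a) ^ 2 ∂ν)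
      (𝓝[≠] 0) (𝓝 0)) :
    ∫ a, S a * f a ∂ν = 0 := by
  have hM : 0 ≤ M := by
    obtain ⟨a, ha⟩ := hfM.exists
    exact (abs_nonneg _).trans ha
  set R : ℝ → ℝ := fun γ => (γ ^ 2)⁻¹ * ∫ a, (√(q γ a) - 1 - γ / 2 * S a) ^ 2 ∂ν with hR
  have hSf : Integrable (fun a => S a * f a) ν :=
    (hS.integrable one_le_two).mul_bdd hf hfM
  -- `2 |r| ≤ η + r² / η` makes the linear term in `r` small, for any `η > 0`
  have key : ∀ η : ℝ, 0 < η → ∀ γ : ℝ, γ ≠ 0 → |γ| < δ →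
      |∫ a, S a * f a ∂ν| ≤ M * (η + R γ / η) + |γ| * (M * ((1 / 2) * ∫ a, S a ^ 2 ∂ν + 2 * R γ)) := by
    intro η hη γ hγ hγδ
    -- the remainder of the expansion `√q = 1 + γ (S / 2 + r)`, whose second moment is `R γ`
    let r : α → ℝ := fun a => (√(q γ a) - 1 - γ / 2 * S a) / γ
    have hsq : MemLp (fun a => √(q γ a)) 2 ν := by
      refine (memLp_two_iff_integrable_sq
        (Real.continuous_sqrt.comp_aestronglyMeasurable (hqi γ hγδ).1)).2 ?_
      exact (hqi γ hγδ).congr (ae_of_all _ fun a => (Real.sq_sqrt (hq0 γ a)).symm)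
    have hr : MemLp r 2 ν := by
      have := ((hsq.sub (memLp_const 1)).sub (hS.const_mul (γ / 2))).const_mul γ⁻¹
      refine this.ae_eq (ae_of_all _ fun a => ?_)
      simp only [Pi.sub_apply, r]; ring
    have hr2 : Integrable (fun a => r a ^ 2) ν := hr.integrable_sq
    have hS2 : Integrable (fun a => S a ^ 2) ν := hS.integrable_sq
    have hRr : R γ = ∫ a, r a ^ 2 ∂ν := by
      rw [hR]; simp only
      rw [← integral_const_mul]
      refine integral_congr_ae (ae_of_all _ fun a => ?_)
      simp only [r, div_pow]; field_simp
    have hrf : Integrable (fun a => r a * f a) ν := (hr.integrable one_le_two).mul_bdd hf hfM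
    have hs : MemLp (fun a => S a / 2 + r a) 2 ν := by
      refine ((hS.const_mul 2⁻¹).add hr).ae_eq (ae_of_all _ fun a => ?_)
      simp only [Pi.add_apply]; ring
    have hsf : Integrable (fun a => (S a / 2 + r a) ^ 2 * f a) ν := hs.integrable_sq.mul_bdd hf hfM
    have hqfi : Integrable (fun a => q γ a * f a) ν := (hqi γ hγδ).mul_bdd hf hfM
    have hfi : Integrable f ν := Integrable.of_bound hf M hfM
    have e : ∫ a, S a * f a ∂ν = - (2 * ∫ a, r a * f a ∂ν + γ * ∫ a, (S a / 2 + r a) ^ 2 * f a ∂ν) := by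
      have h1 : ∀ a, γ * (S a * f a) + γ * (2 * (r a * f a)) + γ * (γ * ((S a / 2 + r a) ^ 2 * f a))
          = q γ a * f a - f a := by
        intro a
        have h2 : √(q γ a) = 1 + γ * (S a / 2 + r a) := by
          simp only [r]; field_simp; ring
        have h3 : q γ a = (1 + γ * (S a / 2 + r a)) ^ 2 := by rw [← h2, Real.sq_sqrt (hq0 γ a)]
        rw [h3]; ring
      have h4 : ∫ a, (γ * (S a * f a) + γ * (2 * (r a * f a))
          + γ * (γ * ((S a / 2 + r a) ^ 2 * f a))) ∂ν = 0 := by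
        simp only [h1]
        rw [integral_sub hqfi hfi, hqf γ hγδ, hf0, sub_zero]
      have h12 : Integrable (fun a => γ * (S a * f a) + γ * (2 * (r a * f a))) ν :=
        (hSf.const_mul _).add ((hrf.const_mul _).const_mul _)
      rw [integral_add h12 ((hsf.const_mul _).const_mul _), integral_add (hSf.const_mul _)
        ((hrf.const_mul _).const_mul _)] at h4
      simp only [integral_const_mul] at h4
      have h5 : γ * (∫ a, S a * f a ∂ν + 2 * ∫ a, r a * f a ∂ν
          + γ * ∫ a, (S a / 2 + r a) ^ 2 * f a ∂ν) = 0 := by linarith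
      have := (mul_eq_zero.1 h5).resolve_left hγ
      linarith
    have b1 : |2 * ∫ a, r a * f a ∂ν| ≤ M * (η + R γ / η) := by
      rw [← integral_const_mul, hRr]
      have : ∫ a, M * (η + r a ^ 2 / η) ∂ν = M * (η + (∫ a, r a ^ 2 ∂ν) / η) := by
        rw [integral_const_mul, integral_add (integrable_const _) (hr2.div_const _), integral_div]
        simp
      rw [← this, ← Real.norm_eq_abs]
      refine norm_integral_le_of_norm_le
        (((integrable_const _).add (hr2.div_const _)).const_mul _) ?_
      filter_upwards [hfM] with a ha
      rw [Real.norm_eq_abs, abs_mul, abs_mul, abs_two]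
      have h6 : 2 * |r a| ≤ η + r a ^ 2 / η := by
        have : 0 ≤ (η - |r a|) ^ 2 / η := by positivity
        have h7 : (η - |r a|) ^ 2 / η = η + r a ^ 2 / η - 2 * |r a| := by
          rw [sub_sq, sq_abs]; field_simp; ring
        linarith
      calc 2 * (|r a| * |f a|) = |f a| * (2 * |r a|) := by ring
        _ ≤ M * (η + r a ^ 2 / η) := mul_le_mul ha h6 (by positivity) hM
    have b2 : |∫ a, (S a / 2 + r a) ^ 2 * f a ∂ν| ≤ M * ((1 / 2) * ∫ a, S a ^ 2 ∂ν + 2 * R γ) := by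
      rw [hRr]
      have : ∫ a, M * ((1 / 2) * S a ^ 2 + 2 * r a ^ 2) ∂ν
          = M * ((1 / 2) * ∫ a, S a ^ 2 ∂ν + 2 * ∫ a, r a ^ 2 ∂ν) := by
        rw [integral_const_mul, integral_add (hS2.const_mul _) (hr2.const_mul _),
          integral_const_mul, integral_const_mul]
      rw [← this, ← Real.norm_eq_abs]
      refine norm_integral_le_of_norm_le (((hS2.const_mul _).add (hr2.const_mul _)).const_mul _) ?_
      filter_upwards [hfM] with a ha
      rw [Real.norm_eq_abs, abs_mul, abs_of_nonneg (sq_nonneg _), mul_comm]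
      refine mul_le_mul ha ?_ (sq_nonneg _) hM
      nlinarith [sq_nonneg (S a / 2 - r a)]
    rw [e, abs_neg]
    refine (abs_add_le _ _).trans (add_le_add b1 ?_)
    rw [abs_mul]
    exact mul_le_mul_of_nonneg_left b2 (abs_nonneg _)
  have hbound : ∀ η : ℝ, 0 < η → |∫ a, S a * f a ∂ν| ≤ M * η := by
    intro η hη
    have hid : Tendsto (fun γ : ℝ => |γ|) (𝓝[≠] 0) (𝓝 0) := by
      have : Tendsto (fun γ : ℝ => |γ|) (𝓝 0) (𝓝 |0|) := continuous_abs.tendsto 0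
      rw [abs_zero] at this
      exact this.mono_left nhdsWithin_le_nhds
    have hl : Tendsto (fun γ => M * (η + R γ / η)
        + |γ| * (M * ((1 / 2) * ∫ a, S a ^ 2 ∂ν + 2 * R γ))) (𝓝[≠] 0)
        (𝓝 (M * (η + 0 / η) + 0 * (M * ((1 / 2) * ∫ a, S a ^ 2 ∂ν + 2 * 0)))) :=
      ((((hlim.div_const η).const_add η).const_mul M)).add
        (hid.mul (((hlim.const_mul 2).const_add _).const_mul M))
    have : M * (η + 0 / η) + 0 * (M * ((1 / 2) * ∫ a, S a ^ 2 ∂ν + 2 * 0)) = M * η := by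
      simp
    rw [this] at hl
    refine ge_of_tendsto hl ?_
    have hev : ∀ᶠ γ : ℝ in 𝓝[≠] 0, |γ| < δ := hid.eventually_lt_const hδ
    filter_upwards [hev, self_mem_nhdsWithin] with γ h1 h2 using key η hη γ h2 h1
  have hlim2 : Tendsto (fun η : ℝ => M * η) (𝓝[>] 0) (𝓝 (M * 0)) :=
    ((continuous_const.mul continuous_id).tendsto 0).mono_left nhdsWithin_le_nhds
  have h0 : |∫ a, S a * f a ∂ν| ≤ M * 0 :=
    ge_of_tendsto hlim2 (by filter_upwards [self_mem_nhdsWithin] with η hη using hbound η hη)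
  rw [mul_zero] at h0
  exact abs_nonpos_iff.1 h0

/-- The linear path `1 + γ S` with bounded `S` is differentiable in quadratic mean. -/
lemma tendsto_sqrt_linear_path {α : Type*} [MeasurableSpace α] {ν : Measure α}
    [IsProbabilityMeasure ν] {S : α → ℝ} {C : ℝ} (hC : 0 < C)
    (hSC : ∀ᵐ a ∂ν, |S a| ≤ C) :
    Tendsto (fun γ : ℝ => (γ ^ 2)⁻¹ * ∫ a, (√(max 0 (1 + γ * S a)) - 1 - γ / 2 * S a) ^ 2 ∂ν)
      (𝓝[≠] 0) (𝓝 0) := by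
  have hid : Tendsto (fun γ : ℝ => γ ^ 2 * (C ^ 2) ^ 2) (𝓝[≠] 0) (𝓝 0) := by
    have : Tendsto (fun γ : ℝ => γ ^ 2 * (C ^ 2) ^ 2) (𝓝 0) (𝓝 (0 ^ 2 * (C ^ 2) ^ 2)) :=
      ((continuous_pow 2).mul continuous_const).tendsto 0
    simp only [ne_eq, OfNat.ofNat_ne_zero, not_false_eq_true, zero_pow, zero_mul] at this
    exact this.mono_left nhdsWithin_le_nhds
  have habs : Tendsto (fun γ : ℝ => |γ|) (𝓝[≠] 0) (𝓝 0) := by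
    have : Tendsto (fun γ : ℝ => |γ|) (𝓝 0) (𝓝 |0|) := continuous_abs.tendsto 0
    rw [abs_zero] at this
    exact this.mono_left nhdsWithin_le_nhds
  refine squeeze_zero' (Eventually.of_forall fun γ => ?_) ?_ hid
  · exact mul_nonneg (by positivity) (integral_nonneg fun a => sq_nonneg _)
  · filter_upwards [habs.eventually_lt_const (inv_pos.2 hC), self_mem_nhdsWithin] with γ h1 h2
    have hb : ∫ a, (√(max 0 (1 + γ * S a)) - 1 - γ / 2 * S a) ^ 2 ∂ν ≤ (γ ^ 2 * C ^ 2) ^ 2 := by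
      have : ∫ _ : α, (γ ^ 2 * C ^ 2) ^ 2 ∂ν = (γ ^ 2 * C ^ 2) ^ 2 := by simp
      rw [← this]
      refine integral_mono_of_nonneg (ae_of_all _ fun a => sq_nonneg _) (integrable_const _) ?_
      filter_upwards [hSC] with a ha
      have h3 : |γ * S a| ≤ 1 := by
        rw [abs_mul]
        calc |γ| * |S a| ≤ C⁻¹ * C := mul_le_mul h1.le ha (abs_nonneg _) (by positivity)
          _ = 1 := inv_mul_cancel₀ hC.ne'
      have h4 : 0 ≤ 1 + γ * S a := by linarith [(abs_le.1 h3).1]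
      rw [max_eq_right h4]
      set s := √(1 + γ * S a) with hs
      have hs0 : 0 ≤ s := Real.sqrt_nonneg _
      have hs2 : s ^ 2 = 1 + γ * S a := Real.sq_sqrt h4
      have e1 : s - 1 - γ / 2 * S a = -((s - 1) ^ 2 / 2) := by nlinarith
      have e2 : (s - 1) ^ 2 ≤ (γ * S a) ^ 2 := by
        have : γ * S a = (s - 1) * (s + 1) := by linarith [hs2]
        rw [this, mul_pow]
        nlinarith [sq_nonneg (s - 1), mul_nonneg (sq_nonneg (s - 1)) hs0]
      have e3 : (γ * S a) ^ 2 ≤ γ ^ 2 * C ^ 2 := by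
        rw [mul_pow]
        exact mul_le_mul_of_nonneg_left (sq_le_sq' (abs_le.1 ha).1 (abs_le.1 ha).2) (sq_nonneg _)
      rw [e1, neg_sq]
      refine pow_le_pow_left₀ (by positivity) ?_ 2
      linarith [sq_nonneg (s - 1)]
    calc (γ ^ 2)⁻¹ * ∫ a, (√(max 0 (1 + γ * S a)) - 1 - γ / 2 * S a) ^ 2 ∂ν
        ≤ (γ ^ 2)⁻¹ * (γ ^ 2 * C ^ 2) ^ 2 := mul_le_mul_of_nonneg_left hb (by positivity)
      _ = γ ^ 2 * (C ^ 2) ^ 2 := by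
        have : γ ≠ 0 := h2
        field_simp

end DQM

/-! ### The nuisance tangent space and its orthogonal complement -/

section TangentSpace

variable {𝒰 𝒵 : Type*} [MeasurableSpace 𝒰] [MeasurableSpace 𝒵]

lemma balanced_withDensity_iff {ps : ℝ → 𝒰 → ℝ} (hps : Measurable fun q : ℝ × 𝒰 => ps q.1 q.2)
    (hps01 : ∀ y u, 0 < ps y u ∧ ps y u < 1) {ν : Measure (Obs 𝒰 𝒵)} [IsFiniteMeasure ν] {M : ℝ}
    (hM : ∀ᵐ o ∂ν, |resid ps o| ≤ M) {q : Obs 𝒰 𝒵 → ℝ} (hqm : Measurable q) (hq0 : ∀ o, 0 ≤ q o)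
    (hqi : Integrable q ν) :
    Balanced ps (ν.withDensity fun o => ENNReal.ofReal (q o)) ↔
      ∀ A, MeasurableSet A → ∫ o in obsX ⁻¹' A, q o * resid ps o ∂ν = 0 := by
  have hqr : Integrable (fun o => q o * resid ps o) ν :=
    hqi.mul_bdd (measurable_resid hps).aestronglyMeasurable hM
  have hqc : Integrable (fun o => q o * ctrlWeight ps o) ν := by
    refine (hqi.sub hqr).congr (ae_of_all _ fun o => ?_)
    simp only [Pi.sub_apply, resid_eq_one_sub hps01]; ring
  refine forall₂_congr fun A hA => ?_
  have hA' : MeasurableSet (obsX ⁻¹' A : Set (Obs 𝒰 𝒵)) := measurable_obsX hA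
  rw [withDensity_apply _ hA', setLIntegral_withDensity_eq_setLIntegral_mul _ hqm.ennreal_ofReal
    (measurable_ctrlWeight hps).ennreal_ofReal hA']
  have e1 : ∫⁻ o in obsX ⁻¹' A, ((fun o : Obs 𝒰 𝒵 => ENNReal.ofReal (q o)) *
      fun o : Obs 𝒰 𝒵 => ENNReal.ofReal (ctrlWeight ps o) : Obs 𝒰 𝒵 → ℝ≥0∞) o ∂ν
      = ENNReal.ofReal (∫ o in obsX ⁻¹' A, q o * ctrlWeight ps o ∂ν) := by
    rw [ofReal_integral_eq_lintegral_ofReal hqc.integrableOn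
      (ae_of_all _ fun o => mul_nonneg (hq0 o) (ctrlWeight_nonneg hps01 o))]
    refine lintegral_congr fun o => ?_
    rw [Pi.mul_apply, ENNReal.ofReal_mul (hq0 o)]
  rw [e1, ← ofReal_integral_eq_lintegral_ofReal hqi.integrableOn (ae_of_all _ hq0),
    ENNReal.ofReal_eq_ofReal_iff (integral_nonneg fun o =>
      mul_nonneg (hq0 o) (ctrlWeight_nonneg hps01 o)) (integral_nonneg hq0)]
  have e2 : ∫ o in obsX ⁻¹' A, q o * resid ps o ∂ν
      = ∫ o in obsX ⁻¹' A, q o ∂ν - ∫ o in obsX ⁻¹' A, q o * ctrlWeight ps o ∂ν := by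
    rw [← integral_sub hqi.integrableOn hqc.integrableOn]
    refine integral_congr_ae (ae_of_all _ fun o => ?_)
    simp only [resid_eq_one_sub hps01]; ring
  rw [e2, sub_eq_zero, eq_comm]

lemma integrable_of_isProbabilityMeasure_withDensity {α : Type*} [MeasurableSpace α] {ν : Measure α} {q : α → ℝ}
    (hqm : Measurable q) (hq0 : ∀ o, 0 ≤ q o)
    (h : IsProbabilityMeasure (ν.withDensity fun o => ENNReal.ofReal (q o))) : Integrable q ν := by
  have h1 := h.measure_univ
  rw [withDensity_apply _ MeasurableSet.univ, Measure.restrict_univ] at h1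
  refine ⟨hqm.aestronglyMeasurable, ?_⟩
  rw [hasFiniteIntegral_iff_ofReal (ae_of_all _ hq0), h1]
  exact ENNReal.one_lt_top

/-- A score of the model is orthogonal to every `{t - π} / {1 - π} h(x)`: all laws in the model
assign mean zero to these functions. -/
lemma IsNuisanceScore.condExp_mul_resid {ps : ℝ → 𝒰 → ℝ}
    (hps : Measurable fun q : ℝ × 𝒰 => ps q.1 q.2)
    (hps01 : ∀ y u, 0 < ps y u ∧ ps y u < 1) {ν : Measure (Obs 𝒰 𝒵)} [IsProbabilityMeasure ν] {M : ℝ}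
    (hM : ∀ᵐ o ∂ν, |resid ps o| ≤ M) {S : Hilb ν} (hS : IsNuisanceScore ps ν S) :
    ν[fun o => (S : Lp ℝ 2 ν) o * resid ps o|sigmaX 𝒰 𝒵] =ᵐ[ν] 0 := by
  obtain ⟨q, δ, hδ, hqm, hq0, hq1, hmod, hlim⟩ := hS
  have hS2 : MemLp ((S : Lp ℝ 2 ν) : Obs 𝒰 𝒵 → ℝ) 2 ν := Lp.memLp _
  have hr : AEStronglyMeasurable (resid ps) ν := (measurable_resid hps).aestronglyMeasurable
  have hi : Integrable (fun o => (S : Lp ℝ 2 ν) o * resid ps o) ν :=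
    (hS2.integrable one_le_two).mul_bdd hr hM
  refine (ae_eq_condExp_of_forall_setIntegral_eq sigmaX_le hi
    (fun s _ _ => (integrable_zero _ _ _).integrableOn) ?_ aestronglyMeasurable_zero).symm
  rintro s ⟨A, hA, rfl⟩ -
  have hA' : MeasurableSet (obsX ⁻¹' A : Set (Obs 𝒰 𝒵)) := measurable_obsX hA
  have hqi : ∀ γ, |γ| < δ → Integrable (q γ) ν := fun γ hγ =>
    integrable_of_isProbabilityMeasure_withDensity (hqm γ) (hq0 γ) ((hmod γ hγ).isProbabilityMeasure hps01)
  have hind : ∀ g : Obs 𝒰 𝒵 → ℝ, ∫ o, g o * (obsX ⁻¹' A).indicator (resid ps) o ∂ν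
      = ∫ o in obsX ⁻¹' A, g o * resid ps o ∂ν := by
    intro g
    rw [← integral_indicator hA']
    refine integral_congr_ae (ae_of_all _ fun o => ?_)
    by_cases ho : o ∈ (obsX ⁻¹' A : Set (Obs 𝒰 𝒵)) <;> simp [ho]
  have hzero : ∀ γ, |γ| < δ → ∫ o, q γ o * (obsX ⁻¹' A).indicator (resid ps) o ∂ν = 0 := by
    intro γ hγ
    rw [hind]
    exact (balanced_withDensity_iff hps hps01 hM (hqm γ) (hq0 γ) (hqi γ hγ)).1
      ((hmod γ hγ).balanced hps hps01) A hA
  have h0 : ∫ o, (obsX ⁻¹' A).indicator (resid ps) o ∂ν = 0 := by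
    rw [← hzero 0 (by simpa using hδ)]
    refine integral_congr_ae (hq1.mono fun o ho => ?_)
    simp only [ho, one_mul]
  have := integral_score_mul_eq_zero (ν := ν) (M := M) (q := q)
    (f := (obsX ⁻¹' A).indicator (resid ps)) hδ hS2
    (hr.indicator hA') (hM.mono fun o ho => ?_) hq0 hqi h0 hzero hlim
  · rw [hind] at this
    simp [this]
  · by_cases h : o ∈ (obsX ⁻¹' A : Set (Obs 𝒰 𝒵))
    · simpa [h] using ho
    · simpa [h] using (abs_nonneg _).trans ho

lemma Hilb.integral_eq_zero {ν : Measure (Obs 𝒰 𝒵)} [IsFiniteMeasure ν] (S : Hilb ν) :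
    ∫ o, (S : Lp ℝ 2 ν) o ∂ν = 0 := by
  have h := Submodule.mem_orthogonal_singleton_iff_inner_right.1 S.2
  rw [L2.inner_def] at h
  rw [← h]
  refine integral_congr_ae ?_
  filter_upwards [Lp.coeFn_const (p := 2) (μ := ν) (c := (1 : ℝ))] with o ho
  rw [ho]
  simp

/-- The class in `Hilb ν` of a square integrable function with mean zero. -/
def toHilb {ν : Measure (Obs 𝒰 𝒵)} [IsFiniteMeasure ν] (f : Obs 𝒰 𝒵 → ℝ) (hf : MemLp f 2 ν)
    (h0 : ∫ o, f o ∂ν = 0) : Hilb ν :=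
  ⟨hf.toLp f, by
    rw [Submodule.mem_orthogonal_singleton_iff_inner_right, L2.inner_def, ← h0]
    refine integral_congr_ae ?_
    filter_upwards [Lp.coeFn_const (p := 2) (μ := ν) (c := (1 : ℝ)), hf.coeFn_toLp] with o ho h1
    rw [ho, h1]
    simp⟩

lemma coeFn_toHilb {ν : Measure (Obs 𝒰 𝒵)} [IsFiniteMeasure ν] {f : Obs 𝒰 𝒵 → ℝ} (hf : MemLp f 2 ν)
    (h0 : ∫ o, f o ∂ν = 0) : ((toHilb f hf h0 : Lp ℝ 2 ν) : Obs 𝒰 𝒵 → ℝ) =ᵐ[ν] f :=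
  hf.coeFn_toLp

lemma Hilb.inner_eq {ν : Measure (Obs 𝒰 𝒵)} [IsFiniteMeasure ν] (S T : Hilb ν) :
    inner ℝ S T = ∫ o, (S : Lp ℝ 2 ν) o * (T : Lp ℝ 2 ν) o ∂ν := by
  rw [Submodule.coe_inner, L2.inner_def]
  refine integral_congr_ae (ae_of_all _ fun o => ?_)
  simp [mul_comm]

/-- Every bounded mean zero function `s` with `E[s {t - π} / {1 - π} ∣ x] = 0` is the score of the
path with density `1 + γ s`, which stays in the model because its members are balanced. -/
lemma isNuisanceScore_of_bounded {ps : ℝ → 𝒰 → ℝ}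
    (hps : Measurable fun q : ℝ × 𝒰 => ps q.1 q.2)
    (hps01 : ∀ y u, 0 < ps y u ∧ ps y u < 1) {ν : Measure (Obs 𝒰 𝒵)} [IsProbabilityMeasure ν] {M : ℝ}
    (hM : ∀ᵐ o ∂ν, |resid ps o| ≤ M) (hres : ν[resid ps|sigmaX 𝒰 𝒵] =ᵐ[ν] 0)
    {S : Hilb ν} {C : ℝ} (hC : 0 < C) (hSC : ∀ᵐ o ∂ν, |(S : Lp ℝ 2 ν) o| ≤ C)
    (hSr : ν[fun o => (S : Lp ℝ 2 ν) o * resid ps o|sigmaX 𝒰 𝒵] =ᵐ[ν] 0) :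
    IsNuisanceScore ps ν S := by
  have hS2 : MemLp ((S : Lp ℝ 2 ν) : Obs 𝒰 𝒵 → ℝ) 2 ν := Lp.memLp _
  set s : Obs 𝒰 𝒵 → ℝ := hS2.1.mk _ with hs
  have hsm : Measurable s := hS2.1.stronglyMeasurable_mk.measurable
  have hsS : ((S : Lp ℝ 2 ν) : Obs 𝒰 𝒵 → ℝ) =ᵐ[ν] s := hS2.1.ae_eq_mk
  have hsi : Integrable s ν := (hS2.integrable one_le_two).congr hsS
  have hsC : ∀ᵐ o ∂ν, |s o| ≤ C := by
    filter_upwards [hsS, hSC] with o h1 h2 using h1 ▸ h2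
  have hr : AEStronglyMeasurable (resid ps) ν := (measurable_resid hps).aestronglyMeasurable
  have hri : Integrable (resid ps) ν := Integrable.of_bound hr M hM
  have hpos : ∀ γ, |γ| < C⁻¹ → ∀ᵐ o ∂ν, max 0 (1 + γ * s o) = 1 + γ * s o := by
    intro γ hγ
    filter_upwards [hsC] with o ho
    have h3 : |γ * s o| ≤ 1 := by
      rw [abs_mul]
      calc |γ| * |s o| ≤ C⁻¹ * C := mul_le_mul hγ.le ho (abs_nonneg _) (by positivity)
        _ = 1 := inv_mul_cancel₀ hC.ne'
    exact max_eq_right (by linarith [(abs_le.1 h3).1])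
  have hqm : ∀ γ, Measurable fun o => max 0 (1 + γ * s o) := fun γ =>
    measurable_const.max (measurable_const.add (measurable_const.mul hsm))
  refine ⟨fun γ o => max 0 (1 + γ * s o), C⁻¹, inv_pos.2 hC, hqm, fun γ o => le_max_left _ _,
    ae_of_all _ fun o => by simp, fun γ hγ => ?_, ?_⟩
  · have hlin : Integrable (fun o => 1 + γ * s o) ν := (integrable_const _).add (hsi.const_mul γ)
    have hqi : Integrable (fun o => max 0 (1 + γ * s o)) ν :=
      hlin.congr ((hpos γ hγ).mono fun o ho => ho.symm)
    have hint : ∫ o, max 0 (1 + γ * s o) ∂ν = 1 := by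
      rw [integral_congr_ae (hpos γ hγ), integral_add (integrable_const _) (hsi.const_mul γ),
        integral_const_mul, ← integral_congr_ae hsS, Hilb.integral_eq_zero]
      simp
    have : IsProbabilityMeasure (ν.withDensity fun o => ENNReal.ofReal (max 0 (1 + γ * s o))) := by
      refine ⟨?_⟩
      rw [withDensity_apply _ MeasurableSet.univ, Measure.restrict_univ,
        ← ofReal_integral_eq_lintegral_ofReal hqi (ae_of_all _ fun o => le_max_left _ _), hint,
        ENNReal.ofReal_one]
    refine Balanced.inModel hps ((balanced_withDensity_iff hps hps01 hM (hqm γ)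
      (fun o => le_max_left _ _) hqi).2 fun A hA => ?_)
    have hsA : MeasurableSet[sigmaX 𝒰 𝒵] (obsX ⁻¹' A) := ⟨A, hA, rfl⟩
    have hSri : Integrable (fun o => (S : Lp ℝ 2 ν) o * resid ps o) ν :=
      (hS2.integrable one_le_two).mul_bdd hr hM
    have e : ∀ᵐ o ∂ν, max 0 (1 + γ * s o) * resid ps o
        = resid ps o + γ * ((S : Lp ℝ 2 ν) o * resid ps o) := by
      filter_upwards [hpos γ hγ, hsS] with o h1 h2
      rw [h1, h2]; ring
    rw [setIntegral_congr_ae (measurable_obsX hA) (e.mono fun o ho _ => ho),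
      integral_add hri.integrableOn (hSri.const_mul γ).integrableOn, integral_const_mul,
      ← setIntegral_condExp sigmaX_le hri hsA, ← setIntegral_condExp sigmaX_le hSri hsA,
      setIntegral_congr_ae (measurable_obsX hA) (hres.mono fun o ho _ => ho),
      setIntegral_congr_ae (measurable_obsX hA) (hSr.mono fun o ho _ => ho)]
    simp
  · refine (tendsto_sqrt_linear_path hC hsC).congr fun γ => ?_
    congr 1
    refine integral_congr_ae (hsS.mono fun o ho => ?_)
    simp only [ho]

/-- `Λ^⊥` contains every square integrable `{t - π} / {1 - π} h(x)`. -/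
lemma mem_orthogonal_nuisanceTangent {ps : ℝ → 𝒰 → ℝ}
    (hps : Measurable fun q : ℝ × 𝒰 => ps q.1 q.2)
    (hps01 : ∀ y u, 0 < ps y u ∧ ps y u < 1) {ν : Measure (Obs 𝒰 𝒵)} [IsProbabilityMeasure ν] {M : ℝ}
    (hM : ∀ᵐ o ∂ν, |resid ps o| ≤ M) {r : Hilb ν} {h : Obs 𝒰 𝒵 → ℝ}
    (hh : AEStronglyMeasurable[sigmaX 𝒰 𝒵] h ν)
    (hr : ((r : Lp ℝ 2 ν) : Obs 𝒰 𝒵 → ℝ) =ᵐ[ν] fun o => resid ps o * h o) :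
    r ∈ (nuisanceTangent ps ν)ᗮ := by
  rw [Submodule.orthogonal_closure, Submodule.mem_orthogonal]
  intro S hS
  induction hS using Submodule.span_induction with
  | mem S hS =>
    have hc := IsNuisanceScore.condExp_mul_resid hps hps01 hM hS
    have hS2 : MemLp ((S : Lp ℝ 2 ν) : Obs 𝒰 𝒵 → ℝ) 2 ν := Lp.memLp _
    have hr2 : MemLp ((r : Lp ℝ 2 ν) : Obs 𝒰 𝒵 → ℝ) 2 ν := Lp.memLp _
    have e : (fun o => (S : Lp ℝ 2 ν) o * (r : Lp ℝ 2 ν) o)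
        =ᵐ[ν] fun o => h o * ((S : Lp ℝ 2 ν) o * resid ps o) := by
      filter_upwards [hr] with o ho
      rw [ho]; ring
    rw [Hilb.inner_eq, integral_congr_ae e, ← integral_mul_condExp sigmaX_le hh
      ((hS2.integrable_mul hr2).congr e) ((hS2.integrable one_le_two).mul_bdd
        (measurable_resid hps).aestronglyMeasurable hM)]
    rw [integral_congr_ae (hc.mono fun o ho => by rw [ho, Pi.zero_apply, mul_zero])]
    exact integral_zero _ _
  | zero => exact inner_zero_left _
  | add x y _ _ hx hy => rw [inner_add_left, hx, hy, add_zero]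
  | smul c x _ hx => rw [inner_smul_left, hx, mul_zero]

/-- `Λ` contains every `b` with `E[b {t - π} / {1 - π} ∣ x] = 0`. An element `v` of `Λ^⊥` is
orthogonal to all bounded scores, in particular to the residuals
`1_E - {t - π} / {1 - π} β_E(x) - P(E)`, which forces `v` to be of the form
`{t - π} / {1 - π} h(x)`, hence orthogonal to `b`. -/
lemma mem_nuisanceTangent {ps : ℝ → 𝒰 → ℝ}
    (hps : Measurable fun q : ℝ × 𝒰 => ps q.1 q.2)
    (hps01 : ∀ y u, 0 < ps y u ∧ ps y u < 1) {ν : Measure (Obs 𝒰 𝒵)} [IsProbabilityMeasure ν] {M : ℝ}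
    (hM : ∀ᵐ o ∂ν, |resid ps o| ≤ M) (hres : ν[resid ps|sigmaX 𝒰 𝒵] =ᵐ[ν] 0)
    {β : Obs 𝒰 𝒵 → ℝ} {b₀ : ℝ} (hb₀ : 0 < b₀) (hβm : Measurable[sigmaX 𝒰 𝒵] β)
    (hβ : ∀ᵐ o ∂ν, b₀ ≤ β o)
    (hres2 : ν[fun o => resid ps o ^ 2|sigmaX 𝒰 𝒵] =ᵐ[ν] β) {b : Hilb ν}
    (hb : ν[fun o => (b : Lp ℝ 2 ν) o * resid ps o|sigmaX 𝒰 𝒵] =ᵐ[ν] 0) :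
    b ∈ nuisanceTangent ps ν := by
  have hrm : AEStronglyMeasurable (resid ps) ν := (measurable_resid hps).aestronglyMeasurable
  have hri : Integrable (resid ps) ν := Integrable.of_bound hrm M hM
  have hM0 : 0 ≤ M := by
    obtain ⟨o, ho⟩ := hM.exists
    exact (abs_nonneg _).trans ho
  have hr2i : Integrable (fun o => resid ps o ^ 2) ν := by
    refine (hri.mul_bdd hrm hM).congr (ae_of_all _ fun o => ?_)
    simp only; ring
  rw [nuisanceTangent, ← Submodule.orthogonal_orthogonal_eq_closure, Submodule.mem_orthogonal]
  intro v hv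
  have hv2 : MemLp ((v : Lp ℝ 2 ν) : Obs 𝒰 𝒵 → ℝ) 2 ν := Lp.memLp _
  have hvi : Integrable ((v : Lp ℝ 2 ν) : Obs 𝒰 𝒵 → ℝ) ν := hv2.integrable one_le_two
  have hvr : Integrable (fun o => (v : Lp ℝ 2 ν) o * resid ps o) ν := hvi.mul_bdd hrm hM
  set h : Obs 𝒰 𝒵 → ℝ := fun o =>
    (ν[fun o => (v : Lp ℝ 2 ν) o * resid ps o|sigmaX 𝒰 𝒵]) o / β o with hh
  have hhm : AEStronglyMeasurable[sigmaX 𝒰 𝒵] h ν :=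
    (stronglyMeasurable_condExp.measurable.div hβm).stronglyMeasurable.aestronglyMeasurable
  have hβinv : ∀ᵐ o ∂ν, |(β o)⁻¹| ≤ b₀⁻¹ := by
    filter_upwards [hβ] with o ho
    rw [abs_of_nonneg (inv_nonneg.2 (hb₀.le.trans ho))]
    exact inv_anti₀ hb₀ ho
  have hhi : Integrable h ν := by
    refine (Integrable.mul_bdd (g := fun o => (β o)⁻¹) (c := b₀⁻¹) integrable_condExp ?_ hβinv)
    exact (hβm.inv.mono sigmaX_le le_rfl).aestronglyMeasurable
  have hhr : Integrable (fun o => h o * resid ps o) ν := hhi.mul_bdd hrm hM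
  have hform : ((v : Lp ℝ 2 ν) : Obs 𝒰 𝒵 → ℝ) =ᵐ[ν] fun o => h o * resid ps o := by
    refine Integrable.ae_eq_of_forall_setIntegral_eq _ _ hvi hhr fun E hE _ => ?_
    let f : Obs 𝒰 𝒵 → ℝ := E.indicator fun _ => 1
    have hfm : AEStronglyMeasurable f ν := aestronglyMeasurable_const.indicator hE
    have hf1 : ∀ o, |f o| ≤ 1 := fun o => by
      by_cases ho : o ∈ E <;> simp [f, ho]
    have hfr : Integrable (fun o => f o * resid ps o) ν :=
      hri.bdd_mul hfm (ae_of_all _ hf1)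
    let c : Obs 𝒰 𝒵 → ℝ := ν[fun o => f o * resid ps o|sigmaX 𝒰 𝒵]
    let k : Obs 𝒰 𝒵 → ℝ := fun o => c o / β o
    have hkm : AEStronglyMeasurable[sigmaX 𝒰 𝒵] k ν :=
      (stronglyMeasurable_condExp.measurable.div hβm).stronglyMeasurable.aestronglyMeasurable
    have hcM : ∀ᵐ o ∂ν, |c o| ≤ M := by
      refine ae_bdd_abs_condExp_of_ae_bdd_abs ?_
      filter_upwards [hM] with o ho
      rw [abs_mul]
      calc |f o| * |resid ps o| ≤ 1 * M := mul_le_mul (hf1 o) ho (abs_nonneg _) zero_le_one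
        _ = M := one_mul M
    have hkM : ∀ᵐ o ∂ν, |k o| ≤ M * b₀⁻¹ := by
      filter_upwards [hcM, hβinv] with o h1 h2
      simp only [k, div_eq_mul_inv, abs_mul]
      exact mul_le_mul h1 h2 (abs_nonneg _) hM0
    have hkm' : AEStronglyMeasurable k ν := hkm.mono sigmaX_le
    let d : ℝ := ∫ o, f o ∂ν
    let F : Obs 𝒰 𝒵 → ℝ := fun o => f o - k o * resid ps o - d
    have hFm : AEStronglyMeasurable F ν := (hfm.sub (hkm'.mul hrm)).sub aestronglyMeasurable_const
    have hFb : ∀ᵐ o ∂ν, |F o| ≤ 1 + M * b₀⁻¹ * M + |d| := by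
      filter_upwards [hkM, hM] with o h1 h2
      have h3 : |k o * resid ps o| ≤ M * b₀⁻¹ * M := by
        rw [abs_mul]
        exact mul_le_mul h1 h2 (abs_nonneg _) (by positivity)
      calc |F o| ≤ |f o| + |k o * resid ps o| + |d| :=
            (abs_sub _ _).trans (add_le_add_left (abs_sub _ _) _)
        _ ≤ _ := by linarith [hf1 o]
    have hF2 : MemLp F 2 ν := MemLp.of_bound hFm _ hFb
    have hfi : Integrable f ν := (integrable_const (1 : ℝ)).indicator hE
    have hkr : Integrable (fun o => k o * resid ps o) ν := hri.bdd_mul hkm' hkM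
    have hkr0 : ∫ o, k o * resid ps o ∂ν = 0 := by
      rw [← integral_mul_condExp sigmaX_le hkm hkr hri]
      rw [integral_congr_ae (hres.mono fun o ho => by rw [ho, Pi.zero_apply, mul_zero])]
      exact integral_zero _ _
    have hF0 : ∫ o, F o ∂ν = 0 := by
      have : Integrable (fun o => f o - k o * resid ps o) ν := hfi.sub hkr
      rw [integral_sub this (integrable_const _), integral_sub hfi hkr, hkr0]
      simp [d]
    have hscore : IsNuisanceScore ps ν (toHilb F hF2 hF0) := by
      refine isNuisanceScore_of_bounded hps hps01 hM hres
        (C := 1 + M * b₀⁻¹ * M + |d|) (by positivity) ?_ ?_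
      · filter_upwards [hFb, coeFn_toHilb hF2 hF0] with o h1 h2 using h2 ▸ h1
      · have hkr2 : Integrable (k * fun o => resid ps o ^ 2) ν := hr2i.bdd_mul hkm' hkM
        have e1 : (fun o => (toHilb F hF2 hF0 : Lp ℝ 2 ν) o * resid ps o) =ᵐ[ν]
            (fun o => f o * resid ps o) - (k * fun o => resid ps o ^ 2) - d • resid ps := by
          filter_upwards [coeFn_toHilb hF2 hF0] with o ho
          simp only [ho, F, Pi.sub_apply, Pi.mul_apply, Pi.smul_apply, smul_eq_mul]; ring
        refine (condExp_congr_ae e1).trans ?_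
        refine (condExp_sub (hfr.sub hkr2) (hri.smul d) _).trans ?_
        filter_upwards [condExp_sub hfr hkr2 (sigmaX 𝒰 𝒵), condExp_smul d (resid ps) (sigmaX 𝒰 𝒵),
          condExp_mul_of_aestronglyMeasurable_left hkm hkr2 hr2i, hres, hres2, hβ]
          with o h1 h2 h3 h4 h5 h6
        rw [Pi.sub_apply, h1, h2, Pi.sub_apply, h3, Pi.mul_apply, Pi.smul_apply, h4, h5]
        have : β o ≠ 0 := (hb₀.trans_le h6).ne'
        simp only [k, Pi.zero_apply, smul_zero, sub_zero]
        rw [div_mul_cancel₀ _ this, sub_self]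
    have horth : inner ℝ (toHilb F hF2 hF0) v = 0 :=
      (Submodule.mem_orthogonal _ _).1 hv _ (Submodule.subset_span hscore)
    rw [Hilb.inner_eq] at horth
    have e2 : ∫ o, (toHilb F hF2 hF0 : Lp ℝ 2 ν) o * (v : Lp ℝ 2 ν) o ∂ν
        = ∫ o in E, (v : Lp ℝ 2 ν) o ∂ν - ∫ o, k o * ((v : Lp ℝ 2 ν) o * resid ps o) ∂ν
          - d * ∫ o, (v : Lp ℝ 2 ν) o ∂ν := by
      have i1 : Integrable (E.indicator ((v : Lp ℝ 2 ν) : Obs 𝒰 𝒵 → ℝ)) ν := hvi.indicator hE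
      have i2 : Integrable (fun o => k o * ((v : Lp ℝ 2 ν) o * resid ps o)) ν :=
        hvr.bdd_mul hkm' hkM
      have i3 : Integrable (fun o => E.indicator ((v : Lp ℝ 2 ν) : Obs 𝒰 𝒵 → ℝ) o
        - k o * ((v : Lp ℝ 2 ν) o * resid ps o)) ν := i1.sub i2
      rw [← integral_indicator hE, ← integral_const_mul, ← integral_sub i1 i2,
        ← integral_sub i3 (hvi.const_mul d)]
      refine integral_congr_ae ?_
      filter_upwards [coeFn_toHilb hF2 hF0] with o ho
      rw [ho]
      by_cases hoE : o ∈ E <;> simp [F, f, hoE] <;> ring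
    have i4 : Integrable (fun o => k o * ((v : Lp ℝ 2 ν) o * resid ps o)) ν := hvr.bdd_mul hkm' hkM
    have i5 : Integrable (fun o => h o * (f o * resid ps o)) ν := by
      refine (hhr.bdd_mul hfm (ae_of_all _ hf1)).congr (ae_of_all _ fun o => ?_)
      simp only; ring
    -- both sides integrate `E[v r ∣ x] E[f r ∣ x] / E[r² ∣ x]`, where `r` is the residual
    have e3 : ∫ o, k o * ((v : Lp ℝ 2 ν) o * resid ps o) ∂ν = ∫ o, h o * (f o * resid ps o) ∂ν := by
      rw [← integral_mul_condExp sigmaX_le hkm i4 hvr, ← integral_mul_condExp sigmaX_le hhm i5 hfr]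
      refine integral_congr_ae (ae_of_all _ fun o => ?_)
      simp only [k, h, c]; ring
    rw [e2, e3, Hilb.integral_eq_zero, mul_zero, sub_zero, sub_eq_zero] at horth
    rw [horth, ← integral_indicator hE]
    refine integral_congr_ae (ae_of_all _ fun o => ?_)
    by_cases hoE : o ∈ E <;> simp [f, hoE]
  have hb2 : MemLp ((b : Lp ℝ 2 ν) : Obs 𝒰 𝒵 → ℝ) 2 ν := Lp.memLp _
  have e : (fun o => (v : Lp ℝ 2 ν) o * (b : Lp ℝ 2 ν) o)
      =ᵐ[ν] fun o => h o * ((b : Lp ℝ 2 ν) o * resid ps o) := by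
    filter_upwards [hform] with o ho
    rw [ho]; ring
  rw [Hilb.inner_eq, integral_congr_ae e, ← integral_mul_condExp sigmaX_le hhm
    ((hv2.integrable_mul hb2).congr e) ((hb2.integrable one_le_two).mul_bdd hrm hM),
    integral_congr_ae (hb.mono fun o ho => by rw [ho, Pi.zero_apply, mul_zero])]
  exact integral_zero _ _

end TangentSpace

/-! ### Identification of the nuisance quantities -/

section Identification

/-- The conditional mean of `1_E k(X, Y)` given `X` factors into the conditional probability of `E`
and the mean of `k(X, ·)` under the conditional law of `Y` given `X` and `E`. -/
lemma condExp_indicator_ae_eq_mul_integral_condDistrib {Ω 𝒳 : Type*} [MeasurableSpace Ω]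
    [MeasurableSpace 𝒳] {P : Measure Ω} [IsFiniteMeasure P] {E : Set Ω} (hE : MeasurableSet E)
    (hE0 : P E ≠ 0) {X : Ω → 𝒳} (hX : Measurable X) {Y : Ω → ℝ} (hY : Measurable Y)
    {k : 𝒳 × ℝ → ℝ} (hk : Measurable k) (hi : Integrable (E.indicator fun ω => k (X ω, Y ω)) P) :
    P[E.indicator fun ω => k (X ω, Y ω)|MeasurableSpace.comap X inferInstance] =ᵐ[P]
      fun ω => (P[E.indicator fun _ => (1 : ℝ)|MeasurableSpace.comap X inferInstance]) ω *
        ∫ y, k (X ω, y) ∂(condDistrib Y X (ProbabilityTheory.cond P E) (X ω)) := by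
  have hm := hX.comap_le
  set Q := ProbabilityTheory.cond P E with hQ
  have hQP : Q = (P E)⁻¹ • P.restrict E := rfl
  have hc : (P E)⁻¹ ≠ ∞ := ENNReal.inv_ne_top.2 hE0
  have hc0 : (P E)⁻¹ ≠ 0 := ENNReal.inv_ne_zero.2 (measure_ne_top _ _)
  set G : 𝒳 → ℝ := fun x => ∫ y, k (x, y) ∂(condDistrib Y X Q x) with hG
  have hGm : Measurable G := (hk.stronglyMeasurable.integral_condDistrib).measurable
  have hkm : Measurable fun ω => k (X ω, Y ω) := hk.comp (hX.prodMk hY)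
  have hkE : IntegrableOn (fun ω => k (X ω, Y ω)) E P := (integrable_indicator_iff hE).1 hi
  have hkQ : Integrable (fun ω => k (X ω, Y ω)) Q := hkE.smul_measure hc
  have hcond := condExp_prod_ae_eq_integral_condDistrib hX hY.aemeasurable hk.stronglyMeasurable hkQ
  have hGQ : Integrable (fun ω => G (X ω)) Q := integrable_condExp.congr hcond
  have hGE : IntegrableOn (fun ω => G (X ω)) E P := (integrable_smul_measure hc0 hc).1 hGQ
  have hGi : Integrable (E.indicator fun ω => G (X ω)) P := (integrable_indicator_iff hE).2 hGE
  have hset : P[E.indicator fun ω => G (X ω)|MeasurableSpace.comap X inferInstance] =ᵐ[P]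
      P[E.indicator fun ω => k (X ω, Y ω)|MeasurableSpace.comap X inferInstance] := by
    refine ae_eq_condExp_of_forall_setIntegral_eq hm hi
      (fun s _ _ => integrable_condExp.integrableOn) (fun s hs _ => ?_)
      stronglyMeasurable_condExp.aestronglyMeasurable
    rw [setIntegral_condExp hm hGi hs]
    have hsm : MeasurableSet s := hm s hs
    have hQs : ∀ f : Ω → ℝ, ∫ ω in s, E.indicator f ω ∂P = (P E).toReal * ∫ ω in s, f ω ∂Q := by
      intro f
      rw [setIntegral_indicator hE, hQP, Measure.restrict_smul, integral_smul_measure,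
        Measure.restrict_restrict hsm, ENNReal.toReal_inv, smul_eq_mul, ← mul_assoc,
        mul_inv_cancel₀ (ENNReal.toReal_ne_zero.2 ⟨hE0, measure_ne_top _ _⟩), one_mul]
    rw [hQs, hQs, ← setIntegral_condExp hm hkQ hs,
      setIntegral_congr_ae hsm (hcond.mono fun ω hω _ => hω)]
  have e : (E.indicator fun ω => G (X ω)) = (fun ω => G (X ω)) * E.indicator fun _ => (1 : ℝ) := by
    ext ω
    by_cases h : ω ∈ E <;> simp [h]
  have hpull := condExp_mul_of_stronglyMeasurable_left (μ := P)
    (m := MeasurableSpace.comap X inferInstance)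
    ((hGm.comp (comap_measurable X)).stronglyMeasurable)
    (f := fun ω => G (X ω)) (g := E.indicator fun _ => (1 : ℝ)) (e ▸ hGi)
    ((integrable_const (1 : ℝ)).indicator hE)
  rw [← e] at hpull
  refine hset.symm.trans (hpull.trans (ae_of_all _ fun ω => ?_))
  simp only [Pi.mul_apply, hG]; ring

variable {Ω 𝒰 𝒵 : Type*} [MeasurableSpace Ω] [MeasurableSpace 𝒰] [MeasurableSpace 𝒵]

/-- The assumptions on the population: measurability, square integrability of the observed outcome,
the known assignment mechanism `ps`, and overlap. -/
structure Setting (P : Measure Ω) (D : FullData Ω 𝒰 𝒵) (ps : ℝ → 𝒰 → ℝ) (c : ℝ) : Prop where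
  hT : Measurable D.T
  hY0 : Measurable D.Y0
  hY1 : Measurable D.Y1
  hU : Measurable D.U
  hZ : Measurable D.Z
  hY2 : MemLp D.Y 2 P
  hps : Measurable fun q : ℝ × 𝒰 => ps q.1 q.2
  hps01 : ∀ y u, 0 < ps y u ∧ ps y u < 1
  hassign : P[(D.ev true).indicator (fun _ => (1 : ℝ)) |
      MeasurableSpace.comap (fun ω => (D.Y0 ω, D.X ω)) inferInstance]
    =ᵐ[P] fun ω => ps (D.Y0 ω) (D.U ω)
  hc : 0 < c
  hoverlap : ∀ᵐ ω ∂P, c < ps (D.Y0 ω) (D.U ω) ∧ ps (D.Y0 ω) (D.U ω) < 1 - c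

/-- The treatment probability `π(Y₀, U)`. -/
def FullData.prob (D : FullData Ω 𝒰 𝒵) (ps : ℝ → 𝒰 → ℝ) (ω : Ω) : ℝ := ps (D.Y0 ω) (D.U ω)

/-- The treatment indicator as a real random variable. -/
def FullData.treat (D : FullData Ω 𝒰 𝒵) (ω : Ω) : ℝ := ind (D.T ω)

/-- The `σ`-algebra generated by the covariates. -/
abbrev FullData.sigmaX (D : FullData Ω 𝒰 𝒵) : MeasurableSpace Ω :=
  MeasurableSpace.comap D.X inferInstance

/-- The `σ`-algebra generated by the untreated outcome and the covariates. -/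
abbrev FullData.sigmaY0X (D : FullData Ω 𝒰 𝒵) : MeasurableSpace Ω :=
  MeasurableSpace.comap (fun ω => (D.Y0 ω, D.X ω)) inferInstance

lemma FullData.indicator_ev_true (D : FullData Ω 𝒰 𝒵) (f : Ω → ℝ) :
    (D.ev true).indicator f = fun ω => D.treat ω * f ω := by
  ext ω
  by_cases h : D.T ω = true <;> simp [FullData.ev, FullData.treat, ind, Set.indicator, h]

lemma FullData.indicator_ev_false (D : FullData Ω 𝒰 𝒵) (f : Ω → ℝ) :
    (D.ev false).indicator f = fun ω => (1 - D.treat ω) * f ω := by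
  ext ω
  by_cases h : D.T ω = true <;> simp [FullData.ev, FullData.treat, ind, Set.indicator, h]

lemma FullData.treat_eq (D : FullData Ω 𝒰 𝒵) (ω : Ω) : D.treat ω = 0 ∨ D.treat ω = 1 := by
  unfold FullData.treat ind; split_ifs <;> simp

namespace Setting

variable {P : Measure Ω} [IsProbabilityMeasure P] {D : FullData Ω 𝒰 𝒵} {ps : ℝ → 𝒰 → ℝ} {c : ℝ}

lemma measurable_X (H : Setting P D ps c) : Measurable D.X := H.hU.prodMk H.hZ

lemma measurable_treat (H : Setting P D ps c) : Measurable D.treat := measurable_ind.comp H.hT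

lemma measurable_Y (H : Setting P D ps c) : Measurable D.Y :=
  (H.measurable_treat.mul H.hY1).add ((measurable_const.sub H.measurable_treat).mul H.hY0)

lemma measurable_W (H : Setting P D ps c) : Measurable D.W :=
  H.hT.prodMk (H.measurable_Y.prodMk H.measurable_X)

lemma measurable_prob (H : Setting P D ps c) : Measurable (D.prob ps) :=
  H.hps.comp (H.hY0.prodMk H.hU)

lemma measurableSet_ev (H : Setting P D ps c) (t : Bool) : MeasurableSet (D.ev t) :=
  H.hT (measurableSet_singleton t)

lemma c_lt_half (H : Setting P D ps c) : c < 1 / 2 := by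
  obtain ⟨ω, h1, h2⟩ := H.hoverlap.exists
  linarith

lemma abs_treat_le (D : FullData Ω 𝒰 𝒵) (ω : Ω) : |D.treat ω| ≤ 1 := by
  rcases D.treat_eq ω with h | h <;> simp [h]

lemma abs_one_sub_treat_le (D : FullData Ω 𝒰 𝒵) (ω : Ω) : |1 - D.treat ω| ≤ 1 := by
  rcases D.treat_eq ω with h | h <;> simp [h]

lemma prob_mem (H : Setting P D ps c) (ω : Ω) : 0 < D.prob ps ω ∧ D.prob ps ω < 1 :=
  H.hps01 _ _

lemma abs_prob_le (H : Setting P D ps c) (ω : Ω) : |D.prob ps ω| ≤ 1 := by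
  have := H.prob_mem ω
  rw [abs_of_pos this.1]; exact this.2.le

lemma integrable_treat (H : Setting P D ps c) : Integrable D.treat P :=
  Integrable.of_bound H.measurable_treat.aestronglyMeasurable 1 (ae_of_all _ (abs_treat_le D))

lemma integrable_prob (H : Setting P D ps c) : Integrable (D.prob ps) P :=
  Integrable.of_bound H.measurable_prob.aestronglyMeasurable 1 (ae_of_all _ H.abs_prob_le)

/-- Given the covariates, the treatment indicator may be replaced by `π(Y₀, U)` in front of a
function of `Y₀` and `X`. -/
lemma condExp_treat_mul (H : Setting P D ps c) {k : (𝒰 × 𝒵) × ℝ → ℝ} (hk : Measurable k)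
    (hi : Integrable (fun ω => k (D.X ω, D.Y0 ω)) P) :
    P[fun ω => D.treat ω * k (D.X ω, D.Y0 ω)|D.sigmaX] =ᵐ[P]
      P[fun ω => D.prob ps ω * k (D.X ω, D.Y0 ω)|D.sigmaX] := by
  have hYX : Measurable fun ω => (D.Y0 ω, D.X ω) := H.hY0.prodMk H.measurable_X
  have hle : D.sigmaY0X ≤ (inferInstance : MeasurableSpace Ω) := hYX.comap_le
  have hXle : D.sigmaX ≤ D.sigmaY0X := by
    rintro s ⟨A, hA, rfl⟩
    exact ⟨Prod.snd ⁻¹' A, measurable_snd hA, rfl⟩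
  have hkm : StronglyMeasurable[D.sigmaY0X] fun ω => k (D.X ω, D.Y0 ω) :=
    ((hk.comp measurable_swap).comp (comap_measurable fun ω => (D.Y0 ω, D.X ω))).stronglyMeasurable
  have h1 := H.hassign
  rw [D.indicator_ev_true] at h1
  simp only [mul_one] at h1
  have h2 := condExp_mul_of_stronglyMeasurable_right (μ := P) (f := D.treat) hkm
    (hi.bdd_mul H.measurable_treat.aestronglyMeasurable (ae_of_all _ (abs_treat_le D)))
    H.integrable_treat
  have h3 : P[fun ω => D.treat ω * k (D.X ω, D.Y0 ω)|D.sigmaY0X] =ᵐ[P]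
      fun ω => D.prob ps ω * k (D.X ω, D.Y0 ω) := by
    refine h2.trans ?_
    filter_upwards [h1] with ω hω
    rw [Pi.mul_apply]
    exact congrArg (· * _) hω
  exact (condExp_condExp_of_le hXle hle).symm.trans (condExp_congr_ae h3)

lemma condExp_one_sub_treat_mul (H : Setting P D ps c) {k : (𝒰 × 𝒵) × ℝ → ℝ} (hk : Measurable k)
    (hi : Integrable (fun ω => k (D.X ω, D.Y0 ω)) P) :
    P[fun ω => (1 - D.treat ω) * k (D.X ω, D.Y0 ω)|D.sigmaX] =ᵐ[P]
      P[fun ω => (1 - D.prob ps ω) * k (D.X ω, D.Y0 ω)|D.sigmaX] := by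
  have i1 : Integrable (fun ω => D.treat ω * k (D.X ω, D.Y0 ω)) P :=
    hi.bdd_mul H.measurable_treat.aestronglyMeasurable (ae_of_all _ (abs_treat_le D))
  have i2 : Integrable (fun ω => D.prob ps ω * k (D.X ω, D.Y0 ω)) P :=
    hi.bdd_mul H.measurable_prob.aestronglyMeasurable (ae_of_all _ H.abs_prob_le)
  have e1 : (fun ω => (1 - D.treat ω) * k (D.X ω, D.Y0 ω))
      = (fun ω => k (D.X ω, D.Y0 ω)) - fun ω => D.treat ω * k (D.X ω, D.Y0 ω) := by
    ext ω; simp only [Pi.sub_apply]; ring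
  have e2 : (fun ω => (1 - D.prob ps ω) * k (D.X ω, D.Y0 ω))
      = (fun ω => k (D.X ω, D.Y0 ω)) - fun ω => D.prob ps ω * k (D.X ω, D.Y0 ω) := by
    ext ω; simp only [Pi.sub_apply]; ring
  rw [e1, e2]
  refine (condExp_sub hi i1 _).trans (EventuallyEq.trans ?_ (condExp_sub hi i2 _).symm)
  exact (EventuallyEq.refl _ _).sub (H.condExp_treat_mul hk hi)

lemma integral_treat_mul (H : Setting P D ps c) {k : (𝒰 × 𝒵) × ℝ → ℝ} (hk : Measurable k)
    (hi : Integrable (fun ω => k (D.X ω, D.Y0 ω)) P) :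
    ∫ ω, D.treat ω * k (D.X ω, D.Y0 ω) ∂P = ∫ ω, D.prob ps ω * k (D.X ω, D.Y0 ω) ∂P := by
  rw [← integral_condExp H.measurable_X.comap_le, integral_congr_ae (H.condExp_treat_mul hk hi),
    integral_condExp H.measurable_X.comap_le]

lemma integral_one_sub_treat_mul (H : Setting P D ps c) {k : (𝒰 × 𝒵) × ℝ → ℝ} (hk : Measurable k)
    (hi : Integrable (fun ω => k (D.X ω, D.Y0 ω)) P) :
    ∫ ω, (1 - D.treat ω) * k (D.X ω, D.Y0 ω) ∂P
      = ∫ ω, (1 - D.prob ps ω) * k (D.X ω, D.Y0 ω) ∂P := by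
  rw [← integral_condExp H.measurable_X.comap_le,
    integral_congr_ae (H.condExp_one_sub_treat_mul hk hi), integral_condExp H.measurable_X.comap_le]

/-- `Y₀` is observed on the controls only. Overlap carries integrability over to the whole population,
since `E(min(|Y₀|, n)) ≤ c⁻¹ E{(1 - T) min(|Y₀|, n)}` for all `n`. -/
lemma integrable_Y0 (H : Setting P D ps c) : Integrable D.Y0 P := by
  have hYi : Integrable D.Y P := H.hY2.integrable one_le_two
  refine ⟨H.hY0.aestronglyMeasurable, ?_⟩
  have hb : ∀ n : ℕ, ∫⁻ ω, ENNReal.ofReal (min |D.Y0 ω| n) ∂P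
      ≤ ENNReal.ofReal (c⁻¹ * ∫ ω, |D.Y ω| ∂P) := by
    intro n
    have hkm : Measurable fun q : (𝒰 × 𝒵) × ℝ => min |q.2| (n : ℝ) :=
      (measurable_snd.abs).min measurable_const
    have hnn : ∀ ω, 0 ≤ min |D.Y0 ω| (n : ℝ) := fun ω => le_min (abs_nonneg _) n.cast_nonneg
    have hi : Integrable (fun ω => min |D.Y0 ω| (n : ℝ)) P := by
      refine Integrable.of_bound (hkm.comp (H.measurable_X.prodMk H.hY0)).aestronglyMeasurable n
        (ae_of_all _ fun ω => ?_)
      rw [Real.norm_eq_abs, abs_of_nonneg (hnn ω)]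
      exact min_le_right _ _
    rw [← ofReal_integral_eq_lintegral_ofReal hi (ae_of_all _ hnn)]
    refine ENNReal.ofReal_le_ofReal ?_
    have h1 := H.integral_treat_mul (k := fun q => min |q.2| (n : ℝ)) hkm hi
    have i1 : Integrable (fun ω => D.treat ω * min |D.Y0 ω| (n : ℝ)) P :=
      hi.bdd_mul H.measurable_treat.aestronglyMeasurable (ae_of_all _ (abs_treat_le D))
    have i2 : Integrable (fun ω => D.prob ps ω * min |D.Y0 ω| (n : ℝ)) P :=
      hi.bdd_mul H.measurable_prob.aestronglyMeasurable (ae_of_all _ H.abs_prob_le)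
    have h2 : c * ∫ ω, min |D.Y0 ω| (n : ℝ) ∂P ≤ ∫ ω, |D.Y ω| ∂P := by
      calc c * ∫ ω, min |D.Y0 ω| (n : ℝ) ∂P = ∫ ω, c * min |D.Y0 ω| (n : ℝ) ∂P :=
            (integral_const_mul _ _).symm
        _ ≤ ∫ ω, (min |D.Y0 ω| (n : ℝ) - D.prob ps ω * min |D.Y0 ω| (n : ℝ)) ∂P := by
            refine integral_mono_ae (hi.const_mul c) (hi.sub i2) ?_
            filter_upwards [H.hoverlap] with ω hω
            have : D.prob ps ω < 1 - c := hω.2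
            nlinarith [hnn ω]
        _ = ∫ ω, (min |D.Y0 ω| (n : ℝ) - D.treat ω * min |D.Y0 ω| (n : ℝ)) ∂P := by
            rw [integral_sub hi i2, integral_sub hi i1, ← h1]
        _ ≤ ∫ ω, |D.Y ω| ∂P := by
            refine integral_mono (hi.sub i1) hYi.abs fun ω => ?_
            rcases D.treat_eq ω with h | h
            · have : D.Y ω = D.Y0 ω := by
                have h' : ind (D.T ω) = 0 := h
                simp [FullData.Y, h']
              simp [h, this]
            · simp [h]
    rw [inv_mul_eq_div, le_div_iff₀ H.hc]
    linarith
  have hlim : Tendsto (fun n : ℕ => ∫⁻ ω, ENNReal.ofReal (min |D.Y0 ω| n) ∂P) atTop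
      (𝓝 (∫⁻ ω, ENNReal.ofReal |D.Y0 ω| ∂P)) := by
    refine lintegral_tendsto_of_tendsto_of_monotone
      (fun n => ((H.hY0.abs.min measurable_const).ennreal_ofReal).aemeasurable)
      (ae_of_all _ fun ω n m hnm => ENNReal.ofReal_le_ofReal
        (min_le_min_left _ (Nat.cast_le.2 hnm))) (ae_of_all _ fun ω => ?_)
    obtain ⟨N, hN⟩ := exists_nat_ge |D.Y0 ω|
    refine tendsto_const_nhds.congr' ?_
    filter_upwards [eventually_ge_atTop N] with n hn
    rw [min_eq_left (hN.trans (Nat.cast_le.2 hn))]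
  rw [hasFiniteIntegral_iff_norm]
  simp only [Real.norm_eq_abs]
  exact (le_of_tendsto' hlim hb).trans_lt ENNReal.ofReal_lt_top

end Setting

end Identification

/-! ### The treatment probability given the covariates -/

section Moments

variable {Ω 𝒰 𝒵 : Type*} [MeasurableSpace Ω] [MeasurableSpace 𝒰] [MeasurableSpace 𝒵]

namespace Setting

variable {P : Measure Ω} [IsProbabilityMeasure P] {D : FullData Ω 𝒰 𝒵} {ps : ℝ → 𝒰 → ℝ} {c : ℝ}

lemma sigmaX_le (H : Setting P D ps c) : D.sigmaX ≤ (inferInstance : MeasurableSpace Ω) :=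
  H.measurable_X.comap_le

lemma p_eq_integral_treat (H : Setting P D ps c) : D.p P = ∫ ω, D.treat ω ∂P := by
  have := integral_indicator_one (μ := P) (H.measurableSet_ev true)
  rw [FullData.p, ← this]
  refine integral_congr_ae (ae_of_all _ fun ω => ?_)
  have := congrFun (D.indicator_ev_true 1) ω
  simpa using this

lemma p_eq_integral_prob (H : Setting P D ps c) : D.p P = ∫ ω, D.prob ps ω ∂P := by
  have := H.integral_treat_mul (k := fun _ => 1) measurable_const (integrable_const _)
  simpa [H.p_eq_integral_treat] using this

lemma p_pos (H : Setting P D ps c) : 0 < D.p P := by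
  have h : ∫ _ : Ω, c ∂P ≤ ∫ ω, D.prob ps ω ∂P :=
    integral_mono_ae (integrable_const _) H.integrable_prob (H.hoverlap.mono fun ω hω => hω.1.le)
  rw [H.p_eq_integral_prob]
  simp only [integral_const, probReal_univ, one_smul] at h
  exact H.hc.trans_le h

lemma p_lt_one (H : Setting P D ps c) : D.p P < 1 := by
  have h : ∫ ω, D.prob ps ω ∂P ≤ ∫ _ : Ω, (1 - c) ∂P :=
    integral_mono_ae H.integrable_prob (integrable_const _) (H.hoverlap.mono fun ω hω => hω.2.le)
  rw [H.p_eq_integral_prob]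
  simp only [integral_const, probReal_univ, one_smul] at h
  linarith [H.hc]

lemma measure_ev_ne_zero (H : Setting P D ps c) (t : Bool) : P (D.ev t) ≠ 0 := by
  have ht : P (D.ev true) ≠ 0 := fun h => H.p_pos.ne' (by simp [FullData.p, Measure.real, h])
  cases t
  · intro h
    have he : D.ev false = (D.ev true)ᶜ := by
      ext ω; simp [FullData.ev]
    rw [he, prob_compl_eq_zero_iff (H.measurableSet_ev true)] at h
    exact H.p_lt_one.ne (by simp [FullData.p, Measure.real, h])
  · exact ht

lemma condExp_treat (H : Setting P D ps c) :
    P[D.treat|D.sigmaX] =ᵐ[P] fun ω => D.w P (D.X ω) := by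
  have h := condDistrib_ae_eq_condExp (μ := P) H.measurable_X H.hT (measurableSet_singleton true)
  have e : (D.T ⁻¹' {true}).indicator (fun _ => (1 : ℝ)) = D.treat := by
    have := D.indicator_ev_true fun _ => 1
    simpa [FullData.ev] using! this
  rw [e] at h
  exact h.symm

lemma condExp_treat_eq_condExp_prob (H : Setting P D ps c) :
    P[D.treat|D.sigmaX] =ᵐ[P] P[D.prob ps|D.sigmaX] := by
  have := H.condExp_treat_mul (k := fun _ => 1) measurable_const (integrable_const _)
  simpa using! this

lemma w_mem (H : Setting P D ps c) : ∀ᵐ ω ∂P, c ≤ D.w P (D.X ω) ∧ D.w P (D.X ω) ≤ 1 - c := by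
  have h1 : P[fun _ => c|D.sigmaX] ≤ᵐ[P] P[D.prob ps|D.sigmaX] :=
    condExp_mono (integrable_const _) H.integrable_prob (H.hoverlap.mono fun ω hω => hω.1.le)
  have h2 : P[D.prob ps|D.sigmaX] ≤ᵐ[P] P[fun _ => 1 - c|D.sigmaX] :=
    condExp_mono H.integrable_prob (integrable_const _) (H.hoverlap.mono fun ω hω => hω.2.le)
  rw [condExp_const H.sigmaX_le] at h1 h2
  filter_upwards [h1, h2, H.condExp_treat, H.condExp_treat_eq_condExp_prob] with ω a1 a2 a3 a4
  rw [← a3, a4]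
  exact ⟨a1, a2⟩

lemma condExp_one_sub_treat (H : Setting P D ps c) :
    P[fun ω => 1 - D.treat ω|D.sigmaX] =ᵐ[P] fun ω => 1 - D.w P (D.X ω) := by
  have h := condExp_sub (integrable_const (1 : ℝ)) H.integrable_treat (μ := P) D.sigmaX
  rw [condExp_const H.sigmaX_le] at h
  refine h.trans ?_
  filter_upwards [H.condExp_treat] with ω hω
  rw [Pi.sub_apply, hω]

lemma condExp_treat_mul_Y1 (H : Setting P D ps c) {k : (𝒰 × 𝒵) × ℝ → ℝ} (hk : Measurable k)
    (hi : Integrable (fun ω => D.treat ω * k (D.X ω, D.Y1 ω)) P) :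
    P[fun ω => D.treat ω * k (D.X ω, D.Y1 ω)|D.sigmaX] =ᵐ[P]
      fun ω => D.w P (D.X ω) * D.E11 P (fun y => k (D.X ω, y)) (D.X ω) := by
  have h := condExp_indicator_ae_eq_mul_integral_condDistrib (H.measurableSet_ev true)
    (H.measure_ev_ne_zero true) H.measurable_X H.hY1 hk (by rw [D.indicator_ev_true]; exact hi)
  rw [D.indicator_ev_true, D.indicator_ev_true] at h
  simp only [mul_one] at h
  refine h.trans ?_
  filter_upwards [H.condExp_treat] with ω hω
  exact congrArg (· * _) hω

lemma condExp_one_sub_treat_mul_Y0 (H : Setting P D ps c) {k : (𝒰 × 𝒵) × ℝ → ℝ} (hk : Measurable k)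
    (hi : Integrable (fun ω => (1 - D.treat ω) * k (D.X ω, D.Y0 ω)) P) :
    P[fun ω => (1 - D.treat ω) * k (D.X ω, D.Y0 ω)|D.sigmaX] =ᵐ[P]
      fun ω => (1 - D.w P (D.X ω)) * D.E00 P (fun y => k (D.X ω, y)) (D.X ω) := by
  have h := condExp_indicator_ae_eq_mul_integral_condDistrib (H.measurableSet_ev false)
    (H.measure_ev_ne_zero false) H.measurable_X H.hY0 hk (by rw [D.indicator_ev_false]; exact hi)
  rw [D.indicator_ev_false, D.indicator_ev_false] at h
  simp only [mul_one] at h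
  refine h.trans ?_
  filter_upwards [H.condExp_one_sub_treat] with ω hω
  exact congrArg (· * _) hω

/-! ### Bounds on the treatment probability and measurability of the nuisances -/

lemma measurable_ps_swap (H : Setting P D ps c) :
    Measurable fun q : (𝒰 × 𝒵) × ℝ => ps q.2 q.1.1 :=
  H.hps.comp (measurable_snd.prodMk measurable_fst.fst)

lemma one_sub_prob_pos (H : Setting P D ps c) (ω : Ω) : 0 < 1 - D.prob ps ω := by
  linarith [(H.prob_mem ω).2]

lemma inv_one_sub_prob_le (H : Setting P D ps c) : ∀ᵐ ω ∂P, (1 - D.prob ps ω)⁻¹ ≤ c⁻¹ := by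
  filter_upwards [H.hoverlap] with ω hω
  have : D.prob ps ω < 1 - c := hω.2
  exact inv_anti₀ H.hc (by linarith)

lemma integrable_inv (H : Setting P D ps c) : Integrable (fun ω => (1 - D.prob ps ω)⁻¹) P := by
  refine Integrable.of_bound (measurable_const.sub H.measurable_prob).inv.aestronglyMeasurable c⁻¹ ?_
  filter_upwards [H.inv_one_sub_prob_le] with ω hω
  rwa [Real.norm_eq_abs, abs_of_pos (inv_pos.2 (H.one_sub_prob_pos ω))]

lemma integrable_inv_mul (H : Setting P D ps c) :
    Integrable (fun ω => (1 - D.prob ps ω)⁻¹ * D.prob ps ω) P :=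
  H.integrable_inv.mul_bdd H.measurable_prob.aestronglyMeasurable (ae_of_all _ H.abs_prob_le)

lemma integrable_inv_sq_mul (H : Setting P D ps c) :
    Integrable (fun ω => ((1 - D.prob ps ω) ^ 2)⁻¹ * D.prob ps ω) P := by
  have hm := (measurable_const.sub H.measurable_prob).inv.aestronglyMeasurable (μ := P) (f := fun ω => (1 - D.prob ps ω)⁻¹)
  refine (H.integrable_inv_mul.bdd_mul (c := c⁻¹) hm ?_).congr (ae_of_all _ fun ω => ?_)
  · filter_upwards [H.inv_one_sub_prob_le] with ω hω
    rwa [Real.norm_eq_abs, abs_of_pos (inv_pos.2 (H.one_sub_prob_pos ω))]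
  · have := (H.one_sub_prob_pos ω).ne'
    simp only; field_simp

/-- `π² / (1 - π)²` is almost surely at most `c⁻²`. -/
lemma sq_odds_le (H : Setting P D ps c) :
    ∀ᵐ ω ∂P, |((1 - D.prob ps ω) ^ 2)⁻¹ * D.prob ps ω ^ 2| ≤ (c⁻¹) ^ 2 := by
  filter_upwards [H.inv_one_sub_prob_le] with ω hω
  have h1 := H.prob_mem ω
  have h2 := inv_pos.2 (H.one_sub_prob_pos ω)
  rw [← inv_pow, ← mul_pow, abs_of_nonneg (sq_nonneg _)]
  refine pow_le_pow_left₀ (mul_nonneg h2.le h1.1.le) ?_ 2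
  nlinarith

lemma measurable_sq_odds (H : Setting P D ps c) :
    Measurable fun ω => ((1 - D.prob ps ω) ^ 2)⁻¹ * D.prob ps ω ^ 2 :=
  ((measurable_const.sub H.measurable_prob).pow_const 2).inv.mul (H.measurable_prob.pow_const 2)

lemma integrable_sq_odds (H : Setting P D ps c) :
    Integrable (fun ω => ((1 - D.prob ps ω) ^ 2)⁻¹ * D.prob ps ω ^ 2) P :=
  Integrable.of_bound H.measurable_sq_odds.aestronglyMeasurable _ H.sq_odds_le

lemma measurable_w (D : FullData Ω 𝒰 𝒵) : Measurable (D.w P) :=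
  (Kernel.measurable_coe _ (measurableSet_singleton true)).ennreal_toReal

lemma measurable_E00 {k : (𝒰 × 𝒵) × ℝ → ℝ} (hk : Measurable k) :
    Measurable fun x => D.E00 P (fun y => k (x, y)) x :=
  (hk.stronglyMeasurable.integral_condDistrib).measurable

lemma measurable_E11 {k : (𝒰 × 𝒵) × ℝ → ℝ} (hk : Measurable k) :
    Measurable fun x => D.E11 P (fun y => k (x, y)) x :=
  (hk.stronglyMeasurable.integral_condDistrib).measurable

lemma measurable_B (H : Setting P D ps c) : Measurable (D.B P ps) := by
  have hk : Measurable fun q : (𝒰 × 𝒵) × ℝ => (1 - ps q.2 q.1.1)⁻¹ * ps q.2 q.1.1 :=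
    (measurable_const.sub H.measurable_ps_swap).inv.mul H.measurable_ps_swap
  exact (hk.stronglyMeasurable.integral_condDistrib).measurable

lemma measurable_e1 (H : Setting P D ps c) : Measurable (D.nuisance P ps).e1 :=
  measurable_E00 (measurable_const.sub H.measurable_ps_swap).inv

lemma measurable_e2 (H : Setting P D ps c) : Measurable (D.nuisance P ps).e2 :=
  measurable_E00 (((measurable_const.sub H.measurable_ps_swap).pow_const 2).inv.mul
    H.measurable_ps_swap)

lemma measurable_e3 (H : Setting P D ps c) : Measurable (D.nuisance P ps).e3 :=
  measurable_E00 ((measurable_snd.mul ((measurable_const.sub H.measurable_ps_swap).pow_const 2).inv).mul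
    (H.measurable_ps_swap.pow_const 2))

lemma measurable_m1 (D : FullData Ω 𝒰 𝒵) : Measurable (D.nuisance P ps).m1 :=
  measurable_E11 (k := fun q => q.2) measurable_snd

/-- `V = w (m₁ - Δ) + (1 - w) e₃`. -/
lemma V_eq (D : FullData Ω 𝒰 𝒵) (x : 𝒰 × 𝒵) : D.V P ps x =
    D.w P x * (D.nuisance P ps).m1 x - D.w P x * D.att P
      + (1 - D.w P x) * (D.nuisance P ps).e3 x := rfl

lemma measurable_V (H : Setting P D ps c) : Measurable (D.V P ps) := by
  have hw := measurable_w (P := P) D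
  exact ((hw.mul (measurable_m1 (P := P) (ps := ps) D)).sub (hw.mul measurable_const)).add
    ((measurable_const.sub hw).mul H.measurable_e3)

/-! ### Conditional moments of the residual -/

lemma condExp_odds (H : Setting P D ps c) :
    P[fun ω => (1 - D.prob ps ω)⁻¹ * D.prob ps ω|D.sigmaX] =ᵐ[P] fun ω => D.B P ps (D.X ω) := by
  have hk : Measurable fun q : (𝒰 × 𝒵) × ℝ => (1 - ps q.2 q.1.1)⁻¹ * ps q.2 q.1.1 :=
    (measurable_const.sub H.measurable_ps_swap).inv.mul H.measurable_ps_swap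
  exact condExp_prod_ae_eq_integral_condDistrib (μ := P) H.measurable_X H.hY0.aemeasurable
    hk.stronglyMeasurable H.integrable_inv_mul

/-- Since `π > c`, the odds `π / (1 - π)` exceed `c`, hence so does their conditional mean `B`. -/
lemma c_le_B (H : Setting P D ps c) : ∀ᵐ ω ∂P, c ≤ D.B P ps (D.X ω) := by
  have h1 : P[fun _ => c|D.sigmaX] ≤ᵐ[P] P[fun ω => (1 - D.prob ps ω)⁻¹ * D.prob ps ω|D.sigmaX] := by
    refine condExp_mono (integrable_const _) H.integrable_inv_mul (H.hoverlap.mono fun ω hω => ?_)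
    have h1 := H.prob_mem ω
    have h2 : c < D.prob ps ω := hω.1
    have h3 : 1 ≤ (1 - D.prob ps ω)⁻¹ := (one_le_inv₀ (H.one_sub_prob_pos ω)).2 (by linarith)
    simp only
    nlinarith
  rw [condExp_const H.sigmaX_le] at h1
  filter_upwards [h1, H.condExp_odds] with ω a1 a2
  exact a2 ▸ a1

/-- `E{(1 - T) / (1 - π) ∣ x} = 1`, computed by conditioning on `T = 0`. -/
lemma one_sub_w_mul_e1 (H : Setting P D ps c) :
    ∀ᵐ ω ∂P, (1 - D.w P (D.X ω)) * (D.nuisance P ps).e1 (D.X ω) = 1 := by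
  have hk : Measurable fun q : (𝒰 × 𝒵) × ℝ => (1 - ps q.2 q.1.1)⁻¹ :=
    (measurable_const.sub H.measurable_ps_swap).inv
  have hi : Integrable (fun ω => (1 - D.treat ω) * (1 - D.prob ps ω)⁻¹) P :=
    H.integrable_inv.bdd_mul (measurable_const.sub H.measurable_treat).aestronglyMeasurable
      (ae_of_all _ (abs_one_sub_treat_le D))
  have h1 := H.condExp_one_sub_treat_mul_Y0 hk hi
  have h2 := H.condExp_one_sub_treat_mul hk H.integrable_inv
  have e : (fun ω => (1 - D.prob ps ω) * (1 - ps (D.Y0 ω) (D.X ω).1)⁻¹) = fun _ => (1 : ℝ) := by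
    ext ω
    exact mul_inv_cancel₀ (H.one_sub_prob_pos ω).ne'
  simp only [e] at h2
  rw [condExp_const H.sigmaX_le] at h2
  filter_upwards [h1, h2] with ω a1 a2
  exact a1.symm.trans a2

/-- `E{(1 - T) π / (1 - π)² ∣ x} = E{π / (1 - π) ∣ x}`, computed by conditioning on `T = 0`. -/
lemma one_sub_w_mul_e2 (H : Setting P D ps c) :
    ∀ᵐ ω ∂P, (1 - D.w P (D.X ω)) * (D.nuisance P ps).e2 (D.X ω) = D.B P ps (D.X ω) := by
  have hk : Measurable fun q : (𝒰 × 𝒵) × ℝ => ((1 - ps q.2 q.1.1) ^ 2)⁻¹ * ps q.2 q.1.1 :=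
    ((measurable_const.sub H.measurable_ps_swap).pow_const 2).inv.mul H.measurable_ps_swap
  have hi : Integrable (fun ω => (1 - D.treat ω) * (((1 - D.prob ps ω) ^ 2)⁻¹ * D.prob ps ω)) P :=
    H.integrable_inv_sq_mul.bdd_mul (measurable_const.sub H.measurable_treat).aestronglyMeasurable
      (ae_of_all _ (abs_one_sub_treat_le D))
  have h1 := H.condExp_one_sub_treat_mul_Y0 hk hi
  have h2 := H.condExp_one_sub_treat_mul hk H.integrable_inv_sq_mul
  have e : (fun ω => (1 - D.prob ps ω) * (((1 - ps (D.Y0 ω) (D.X ω).1) ^ 2)⁻¹ * ps (D.Y0 ω) (D.X ω).1))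
      = fun ω => (1 - D.prob ps ω)⁻¹ * D.prob ps ω := by
    ext ω
    have := (H.one_sub_prob_pos ω).ne'
    change (1 - D.prob ps ω) * (((1 - D.prob ps ω) ^ 2)⁻¹ * D.prob ps ω) = _
    field_simp
  simp only [e] at h2
  filter_upwards [h1, h2, H.condExp_odds] with ω a1 a2 a3
  exact a1.symm.trans (a2.trans a3)

lemma resid_W (H : Setting P D ps c) (ω : Ω) : resid ps (D.W ω)
    = D.treat ω - (1 - D.treat ω) * ((1 - D.prob ps ω)⁻¹ * D.prob ps ω) := by
  rw [resid_eq_one_sub H.hps01]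
  have h := (H.one_sub_prob_pos ω).ne'
  rcases D.treat_eq ω with h' | h'
  · have h'' : ind (D.T ω) = 0 := h'
    have : D.Y ω = D.Y0 ω := by simp [FullData.Y, h'']
    have e : ps (D.Y0 ω) (D.X ω).1 = D.prob ps ω := rfl
    simp only [ctrlWeight, FullData.W, h', h'', this, e]
    field_simp
    ring
  · have h'' : ind (D.T ω) = 1 := h'
    simp [ctrlWeight, FullData.W, h', h'']

lemma resid_W_sq (H : Setting P D ps c) (ω : Ω) : resid ps (D.W ω) ^ 2
    = D.treat ω + (1 - D.treat ω) * (((1 - D.prob ps ω) ^ 2)⁻¹ * D.prob ps ω ^ 2) := by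
  rw [H.resid_W, ← inv_pow]
  rcases D.treat_eq ω with h' | h' <;> rw [h'] <;> ring

lemma resid_W_sq_mul_Y (H : Setting P D ps c) (ω : Ω) : resid ps (D.W ω) ^ 2 * D.Y ω
    = D.treat ω * D.Y1 ω
      + (1 - D.treat ω) * (D.Y0 ω * ((1 - D.prob ps ω) ^ 2)⁻¹ * D.prob ps ω ^ 2) := by
  rw [H.resid_W_sq]
  rcases D.treat_eq ω with h' | h'
  · have h'' : ind (D.T ω) = 0 := h'
    have : D.Y ω = D.Y0 ω := by simp [FullData.Y, h'']
    rw [h', this]; ring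
  · have h'' : ind (D.T ω) = 1 := h'
    have : D.Y ω = D.Y1 ω := by simp [FullData.Y, h'']
    rw [h', this]; ring

lemma abs_resid_W_le (H : Setting P D ps c) : ∀ᵐ ω ∂P, |resid ps (D.W ω)| ≤ c⁻¹ := by
  filter_upwards [H.inv_one_sub_prob_le] with ω hω
  rw [H.resid_W]
  have h1 := H.prob_mem ω
  have h2 := inv_pos.2 (H.one_sub_prob_pos ω)
  rcases D.treat_eq ω with h' | h'
  · rw [h', zero_sub, sub_zero, one_mul, abs_neg, abs_of_nonneg (mul_nonneg h2.le h1.1.le)]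
    nlinarith
  · rw [h', sub_self, zero_mul, sub_zero, abs_one]
    exact (one_le_inv₀ H.hc).2 (by linarith [H.c_lt_half])

lemma integrable_one_sub_treat_odds (H : Setting P D ps c) :
    Integrable (fun ω => (1 - D.treat ω) * ((1 - D.prob ps ω)⁻¹ * D.prob ps ω)) P :=
  H.integrable_inv_mul.bdd_mul (measurable_const.sub H.measurable_treat).aestronglyMeasurable
    (ae_of_all _ (abs_one_sub_treat_le D))

/-- The residual is centered given the covariates: both `E(T ∣ x)` and `E{(1 - T) π / (1 - π) ∣ x}`
are `E(π ∣ x)`. -/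
lemma condExp_resid_W (H : Setting P D ps c) :
    P[fun ω => resid ps (D.W ω)|D.sigmaX] =ᵐ[P] 0 := by
  have hk : Measurable fun q : (𝒰 × 𝒵) × ℝ => (1 - ps q.2 q.1.1)⁻¹ * ps q.2 q.1.1 :=
    (measurable_const.sub H.measurable_ps_swap).inv.mul H.measurable_ps_swap
  have h2 := H.condExp_one_sub_treat_mul hk H.integrable_inv_mul
  have e : (fun ω => (1 - D.prob ps ω) * ((1 - ps (D.Y0 ω) (D.X ω).1)⁻¹ * ps (D.Y0 ω) (D.X ω).1))
      = D.prob ps := by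
    ext ω
    have := (H.one_sub_prob_pos ω).ne'
    change (1 - D.prob ps ω) * ((1 - D.prob ps ω)⁻¹ * D.prob ps ω) = _
    field_simp
  simp only [e] at h2
  have e2 : (fun ω => resid ps (D.W ω))
      = D.treat - fun ω => (1 - D.treat ω) * ((1 - D.prob ps ω)⁻¹ * D.prob ps ω) :=
    funext H.resid_W
  rw [e2]
  refine (condExp_sub H.integrable_treat H.integrable_one_sub_treat_odds _).trans ?_
  filter_upwards [h2, H.condExp_treat_eq_condExp_prob] with ω a2 a3
  rw [Pi.sub_apply, a3, Pi.zero_apply, sub_eq_zero]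
  exact a2.symm

lemma integrable_one_sub_treat_sq_odds (H : Setting P D ps c) :
    Integrable (fun ω => (1 - D.treat ω) * (((1 - D.prob ps ω) ^ 2)⁻¹ * D.prob ps ω ^ 2)) P :=
  H.integrable_sq_odds.bdd_mul (measurable_const.sub H.measurable_treat).aestronglyMeasurable
    (ae_of_all _ (abs_one_sub_treat_le D))

lemma condExp_resid_W_sq (H : Setting P D ps c) :
    P[fun ω => resid ps (D.W ω) ^ 2|D.sigmaX] =ᵐ[P] fun ω => D.B P ps (D.X ω) := by
  have hk : Measurable fun q : (𝒰 × 𝒵) × ℝ => ((1 - ps q.2 q.1.1) ^ 2)⁻¹ * ps q.2 q.1.1 ^ 2 :=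
    ((measurable_const.sub H.measurable_ps_swap).pow_const 2).inv.mul
      (H.measurable_ps_swap.pow_const 2)
  have h2 := H.condExp_one_sub_treat_mul hk H.integrable_sq_odds
  have i : Integrable (fun ω => (1 - D.prob ps ω) * (((1 - D.prob ps ω) ^ 2)⁻¹ * D.prob ps ω ^ 2)) P := by
    refine H.integrable_sq_odds.bdd_mul (c := 1)
      (measurable_const.sub H.measurable_prob).aestronglyMeasurable (ae_of_all _ fun ω => ?_)
    rw [Real.norm_eq_abs, abs_of_pos (H.one_sub_prob_pos ω)]
    linarith [(H.prob_mem ω).1]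
  have e2 : (fun ω => resid ps (D.W ω) ^ 2) = D.treat
      + fun ω => (1 - D.treat ω) * (((1 - D.prob ps ω) ^ 2)⁻¹ * D.prob ps ω ^ 2) :=
    funext H.resid_W_sq
  have e3 : (fun ω => (1 - D.prob ps ω)⁻¹ * D.prob ps ω) = D.prob ps
      + fun ω => (1 - D.prob ps ω) * (((1 - D.prob ps ω) ^ 2)⁻¹ * D.prob ps ω ^ 2) := by
    ext ω
    have := (H.one_sub_prob_pos ω).ne'
    simp only [Pi.add_apply]
    field_simp
    ring
  have h3 := H.condExp_odds
  rw [e3] at h3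
  rw [e2]
  refine (condExp_add H.integrable_treat H.integrable_one_sub_treat_sq_odds _).trans ?_
  have h4 := condExp_add H.integrable_prob i D.sigmaX
  filter_upwards [h2, h3, h4, H.condExp_treat_eq_condExp_prob] with ω a2 a3 a4 a5
  rw [← a3, a4, Pi.add_apply, Pi.add_apply, a5]
  exact congrArg _ a2

lemma treat_mul_Y1 (D : FullData Ω 𝒰 𝒵) (ω : Ω) : D.treat ω * D.Y1 ω = D.treat ω * D.Y ω := by
  rcases D.treat_eq ω with h' | h'
  · simp [h']
  · have h'' : ind (D.T ω) = 1 := h'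
    simp [FullData.Y, h'']

lemma one_sub_treat_mul_Y0 (D : FullData Ω 𝒰 𝒵) (ω : Ω) :
    (1 - D.treat ω) * D.Y0 ω = (1 - D.treat ω) * D.Y ω := by
  rcases D.treat_eq ω with h' | h'
  · have h'' : ind (D.T ω) = 0 := h'
    simp [FullData.Y, h'']
  · simp [h']

lemma memLp_treat_mul_Y1 (H : Setting P D ps c) : MemLp (fun ω => D.treat ω * D.Y1 ω) 2 P := by
  simp only [treat_mul_Y1]
  refine H.hY2.mono (H.measurable_treat.mul H.measurable_Y).aestronglyMeasurable
    (ae_of_all _ fun ω => ?_)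
  rw [norm_mul]
  exact mul_le_of_le_one_left (norm_nonneg _) (abs_treat_le D ω)

lemma memLp_one_sub_treat_mul_Y0 (H : Setting P D ps c) :
    MemLp (fun ω => (1 - D.treat ω) * (D.Y0 ω * ((1 - D.prob ps ω) ^ 2)⁻¹ * D.prob ps ω ^ 2)) 2 P := by
  have e : (fun ω => (1 - D.treat ω) * (D.Y0 ω * ((1 - D.prob ps ω) ^ 2)⁻¹ * D.prob ps ω ^ 2))
      = fun ω => ((1 - D.treat ω) * (((1 - D.prob ps ω) ^ 2)⁻¹ * D.prob ps ω ^ 2)) * D.Y ω := by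
    ext ω
    have := one_sub_treat_mul_Y0 D ω
    linear_combination (((1 - D.prob ps ω) ^ 2)⁻¹ * D.prob ps ω ^ 2) * this
  rw [e]
  refine MemLp.of_le_mul (c := (c⁻¹) ^ 2) H.hY2 (((measurable_const.sub H.measurable_treat).mul
    H.measurable_sq_odds).mul H.measurable_Y).aestronglyMeasurable ?_
  filter_upwards [H.sq_odds_le] with ω hω
  rw [norm_mul]
  refine mul_le_mul_of_nonneg_right ?_ (norm_nonneg _)
  rw [norm_mul]
  exact (mul_le_of_le_one_left (norm_nonneg _) (abs_one_sub_treat_le D ω)).trans hω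

lemma condExp_treat_Y1 (H : Setting P D ps c) :
    P[fun ω => D.treat ω * D.Y1 ω|D.sigmaX] =ᵐ[P]
      fun ω => D.w P (D.X ω) * (D.nuisance P ps).m1 (D.X ω) :=
  H.condExp_treat_mul_Y1 (k := fun q => q.2) measurable_snd
    (H.memLp_treat_mul_Y1.integrable one_le_two)

lemma condExp_control_Y0 (H : Setting P D ps c) :
    P[fun ω => (1 - D.treat ω) * (D.Y0 ω * ((1 - D.prob ps ω) ^ 2)⁻¹ * D.prob ps ω ^ 2)|D.sigmaX]
      =ᵐ[P] fun ω => (1 - D.w P (D.X ω)) * (D.nuisance P ps).e3 (D.X ω) := by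
  have hk : Measurable fun q : (𝒰 × 𝒵) × ℝ =>
      q.2 * ((1 - ps q.2 q.1.1) ^ 2)⁻¹ * ps q.2 q.1.1 ^ 2 :=
    (measurable_snd.mul ((measurable_const.sub H.measurable_ps_swap).pow_const 2).inv).mul
      (H.measurable_ps_swap.pow_const 2)
  exact H.condExp_one_sub_treat_mul_Y0 hk (H.memLp_one_sub_treat_mul_Y0.integrable one_le_two)

/-- `w m₁ = E(T Y₁ ∣ x)` is square integrable, and `w` is bounded away from zero. -/
lemma memLp_m1 (H : Setting P D ps c) : MemLp (fun ω => (D.nuisance P ps).m1 (D.X ω)) 2 P := by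
  refine MemLp.of_le_mul (c := c⁻¹) (H.memLp_treat_mul_Y1.condExp (m := D.sigmaX) one_le_two)
    ((measurable_m1 D).comp H.measurable_X).aestronglyMeasurable ?_
  filter_upwards [H.condExp_treat_Y1, H.w_mem] with ω h1 h2
  rw [h1, norm_mul, Real.norm_of_nonneg (H.hc.le.trans h2.1), ← mul_assoc]
  refine le_mul_of_one_le_left (norm_nonneg _) ?_
  rw [inv_mul_eq_div, one_le_div H.hc]; exact h2.1

/-- `(1 - w) e₃` is the conditional mean of a square integrable variable, and `1 - w` is bounded away
from zero. -/
lemma memLp_e3 (H : Setting P D ps c) : MemLp (fun ω => (D.nuisance P ps).e3 (D.X ω)) 2 P := by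
  refine MemLp.of_le_mul (c := c⁻¹)
    (H.memLp_one_sub_treat_mul_Y0.condExp (m := D.sigmaX) one_le_two)
    (H.measurable_e3.comp H.measurable_X).aestronglyMeasurable ?_
  filter_upwards [H.condExp_control_Y0, H.w_mem] with ω h1 h2
  have h3 : c ≤ 1 - D.w P (D.X ω) := by linarith [h2.2]
  rw [h1, norm_mul, Real.norm_of_nonneg (H.hc.le.trans h3), ← mul_assoc]
  refine le_mul_of_one_le_left (norm_nonneg _) ?_
  rw [inv_mul_eq_div, one_le_div H.hc]; exact h3

/-- `E[{(t - π) / (1 - π)}² y - t Δ ∣ x] = V(x)`. -/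
lemma condExp_resid_sq_mul_Y_sub (H : Setting P D ps c) :
    P[fun ω => resid ps (D.W ω) ^ 2 * D.Y ω - D.treat ω * D.att P|D.sigmaX] =ᵐ[P]
      fun ω => D.V P ps (D.X ω) := by
  have i1 := H.memLp_treat_mul_Y1.integrable one_le_two
  have i2 := H.memLp_one_sub_treat_mul_Y0.integrable one_le_two
  have i3 : Integrable (D.att P • D.treat) P := H.integrable_treat.smul _
  have e : (fun ω => resid ps (D.W ω) ^ 2 * D.Y ω - D.treat ω * D.att P)
      = ((fun ω => D.treat ω * D.Y1 ω) + fun ω => (1 - D.treat ω) *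
        (D.Y0 ω * ((1 - D.prob ps ω) ^ 2)⁻¹ * D.prob ps ω ^ 2)) - D.att P • D.treat := by
    ext ω
    simp only [Pi.sub_apply, Pi.add_apply, Pi.smul_apply, smul_eq_mul, H.resid_W_sq_mul_Y]
    ring
  rw [e]
  refine (condExp_sub (i1.add i2) i3 _).trans ?_
  filter_upwards [condExp_add i1 i2 D.sigmaX, condExp_smul (D.att P) D.treat D.sigmaX,
    H.condExp_treat_Y1, H.condExp_control_Y0, H.condExp_treat] with ω a1 a2 a3 a4 a5
  rw [Pi.sub_apply, a1, a2, Pi.add_apply, Pi.smul_apply, a3, a4, a5, V_eq, smul_eq_mul]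
  ring

lemma memLp_V (H : Setting P D ps c) : MemLp (fun ω => D.V P ps (D.X ω)) 2 P := by
  have h0 : MemLp (fun ω => resid ps (D.W ω) ^ 2 * D.Y ω - D.treat ω * D.att P) 2 P := by
    have h1 := H.memLp_treat_mul_Y1.add H.memLp_one_sub_treat_mul_Y0
    have h2 : MemLp (fun ω => D.treat ω * D.att P) 2 P :=
      MemLp.of_bound (H.measurable_treat.mul_const _).aestronglyMeasurable |D.att P|
        (ae_of_all _ fun ω => by
          rw [norm_mul]
          exact mul_le_of_le_one_left (norm_nonneg _) (abs_treat_le D ω))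
    refine (h1.sub h2).ae_eq (ae_of_all _ fun ω => ?_)
    simp only [Pi.sub_apply, Pi.add_apply, H.resid_W_sq_mul_Y]
  exact (h0.condExp (m := D.sigmaX) one_le_two).ae_eq H.condExp_resid_sq_mul_Y_sub

/-- `p Δ = E(T Y₁) - E(T Y₀)`. -/
lemma p_mul_att (H : Setting P D ps c) :
    D.p P * D.att P = ∫ ω, D.treat ω * D.Y1 ω ∂P - ∫ ω, D.treat ω * D.Y0 ω ∂P := by
  have i0 : Integrable (fun ω => D.treat ω * D.Y0 ω) P := H.integrable_Y0.bdd_mul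
    H.measurable_treat.aestronglyMeasurable (ae_of_all _ (abs_treat_le D))
  have hp : P (D.ev true) ≠ 0 := H.measure_ev_ne_zero true
  rw [← integral_sub (H.memLp_treat_mul_Y1.integrable one_le_two) i0]
  have e : (fun ω => D.treat ω * D.Y1 ω - D.treat ω * D.Y0 ω)
      = (D.ev true).indicator fun ω => D.Y1 ω - D.Y0 ω := by
    rw [D.indicator_ev_true]; ext ω; ring
  rw [e, integral_indicator (H.measurableSet_ev true), FullData.att, ProbabilityTheory.cond,
    integral_smul_measure, ENNReal.toReal_inv, smul_eq_mul, ← mul_assoc]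
  have : D.p P * (P (D.ev true)).toReal⁻¹ = 1 := mul_inv_cancel₀ H.p_pos.ne'
  rw [this, one_mul]

lemma integral_one_sub_treat_odds_mul_Y0 (H : Setting P D ps c) :
    Integrable (fun ω => (1 - D.treat ω) * ((1 - D.prob ps ω)⁻¹ * D.prob ps ω * D.Y0 ω)) P ∧
    ∫ ω, (1 - D.treat ω) * ((1 - D.prob ps ω)⁻¹ * D.prob ps ω * D.Y0 ω) ∂P
      = ∫ ω, D.treat ω * D.Y0 ω ∂P := by
  have hk : Measurable fun q : (𝒰 × 𝒵) × ℝ => (1 - ps q.2 q.1.1)⁻¹ * ps q.2 q.1.1 * q.2 :=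
    ((measurable_const.sub H.measurable_ps_swap).inv.mul H.measurable_ps_swap).mul measurable_snd
  have hi : Integrable (fun ω => (1 - D.prob ps ω)⁻¹ * D.prob ps ω * D.Y0 ω) P := by
    refine H.integrable_Y0.bdd_mul (c := c⁻¹) ((measurable_const.sub H.measurable_prob).inv.mul
      H.measurable_prob).aestronglyMeasurable ?_
    filter_upwards [H.inv_one_sub_prob_le] with ω hω
    have h1 := H.prob_mem ω
    have h2 := inv_pos.2 (H.one_sub_prob_pos ω)
    rw [Real.norm_of_nonneg (mul_nonneg h2.le h1.1.le)]
    nlinarith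
  refine ⟨hi.bdd_mul (measurable_const.sub H.measurable_treat).aestronglyMeasurable
    (ae_of_all _ (abs_one_sub_treat_le D)), ?_⟩
  have e1 : ∫ ω, (1 - D.treat ω) * ((1 - D.prob ps ω)⁻¹ * D.prob ps ω * D.Y0 ω) ∂P
      = ∫ ω, (1 - D.prob ps ω) * ((1 - D.prob ps ω)⁻¹ * D.prob ps ω * D.Y0 ω) ∂P :=
    H.integral_one_sub_treat_mul hk hi
  rw [e1, H.integral_treat_mul (k := fun q => q.2) measurable_snd H.integrable_Y0]
  refine integral_congr_ae (ae_of_all _ fun ω => ?_)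
  have := (H.one_sub_prob_pos ω).ne'
  simp only
  field_simp

/-- `E{V(X)} = E{Y₀ π / (1 - π)}`. -/
lemma integral_V (H : Setting P D ps c) : ∫ ω, D.V P ps (D.X ω) ∂P
    = ∫ ω, D.Y0 ω * (D.prob ps ω / (1 - D.prob ps ω)) ∂P := by
  have i1 := H.memLp_treat_mul_Y1.integrable one_le_two
  have i2 := H.memLp_one_sub_treat_mul_Y0.integrable one_le_two
  have i3 : Integrable (fun ω => D.treat ω * D.att P) P := H.integrable_treat.mul_const _
  have hk : Measurable fun q : (𝒰 × 𝒵) × ℝ =>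
      q.2 * ((1 - ps q.2 q.1.1) ^ 2)⁻¹ * ps q.2 q.1.1 ^ 2 :=
    (measurable_snd.mul ((measurable_const.sub H.measurable_ps_swap).pow_const 2).inv).mul
      (H.measurable_ps_swap.pow_const 2)
  have hi : Integrable (fun ω => D.Y0 ω * ((1 - D.prob ps ω) ^ 2)⁻¹ * D.prob ps ω ^ 2) P := by
    refine (H.integrable_Y0.mul_bdd H.measurable_sq_odds.aestronglyMeasurable H.sq_odds_le).congr
      (ae_of_all _ fun ω => ?_)
    simp only; ring
  have e1 : ∫ ω, (1 - D.treat ω) * (D.Y0 ω * ((1 - D.prob ps ω) ^ 2)⁻¹ * D.prob ps ω ^ 2) ∂P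
      = ∫ ω, (1 - D.prob ps ω) * (D.Y0 ω * ((1 - D.prob ps ω) ^ 2)⁻¹ * D.prob ps ω ^ 2) ∂P :=
    H.integral_one_sub_treat_mul hk hi
  have i4 : Integrable (fun ω =>
      (1 - D.prob ps ω) * (D.Y0 ω * ((1 - D.prob ps ω) ^ 2)⁻¹ * D.prob ps ω ^ 2)) P := by
    refine hi.bdd_mul (c := 1)
      (measurable_const.sub H.measurable_prob).aestronglyMeasurable (ae_of_all _ fun ω => ?_)
    rw [Real.norm_eq_abs, abs_of_pos (H.one_sub_prob_pos ω)]
    linarith [(H.prob_mem ω).1]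
  have i5 : Integrable (fun ω => D.prob ps ω * D.Y0 ω) P := H.integrable_Y0.bdd_mul
    H.measurable_prob.aestronglyMeasurable (ae_of_all _ H.abs_prob_le)
  have i12 : Integrable (fun ω => D.treat ω * D.Y1 ω +
    (1 - D.treat ω) * (D.Y0 ω * ((1 - D.prob ps ω) ^ 2)⁻¹ * D.prob ps ω ^ 2)) P := i1.add i2
  rw [← integral_congr_ae H.condExp_resid_sq_mul_Y_sub, integral_condExp H.sigmaX_le]
  simp only [H.resid_W_sq_mul_Y]
  rw [integral_sub i12 i3, integral_add i1 i2, integral_mul_const, ← H.p_eq_integral_treat,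
    H.p_mul_att, e1, H.integral_treat_mul (k := fun q => q.2) measurable_snd H.integrable_Y0]
  have : ∫ ω, D.Y0 ω * (D.prob ps ω / (1 - D.prob ps ω)) ∂P = ∫ ω, D.prob ps ω * D.Y0 ω ∂P
      + ∫ ω, (1 - D.prob ps ω) * (D.Y0 ω * ((1 - D.prob ps ω) ^ 2)⁻¹ * D.prob ps ω ^ 2) ∂P := by
    rw [← integral_add i5 i4]
    refine integral_congr_ae (ae_of_all _ fun ω => ?_)
    have := (H.one_sub_prob_pos ω).ne'
    simp only
    field_simp
    ring
  rw [this]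
  ring

end Setting

end Moments

/-! ### The projections of `φ_alt` -/

section Projection

variable {Ω 𝒰 𝒵 : Type*}

lemma ipw_eq_resid_mul {ps : ℝ → 𝒰 → ℝ} (hps01 : ∀ y u, 0 < ps y u ∧ ps y u < 1)
    (o : Obs 𝒰 𝒵) : ipw ps o = resid ps o * o.2.1 := by
  have h : 1 - ps o.2.1 o.2.2.1 ≠ 0 := by linarith [hps01 o.2.1 o.2.2.1]
  unfold ipw resid
  rcases o with ⟨t, y, x⟩
  cases t <;> simp only [ind, if_true, if_false, Bool.false_eq_true] <;> field_simp <;> ring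

lemma resid_mul_ind {ps : ℝ → 𝒰 → ℝ} (hps01 : ∀ y u, 0 < ps y u ∧ ps y u < 1)
    (o : Obs 𝒰 𝒵) : resid ps o * ind o.1 = ind o.1 := by
  have h : 1 - ps o.2.1 o.2.2.1 ≠ 0 := by linarith [hps01 o.2.1 o.2.2.1]
  unfold resid
  rcases o with ⟨t, y, x⟩
  cases t
  · simp [ind]
  · simp only [ind, if_true, mul_one]
    exact div_self h

variable [MeasurableSpace Ω] [MeasurableSpace 𝒰] [MeasurableSpace 𝒵]

lemma phi_add_phiPerp (P : Measure Ω) [IsProbabilityMeasure P] (D : FullData Ω 𝒰 𝒵) {ps : ℝ → 𝒰 → ℝ}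
    (hps01 : ∀ y u, 0 < ps y u ∧ ps y u < 1) (o : Obs 𝒰 𝒵) :
    phiAlt D P ps o = phi D P ps o + phiPerp D P ps o := by
  have e : D.E00 P (fun y => ps y o.2.2.1 ^ 2 / (1 - ps y o.2.2.1) ^ 2 * y) o.2.2
      = (D.nuisance P ps).e3 o.2.2 := by
    change D.E00 P _ _ = D.E00 P _ _
    congr 1
    ext y
    ring
  unfold phiAlt phi phiPerp
  rw [ipw_eq_resid_mul hps01, Setting.V_eq]
  simp only [e]
  change _ = (D.p P)⁻¹ * (_ - _ * (_ * (D.nuisance P ps).m1 o.2.2 + _) - _) + _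
  ring

namespace Setting

variable {P : Measure Ω} [IsProbabilityMeasure P] {D : FullData Ω 𝒰 𝒵} {ps : ℝ → 𝒰 → ℝ} {c : ℝ}

lemma isProbabilityMeasure_law (H : Setting P D ps c) : IsProbabilityMeasure (P.map D.W) :=
  Measure.isProbabilityMeasure_map H.measurable_W.aemeasurable

lemma map_obsX (H : Setting P D ps c) : (P.map D.W).map obsX = P.map D.X :=
  Measure.map_map measurable_obsX H.measurable_W

lemma ae_law_of_ae_X (H : Setting P D ps c) {p : 𝒰 × 𝒵 → Prop} (h : ∀ᵐ ω ∂P, p (D.X ω))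
    (hp : MeasurableSet {x | p x}) : ∀ᵐ o ∂(P.map D.W), p (obsX o) :=
  (ae_map_iff H.measurable_W.aemeasurable (measurable_obsX hp)).2 h

lemma abs_resid_le (H : Setting P D ps c) : ∀ᵐ o ∂(P.map D.W), |resid ps o| ≤ c⁻¹ :=
  (ae_map_iff H.measurable_W.aemeasurable
    (measurableSet_le (measurable_resid H.hps).abs measurable_const)).2 H.abs_resid_W_le

lemma integrable_resid (H : Setting P D ps c) : Integrable (resid ps) (P.map D.W) :=
  have := H.isProbabilityMeasure_law
  Integrable.of_bound (measurable_resid H.hps).aestronglyMeasurable c⁻¹ H.abs_resid_le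

lemma integrable_resid_sq (H : Setting P D ps c) :
    Integrable (fun o => resid ps o ^ 2) (P.map D.W) := by
  refine (H.integrable_resid.mul_bdd (measurable_resid H.hps).aestronglyMeasurable
    H.abs_resid_le).congr (ae_of_all _ fun o => ?_)
  simp only; ring

lemma condExp_resid (H : Setting P D ps c) :
    (P.map D.W)[resid ps|ATT.sigmaX 𝒰 𝒵] =ᵐ[P.map D.W] 0 :=
  condExp_map_ae_eq H.measurable_W measurable_obsX (g := fun _ => 0) H.integrable_resid
    measurable_const H.condExp_resid_W

lemma condExp_resid_sq (H : Setting P D ps c) :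
    (P.map D.W)[fun o => resid ps o ^ 2|ATT.sigmaX 𝒰 𝒵] =ᵐ[P.map D.W]
      fun o => D.B P ps (obsX o) :=
  condExp_map_ae_eq H.measurable_W measurable_obsX H.integrable_resid_sq H.measurable_B
    H.condExp_resid_W_sq

lemma measurable_phiAlt (H : Setting P D ps c) : Measurable (phiAlt D P ps) := by
  have hi : Measurable fun o : Obs 𝒰 𝒵 => ind o.1 := measurable_ind.comp measurable_fst
  have : phiAlt D P ps
      = fun o => (D.p P)⁻¹ * (resid ps o * o.2.1 - ind o.1 * D.att P) :=
    funext fun o => by rw [phiAlt, ipw_eq_resid_mul H.hps01]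
  rw [this]
  exact measurable_const.mul (((measurable_resid H.hps).mul measurable_snd.fst).sub
    (hi.mul measurable_const))

lemma measurable_phiPerp (H : Setting P D ps c) : Measurable (phiPerp D P ps) :=
  (((measurable_resid H.hps).mul measurable_const).mul
    (H.measurable_B.comp measurable_obsX).inv).mul (H.measurable_V.comp measurable_obsX)

lemma measurable_phi (H : Setting P D ps c) : Measurable (phi D P ps) := by
  have : phi D P ps = fun o => phiAlt D P ps o - phiPerp D P ps o :=
    funext fun o => by rw [phi_add_phiPerp P D H.hps01]; ring
  rw [this]
  exact H.measurable_phiAlt.sub H.measurable_phiPerp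

lemma memLp_Y (H : Setting P D ps c) : MemLp (fun o : Obs 𝒰 𝒵 => o.2.1) 2 (P.map D.W) :=
  (memLp_map_measure_iff measurable_snd.fst.aestronglyMeasurable
    H.measurable_W.aemeasurable).2 H.hY2

lemma memLp_phiAlt (H : Setting P D ps c) : MemLp (phiAlt D P ps) 2 (P.map D.W) := by
  have := H.isProbabilityMeasure_law
  have hi : Measurable fun o : Obs 𝒰 𝒵 => ind o.1 := measurable_ind.comp measurable_fst
  have h1 : MemLp (fun o : Obs 𝒰 𝒵 => resid ps o * o.2.1) 2 (P.map D.W) := by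
    refine MemLp.of_le_mul (c := c⁻¹) H.memLp_Y
      ((measurable_resid H.hps).mul measurable_snd.fst).aestronglyMeasurable ?_
    filter_upwards [H.abs_resid_le] with o ho
    rw [norm_mul]
    exact mul_le_mul_of_nonneg_right ho (norm_nonneg _)
  have h2 : MemLp (fun o : Obs 𝒰 𝒵 => ind o.1 * D.att P) 2 (P.map D.W) := by
    refine MemLp.of_bound (hi.mul measurable_const).aestronglyMeasurable |D.att P|
      (ae_of_all _ fun o => ?_)
    rw [norm_mul]
    refine mul_le_of_le_one_left (norm_nonneg _) ?_
    unfold ind; split_ifs <;> simp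
  refine ((h1.sub h2).const_mul (D.p P)⁻¹).ae_eq (ae_of_all _ fun o => ?_)
  rw [phiAlt, ipw_eq_resid_mul H.hps01]
  rfl

lemma memLp_V_law (H : Setting P D ps c) :
    MemLp (fun o => D.V P ps (obsX o)) 2 (P.map D.W) :=
  (memLp_map_measure_iff (H.measurable_V.comp measurable_obsX).aestronglyMeasurable
    H.measurable_W.aemeasurable).2 H.memLp_V

lemma c_le_B_law (H : Setting P D ps c) : ∀ᵐ o ∂(P.map D.W), c ≤ D.B P ps (obsX o) :=
  H.ae_law_of_ae_X H.c_le_B (measurableSet_le measurable_const H.measurable_B)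

lemma memLp_phiPerp (H : Setting P D ps c) : MemLp (phiPerp D P ps) 2 (P.map D.W) := by
  refine MemLp.of_le_mul (c := c⁻¹ * (D.p P)⁻¹ * c⁻¹) H.memLp_V_law
    H.measurable_phiPerp.aestronglyMeasurable ?_
  filter_upwards [H.abs_resid_le, H.c_le_B_law] with o h1 h2
  have h3 : |(D.B P ps (obsX o))⁻¹| ≤ c⁻¹ := by
    rw [abs_of_nonneg (inv_nonneg.2 (H.hc.le.trans h2))]
    exact inv_anti₀ H.hc h2
  have h4 : |(D.p P)⁻¹| = (D.p P)⁻¹ := abs_of_pos (inv_pos.2 H.p_pos)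
  have hc := inv_pos.2 H.hc
  have hp := inv_pos.2 H.p_pos
  rw [phiPerp, norm_mul, norm_mul, norm_mul]
  refine mul_le_mul_of_nonneg_right ?_ (norm_nonneg _)
  refine mul_le_mul (mul_le_mul h1 h4.le (norm_nonneg _) hc.le) h3 (norm_nonneg _) (by positivity)

lemma memLp_phi (H : Setting P D ps c) : MemLp (phi D P ps) 2 (P.map D.W) := by
  refine (H.memLp_phiAlt.sub H.memLp_phiPerp).ae_eq (ae_of_all _ fun o => ?_)
  rw [Pi.sub_apply, phi_add_phiPerp P D H.hps01]; ring

/-- `φ_alt` has mean zero: by the assignment model, weighting the controls by `π / (1 - π)`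
reproduces `E(T Y₀)`. -/
lemma integral_phiAlt (H : Setting P D ps c) : ∫ o, phiAlt D P ps o ∂(P.map D.W) = 0 := by
  rw [integral_map H.measurable_W.aemeasurable H.measurable_phiAlt.aestronglyMeasurable]
  obtain ⟨i2, e2⟩ := H.integral_one_sub_treat_odds_mul_Y0
  have i1 := H.memLp_treat_mul_Y1.integrable one_le_two
  have i3 : Integrable (fun ω => D.treat ω * D.att P) P := H.integrable_treat.mul_const _
  have i12 : Integrable (fun ω => D.treat ω * D.Y1 ω
    - (1 - D.treat ω) * ((1 - D.prob ps ω)⁻¹ * D.prob ps ω * D.Y0 ω)) P := i1.sub i2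
  have e : ∀ ω, phiAlt D P ps (D.W ω) = (D.p P)⁻¹ * (D.treat ω * D.Y1 ω
      - (1 - D.treat ω) * ((1 - D.prob ps ω)⁻¹ * D.prob ps ω * D.Y0 ω)
      - D.treat ω * D.att P) := by
    intro ω
    have a0 := one_sub_treat_mul_Y0 D ω
    have a1 := treat_mul_Y1 D ω
    rw [phiAlt, ipw_eq_resid_mul H.hps01, H.resid_W]
    change (D.p P)⁻¹ * ((D.treat ω - (1 - D.treat ω) * ((1 - D.prob ps ω)⁻¹ * D.prob ps ω)) * D.Y ω
      - D.treat ω * D.att P) = _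
    linear_combination (D.p P)⁻¹ * ((1 - D.prob ps ω)⁻¹ * D.prob ps ω) * a0 - (D.p P)⁻¹ * a1
  simp only [e]
  rw [integral_const_mul, integral_sub i12 i3, integral_sub i1 i2, e2, integral_mul_const,
    ← H.p_eq_integral_treat, ← H.p_mul_att]
  ring

lemma condExp_phiAlt_mul_resid (H : Setting P D ps c) :
    (P.map D.W)[fun o => phiAlt D P ps o * resid ps o|ATT.sigmaX 𝒰 𝒵] =ᵐ[P.map D.W]
      fun o => (D.p P)⁻¹ * D.V P ps (obsX o) := by
  have := H.isProbabilityMeasure_law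
  refine condExp_map_ae_eq H.measurable_W measurable_obsX
    ((H.memLp_phiAlt.integrable one_le_two).mul_bdd (measurable_resid H.hps).aestronglyMeasurable
      H.abs_resid_le) (g := fun x => (D.p P)⁻¹ * D.V P ps x)
    (measurable_const.mul H.measurable_V) ?_
  have e : (fun ω => phiAlt D P ps (D.W ω) * resid ps (D.W ω)) = (D.p P)⁻¹ •
      fun ω => resid ps (D.W ω) ^ 2 * D.Y ω - D.treat ω * D.att P := by
    ext ω
    have := resid_mul_ind H.hps01 (D.W ω)
    rw [Pi.smul_apply, smul_eq_mul, phiAlt, ipw_eq_resid_mul H.hps01]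
    change (D.p P)⁻¹ * (resid ps (D.W ω) * D.Y ω - D.treat ω * D.att P) * resid ps (D.W ω) = _
    have h' : resid ps (D.W ω) * D.treat ω = D.treat ω := this
    linear_combination -(D.p P)⁻¹ * D.att P * h'
  rw [e]
  refine (condExp_smul _ _ _).trans ?_
  filter_upwards [H.condExp_resid_sq_mul_Y_sub] with ω hω
  rw [Pi.smul_apply, smul_eq_mul]
  exact congrArg _ hω

/-- The factor of the residual in `phiPerp`. -/
lemma phiPerp_eq (D : FullData Ω 𝒰 𝒵) (o : Obs 𝒰 𝒵) : phiPerp D P ps o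
    = resid ps o * ((D.p P)⁻¹ * (D.B P ps (obsX o))⁻¹ * D.V P ps (obsX o)) := by
  unfold phiPerp
  change _ * _ * (D.B P ps (obsX o))⁻¹ * D.V P ps (obsX o) = _
  ring

lemma measurable_phiPerp_factor (H : Setting P D ps c) : Measurable[ATT.sigmaX 𝒰 𝒵]
    fun o => (D.p P)⁻¹ * (D.B P ps (obsX o))⁻¹ * D.V P ps (obsX o) := by
  have : Measurable fun x => (D.p P)⁻¹ * (D.B P ps x)⁻¹ * D.V P ps x :=
    (measurable_const.mul H.measurable_B.inv).mul H.measurable_V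
  exact this.comp (comap_measurable obsX)

lemma condExp_phiPerp_mul_resid (H : Setting P D ps c) :
    (P.map D.W)[fun o => phiPerp D P ps o * resid ps o|ATT.sigmaX 𝒰 𝒵] =ᵐ[P.map D.W]
      fun o => (D.p P)⁻¹ * D.V P ps (obsX o) := by
  have := H.isProbabilityMeasure_law
  have e : (fun o => phiPerp D P ps o * resid ps o)
      = (fun o => (D.p P)⁻¹ * (D.B P ps (obsX o))⁻¹ * D.V P ps (obsX o))
        * fun o => resid ps o ^ 2 := by
    ext o
    rw [phiPerp_eq, Pi.mul_apply]; ring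
  have hi : Integrable (fun o => phiPerp D P ps o * resid ps o) (P.map D.W) :=
    (H.memLp_phiPerp.integrable one_le_two).mul_bdd (measurable_resid H.hps).aestronglyMeasurable
      H.abs_resid_le
  rw [e] at hi ⊢
  refine (condExp_mul_of_stronglyMeasurable_left H.measurable_phiPerp_factor.stronglyMeasurable hi
    H.integrable_resid_sq).trans ?_
  filter_upwards [H.condExp_resid_sq, H.c_le_B_law] with o h1 h2
  have : D.B P ps (obsX o) ≠ 0 := (H.hc.trans_le h2).ne'
  rw [Pi.mul_apply, h1]
  field_simp

lemma integral_phiPerp (H : Setting P D ps c) : ∫ o, phiPerp D P ps o ∂(P.map D.W) = 0 := by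
  have := H.isProbabilityMeasure_law
  have e : (fun o => phiPerp D P ps o) = fun o =>
      ((D.p P)⁻¹ * (D.B P ps (obsX o))⁻¹ * D.V P ps (obsX o)) * resid ps o := by
    ext o; rw [phiPerp_eq]; ring
  have hi : Integrable (fun o => phiPerp D P ps o) (P.map D.W) :=
    H.memLp_phiPerp.integrable one_le_two
  rw [e] at hi ⊢
  rw [← integral_mul_condExp ATT.sigmaX_le
    H.measurable_phiPerp_factor.stronglyMeasurable.aestronglyMeasurable hi H.integrable_resid,
    integral_congr_ae (H.condExp_resid.mono fun o ho => by rw [ho, Pi.zero_apply, mul_zero])]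
  exact integral_zero _ _

lemma integral_phi (H : Setting P D ps c) : ∫ o, phi D P ps o ∂(P.map D.W) = 0 := by
  have := H.isProbabilityMeasure_law
  have e : ∀ o, phi D P ps o = phiAlt D P ps o - phiPerp D P ps o := fun o => by
    rw [phi_add_phiPerp P D H.hps01]; ring
  simp only [e]
  rw [integral_sub (H.memLp_phiAlt.integrable one_le_two) (H.memLp_phiPerp.integrable one_le_two),
    H.integral_phiAlt, H.integral_phiPerp, sub_zero]

lemma condExp_phi_mul_resid (H : Setting P D ps c) :
    (P.map D.W)[fun o => phi D P ps o * resid ps o|ATT.sigmaX 𝒰 𝒵] =ᵐ[P.map D.W] 0 := by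
  have := H.isProbabilityMeasure_law
  have hr := (measurable_resid (𝒵 := 𝒵) H.hps).aestronglyMeasurable (μ := P.map D.W)
  have e : (fun o => phi D P ps o * resid ps o) = (fun o => phiAlt D P ps o * resid ps o)
      - fun o => phiPerp D P ps o * resid ps o := by
    ext o
    rw [Pi.sub_apply, phi_add_phiPerp P D H.hps01]; ring
  rw [e]
  refine (condExp_sub ((H.memLp_phiAlt.integrable one_le_two).mul_bdd hr H.abs_resid_le)
    ((H.memLp_phiPerp.integrable one_le_two).mul_bdd hr H.abs_resid_le) _).trans ?_
  filter_upwards [H.condExp_phiAlt_mul_resid, H.condExp_phiPerp_mul_resid] with o h1 h2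
  rw [Pi.sub_apply, h1, h2, sub_self, Pi.zero_apply]

lemma phiPerp_ae_eq_zero_iff (H : Setting P D ps c) :
    phiPerp D P ps =ᵐ[P.map D.W] 0 ↔ D.V P ps =ᵐ[P.map D.X] 0 := by
  rw [← H.map_obsX]
  have hms : MeasurableSet {x | D.V P ps x = (0 : 𝒰 × 𝒵 → ℝ) x} :=
    H.measurable_V (measurableSet_singleton 0)
  unfold Filter.EventuallyEq
  rw [ae_map_iff measurable_obsX.aemeasurable hms]
  constructor
  · intro h
    have e : (fun o => phiPerp D P ps o * resid ps o) =ᵐ[P.map D.W] 0 := by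
      filter_upwards [h] with o ho
      simp only [ho, Pi.zero_apply, zero_mul]
    have h2 := condExp_congr_ae (m := ATT.sigmaX 𝒰 𝒵) e
    rw [condExp_zero] at h2
    filter_upwards [h2, H.condExp_phiPerp_mul_resid] with o h3 h4
    rw [h3] at h4
    exact ((mul_eq_zero.1 h4.symm).resolve_left (inv_ne_zero H.p_pos.ne'))
  · intro h
    filter_upwards [h] with o ho
    rw [phiPerp_eq, ho, Pi.zero_apply, mul_zero, mul_zero, Pi.zero_apply]

lemma V_ne_zero_of_integral_ne_zero (H : Setting P D ps c)
    (h : ∫ ω, D.Y0 ω * (ps (D.Y0 ω) (D.U ω) / (1 - ps (D.Y0 ω) (D.U ω))) ∂P ≠ 0) :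
    ¬ D.V P ps =ᵐ[P.map D.X] 0 := by
  intro hV
  refine h ?_
  have hV' : (fun ω => D.V P ps (D.X ω)) =ᵐ[P] fun _ => 0 :=
    ae_of_ae_map H.measurable_X.aemeasurable hV
  have := H.integral_V
  rw [integral_congr_ae hV', integral_zero] at this
  exact this.symm

/-- The decomposition `φ_alt = φ + φ_perp` along `Λ` and `Λ^⊥`. -/
theorem exists_projections (H : Setting P D ps c) [IsProbabilityMeasure (P.map D.W)] :
    ∃ a b r : Hilb (P.map D.W),
      ((a : Lp ℝ 2 (P.map D.W)) : Obs 𝒰 𝒵 → ℝ) =ᵐ[P.map D.W] phiAlt D P ps ∧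
      ((b : Lp ℝ 2 (P.map D.W)) : Obs 𝒰 𝒵 → ℝ) =ᵐ[P.map D.W] phi D P ps ∧
      ((r : Lp ℝ 2 (P.map D.W)) : Obs 𝒰 𝒵 → ℝ) =ᵐ[P.map D.W] phiPerp D P ps ∧
      a = b + r ∧ b ∈ nuisanceTangent ps (P.map D.W) ∧
      r ∈ (nuisanceTangent ps (P.map D.W))ᗮ ∧
      (r = 0 ↔ D.V P ps =ᵐ[P.map D.X] 0) := by
  have ha := coeFn_toHilb H.memLp_phiAlt H.integral_phiAlt
  have hb := coeFn_toHilb H.memLp_phi H.integral_phi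
  have hr := coeFn_toHilb H.memLp_phiPerp H.integral_phiPerp
  refine ⟨toHilb _ H.memLp_phiAlt H.integral_phiAlt, toHilb _ H.memLp_phi H.integral_phi,
    toHilb _ H.memLp_phiPerp H.integral_phiPerp, ha, hb, hr, ?_, ?_, ?_, ?_⟩
  · refine Subtype.ext (Lp.ext ?_)
    rw [Submodule.coe_add]
    filter_upwards [ha, hb, hr, Lp.coeFn_add
      (toHilb _ H.memLp_phi H.integral_phi : Lp ℝ 2 (P.map D.W))
      (toHilb _ H.memLp_phiPerp H.integral_phiPerp : Lp ℝ 2 (P.map D.W))] with o h1 h2 h3 h4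
    rw [h4, Pi.add_apply, h1, h2, h3, phi_add_phiPerp P D H.hps01]
  · refine mem_nuisanceTangent H.hps H.hps01 H.abs_resid_le H.condExp_resid H.hc
      (H.measurable_B.comp (comap_measurable obsX)) H.c_le_B_law H.condExp_resid_sq ?_
    refine (condExp_congr_ae ?_).trans H.condExp_phi_mul_resid
    filter_upwards [hb] with o ho
    rw [ho]
  · refine mem_orthogonal_nuisanceTangent H.hps H.hps01 H.abs_resid_le
      H.measurable_phiPerp_factor.stronglyMeasurable.aestronglyMeasurable ?_
    filter_upwards [hr] with o ho
    rw [ho, phiPerp_eq]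
  · rw [← H.phiPerp_ae_eq_zero_iff, ← Submodule.coe_eq_zero, Lp.eq_zero_iff_ae_eq_zero]
    exact ⟨fun h => hr.symm.trans h, fun h => hr.trans h⟩

end Setting

end Projection

/-! ### Independent and identically distributed sums -/

section Sums

variable {Ω' α β : Type*} [MeasurableSpace Ω'] [MeasurableSpace α] [MeasurableSpace β]
  {μ : Measure Ω'} [IsProbabilityMeasure μ] {ν : Measure β}

/-- Chebyshev's inequality for a sum of independent and identically distributed variables. -/
lemma measure_abs_sum_ge_le {ι : Type*} [Fintype ι] {V : ι → Ω' → β} (hV : ∀ i, Measurable (V i))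
    (hind : iIndepFun V μ) (hlaw : ∀ i, μ.map (V i) = ν) {ψ : β → ℝ} (hψm : Measurable ψ)
    (hψ : MemLp ψ 2 ν) (hψ0 : ∫ o, ψ o ∂ν = 0) {δ : ℝ} (hδ : 0 < δ) :
    μ {ω | δ ≤ |∑ i, ψ (V i ω)|}
      ≤ ENNReal.ofReal (Fintype.card ι * (∫ o, ψ o ^ 2 ∂ν) / δ ^ 2) := by
  have hL : ∀ i, MemLp (fun ω => ψ (V i ω)) 2 μ := fun i =>
    (memLp_map_measure_iff hψm.aestronglyMeasurable (hV i).aemeasurable).1 ((hlaw i).symm ▸ hψ)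
  have h0 : ∀ i, ∫ ω, ψ (V i ω) ∂μ = 0 := fun i => by
    rw [← integral_map (hV i).aemeasurable hψm.aestronglyMeasurable, hlaw i, hψ0]
  have hv : ∀ i, variance (fun ω => ψ (V i ω)) μ = ∫ o, ψ o ^ 2 ∂ν := fun i => by
    have hm : Measurable fun ω => ψ (V i ω) := hψm.comp (hV i)
    rw [variance_eq_integral hm.aemeasurable, h0, ← hlaw i,
      integral_map (hV i).aemeasurable (hψm.pow_const 2).aestronglyMeasurable]
    simp
  have hs : (fun ω => ∑ i, ψ (V i ω)) = ∑ i, fun ω => ψ (V i ω) := by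
    ext ω; simp
  have hvar : variance (fun ω => ∑ i, ψ (V i ω)) μ = Fintype.card ι * ∫ o, ψ o ^ 2 ∂ν := by
    rw [hs, IndepFun.variance_sum (fun i _ => hL i)
      (fun i _ j _ hij => (hind.indepFun hij).comp hψm hψm)]
    simp [hv]
  have hm : ∫ ω, ∑ i, ψ (V i ω) ∂μ = 0 := by
    rw [integral_finsetSum _ fun i _ => (hL i).integrable one_le_two]
    simp [h0]
  have hLs : MemLp (fun ω => ∑ i, ψ (V i ω)) 2 μ := memLp_finsetSum _ fun i _ => hL i
  have := meas_ge_le_variance_div_sq hLs hδ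
  simp only [hm, sub_zero, hvar] at this
  exact this

/-- Chebyshev's inequality for summands depending on independent data `A`, conditionally on `A`. -/
lemma measure_abs_sum_ge_le_of_indepFun {ι : Type*} [Fintype ι] {A : Ω' → α} (hA : Measurable A)
    {V : ι → Ω' → β} (hV : ∀ i, Measurable (V i)) (hind : iIndepFun V μ)
    (hlaw : ∀ i, μ.map (V i) = ν) (hAV : IndepFun A (fun ω i => V i ω) μ) {ψ : α → β → ℝ}
    (hψm : Measurable (Function.uncurry ψ)) (hψ : ∀ a, MemLp (ψ a) 2 ν)
    (hψ0 : ∀ a, ∫ o, ψ a o ∂ν = 0) {M : ℝ} (hM : ∀ a, ∫ o, ψ a o ^ 2 ∂ν ≤ M) {δ : ℝ} (hδ : 0 < δ) :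
    μ {ω | δ ≤ |∑ i, ψ (A ω) (V i ω)|} ≤ ENNReal.ofReal (Fintype.card ι * M / δ ^ 2) := by
  have hVm : Measurable fun ω i => V i ω := measurable_pi_lambda _ hV
  have hS : MeasurableSet {q : α × (ι → β) | δ ≤ |∑ i, ψ q.1 (q.2 i)|} := by
    refine measurableSet_le measurable_const (Measurable.abs ?_)
    exact Finset.measurable_sum _ fun i _ =>
      hψm.comp (measurable_fst.prodMk ((measurable_pi_apply i).comp measurable_snd))
  have hprob : IsProbabilityMeasure (μ.map A) := Measure.isProbabilityMeasure_map hA.aemeasurable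
  have e1 : μ {ω | δ ≤ |∑ i, ψ (A ω) (V i ω)|}
      = ((μ.map A).prod (μ.map fun ω i => V i ω)) {q | δ ≤ |∑ i, ψ q.1 (q.2 i)|} := by
    rw [← (indepFun_iff_map_prod_eq_prod_map_map hA.aemeasurable hVm.aemeasurable).1 hAV,
      Measure.map_apply (hA.prodMk hVm) hS]
    rfl
  rw [e1, Measure.prod_apply hS]
  calc ∫⁻ a, (μ.map fun ω i => V i ω) (Prod.mk a ⁻¹' {q | δ ≤ |∑ i, ψ q.1 (q.2 i)|}) ∂(μ.map A)
      ≤ ∫⁻ _, ENNReal.ofReal (Fintype.card ι * M / δ ^ 2) ∂(μ.map A) := by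
        refine lintegral_mono fun a => ?_
        rw [Measure.map_apply hVm (measurable_prodMk_left hS)]
        have hψa : Measurable (ψ a) := hψm.comp measurable_prodMk_left
        refine (measure_abs_sum_ge_le hV hind hlaw hψa (hψ a) (hψ0 a) hδ).trans (ENNReal.ofReal_le_ofReal ?_)
        have := hM a
        gcongr
    _ = _ := by simp

/-- For a random partition that is independent of the data, a sum over the `k`-th fold of summands
that are centered given the data outside that fold obeys Chebyshev's inequality. -/
lemma measure_abs_fold_sum_ge_le {W : ℕ → Ω' → β} (hW : ∀ i, Measurable (W i))
    (hind : iIndepFun W μ) (hlaw : ∀ i, μ.map (W i) = ν) {K n : ℕ} {fold : Ω' → Fin n → Fin K}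
    (hfold : Measurable fold) (hfoldind : IndepFun fold (fun ω i => W i ω) μ) (k : Fin K)
    {ψ : (F : Fin n → Fin K) → (trainSet F k → β) → β → ℝ}
    (hψm : ∀ F, Measurable (Function.uncurry (ψ F))) (hψ : ∀ F s, MemLp (ψ F s) 2 ν)
    (hψ0 : ∀ F s, ∫ o, ψ F s o ∂ν = 0) {M : ℝ} (hM : ∀ F s, ∫ o, ψ F s o ^ 2 ∂ν ≤ M)
    (hM0 : 0 ≤ M) {δ : ℝ} (hδ : 0 < δ) :
    μ {ω | δ ≤ |∑ i with fold ω i = k, ψ (fold ω) (fun j => W j ω) (W i ω)|}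
      ≤ ENNReal.ofReal (n * M / δ ^ 2) := by
  have hWm : Measurable fun ω i => W i ω := measurable_pi_lambda _ hW
  let S : (Fin n → Fin K) → Set (ℕ → β) := fun F =>
    {v | δ ≤ |∑ i with F i = k, ψ F (fun j => v j) (v i)|}
  have hS : ∀ F, MeasurableSet (S F) := by
    intro F
    refine measurableSet_le measurable_const (Measurable.abs ?_)
    refine Finset.measurable_sum _ fun i _ => (hψm F).comp (Measurable.prodMk ?_ ?_)
    · exact measurable_pi_lambda _ fun j => measurable_pi_apply _
    · exact measurable_pi_apply _
  have hb : ∀ F, μ ((fun ω i => W i ω) ⁻¹' S F) ≤ ENNReal.ofReal (n * M / δ ^ 2) := by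
    intro F
    let T : Finset (Fin n) := Finset.univ.filter fun i => F i = k
    have hWn : iIndepFun (fun (i : Fin n) => W i) μ := hind.precomp Fin.val_injective
    have hdisj : Disjoint (trainSet F k) T := by
      rw [Finset.disjoint_left]
      intro i h1 h2
      exact (Finset.mem_filter.1 h1).2 (Finset.mem_filter.1 h2).2
    have hAV := hWn.indepFun_finset (trainSet F k) T hdisj fun i => hW i
    have hVind : iIndepFun (fun (i : T) => W i) μ := hWn.precomp Subtype.val_injective
    have := measure_abs_sum_ge_le_of_indepFun (μ := μ) (ν := ν)
      (A := fun ω (j : trainSet F k) => W j ω) (V := fun i : T => W i)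
      (measurable_pi_lambda _ fun j => hW _) (fun i => hW _) hVind (fun i => hlaw _) hAV
      (hψm F) (hψ F) (hψ0 F) (hM F) hδ
    have e : ∀ ω, ∑ i : T, ψ F (fun j => W j ω) (W i ω)
        = ∑ i with F i = k, ψ F (fun j => W j ω) (W i ω) := fun ω =>
      Finset.sum_coe_sort T fun i : Fin n => ψ F (fun j => W j ω) (W i ω)
    simp only [e] at this
    refine this.trans (ENNReal.ofReal_le_ofReal ?_)
    have hcard : (Fintype.card T : ℝ) ≤ n := by
      rw [Fintype.card_coe]
      exact_mod_cast (Finset.card_le_univ T).trans_eq (Fintype.card_fin n)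
    gcongr
  calc μ {ω | δ ≤ |∑ i with fold ω i = k, ψ (fold ω) (fun j => W j ω) (W i ω)|}
      ≤ μ (⋃ F, fold ⁻¹' {F} ∩ (fun ω i => W i ω) ⁻¹' S F) := by
        refine measure_mono fun ω hω => ?_
        exact Set.mem_iUnion.2 ⟨fold ω, rfl, hω⟩
    _ ≤ ∑ F, μ (fold ⁻¹' {F} ∩ (fun ω i => W i ω) ⁻¹' S F) := measure_iUnion_fintype_le _ _
    _ = ∑ F, μ (fold ⁻¹' {F}) * μ ((fun ω i => W i ω) ⁻¹' S F) := by
        refine Finset.sum_congr rfl fun F _ => ?_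
        exact hfoldind.measure_inter_preimage_eq_mul _ _ (measurableSet_singleton F) (hS F)
    _ ≤ ∑ F, μ (fold ⁻¹' {F}) * ENNReal.ofReal (n * M / δ ^ 2) := by
        gcongr with F _
        exact hb F
    _ = ENNReal.ofReal (n * M / δ ^ 2) := by
        rw [← Finset.sum_mul, sum_measure_preimage_singleton _ fun F _ =>
          hfold (measurableSet_singleton F)]
        simp

end Sums

/-! ### Influence functions of ratio estimators -/

section Ratio

variable {Ω' β : Type*} [MeasurableSpace Ω'] [MeasurableSpace β]
  {μ : Measure Ω'} [IsProbabilityMeasure μ] {ν : Measure β}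

lemma tendstoInMeasure_zero_iff {f : ℕ → Ω' → ℝ} :
    TendstoInMeasure μ f atTop (fun _ => 0)
      ↔ ∀ ε, 0 < ε → Tendsto (fun n => μ {ω | ε ≤ |f n ω|}) atTop (𝓝 0) := by
  simp [tendstoInMeasure_iff_norm]

lemma tendstoInMeasure_add_zero {f g : ℕ → Ω' → ℝ} (hf : TendstoInMeasure μ f atTop fun _ => 0)
    (hg : TendstoInMeasure μ g atTop fun _ => 0) :
    TendstoInMeasure μ (fun n ω => f n ω + g n ω) atTop fun _ => 0 := by
  rw [tendstoInMeasure_zero_iff] at *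
  intro ε hε
  have h := (hf (ε / 2) (by positivity)).add (hg (ε / 2) (by positivity))
  rw [add_zero] at h
  refine tendsto_of_tendsto_of_tendsto_of_le_of_le tendsto_const_nhds h (fun _ => zero_le)
    fun n => ?_
  refine (measure_mono fun ω hω => ?_).trans (measure_union_le _ _)
  by_contra hcon
  simp only [Set.mem_union, Set.mem_ofPred_eq, not_or, not_le] at hcon hω
  have := abs_add_le (f n ω) (g n ω)
  linarith [hcon.1, hcon.2]

/-- Law of large numbers, in probability. -/
lemma tendstoInMeasure_average {W : ℕ → Ω' → β} (hW : ∀ i, Measurable (W i))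
    (hind : iIndepFun W μ) (hlaw : ∀ i, μ.map (W i) = ν) {f : β → ℝ} (hfm : Measurable f)
    (hf : Integrable f ν) :
    TendstoInMeasure μ (fun (n : ℕ) ω => (n : ℝ)⁻¹ * ∑ i ∈ Finset.range n, f (W i ω) - ∫ o, f o ∂ν)
      atTop fun _ => 0 := by
  have hident : ∀ i, IdentDistrib (fun ω => f (W i ω)) (fun ω => f (W 0 ω)) μ μ := fun i =>
    (IdentDistrib.mk (hW i).aemeasurable (hW 0).aemeasurable
      ((hlaw i).trans (hlaw 0).symm)).comp hfm
  have hint : Integrable (fun ω => f (W 0 ω)) μ :=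
    (integrable_map_measure hfm.aestronglyMeasurable (hW 0).aemeasurable).1 ((hlaw 0).symm ▸ hf)
  have h := strong_law_ae_real (fun i ω => f (W i ω)) hint
    (fun i j hij => (hind.indepFun hij).comp hfm hfm) hident
  have e : ∫ ω, f (W 0 ω) ∂μ = ∫ o, f o ∂ν := by
    rw [← hlaw 0, integral_map (hW 0).aemeasurable hfm.aestronglyMeasurable]
  rw [e] at h
  refine tendstoInMeasure_of_tendsto_ae (fun n => ?_) ?_
  · exact ((measurable_const.mul (Finset.measurable_sum _ fun i _ => hfm.comp (hW i))).sub
      measurable_const).aestronglyMeasurable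
  · filter_upwards [h] with ω hω
    have := hω.sub_const (∫ o, f o ∂ν)
    rw [sub_self] at this
    refine this.congr fun n => ?_
    rw [inv_mul_eq_div]

/-- If `√n (Nₙ - Δ Dₙ) = n^(-1/2) ∑ p ψ(Wᵢ) + o_p(1)` and `Dₙ → p > 0` in probability, then
`Nₙ / Dₙ` has influence function `ψ` for `Δ`. -/
lemma tendstoInMeasure_ratio {W : ℕ → Ω' → β} (hW : ∀ i, Measurable (W i))
    (hind : iIndepFun W μ) (hlaw : ∀ i, μ.map (W i) = ν) {ψ : β → ℝ} (hψm : Measurable ψ)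
    (hψ : MemLp ψ 2 ν) (hψ0 : ∫ o, ψ o ∂ν = 0) {N D : ℕ → Ω' → ℝ} {p Δ : ℝ} (hp : 0 < p)
    (hN : TendstoInMeasure μ (fun (n : ℕ) ω => √(n : ℝ) * (N n ω - Δ * D n ω)
      - p * ((√(n : ℝ))⁻¹ * ∑ i ∈ Finset.range n, ψ (W i ω))) atTop fun _ => 0)
    (hD : TendstoInMeasure μ (fun n ω => D n ω - p) atTop fun _ => 0) :
    TendstoInMeasure μ (fun (n : ℕ) ω => √(n : ℝ) * (N n ω / D n ω - Δ)
      - (√(n : ℝ))⁻¹ * ∑ i ∈ Finset.range n, ψ (W i ω)) atTop fun _ => 0 := by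
  rw [tendstoInMeasure_zero_iff] at *
  intro ε hε
  set v := ∫ o, ψ o ^ 2 ∂ν with hv
  have hv0 : 0 ≤ v := integral_nonneg fun o => sq_nonneg _
  -- the normalized sum is bounded in probability
  have hbdd : ∀ m : ℝ, 0 < m → ∀ n : ℕ,
      μ {ω | m ≤ |(√(n : ℝ))⁻¹ * ∑ i ∈ Finset.range n, ψ (W i ω)|} ≤ ENNReal.ofReal (v / m ^ 2) := by
    intro m hm n
    rcases Nat.eq_zero_or_pos n with rfl | hn
    · have : {ω : Ω' | m ≤ |(√((0 : ℕ) : ℝ))⁻¹ * ∑ i ∈ Finset.range 0, ψ (W i ω)|} = ∅ := by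
        ext ω; simp [hm]
      rw [this, measure_empty]; exact zero_le
    have hs : 0 < √(n : ℝ) := Real.sqrt_pos.2 (Nat.cast_pos.2 hn)
    have h1 := measure_abs_sum_ge_le (μ := μ) (ν := ν) (V := fun i : Fin n => W i) (fun i => hW i)
      (hind.precomp Fin.val_injective) (fun i => hlaw i) hψm hψ hψ0 (mul_pos hm hs)
    have e : ∀ ω, ∑ i : Fin n, ψ (W i ω) = ∑ i ∈ Finset.range n, ψ (W i ω) := fun ω =>
      Fin.sum_univ_eq_sum_range (fun i => ψ (W i ω)) n
    simp only [e] at h1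
    refine (measure_mono fun ω hω => ?_).trans (h1.trans_eq ?_)
    · simp only [Set.mem_ofPred_eq] at hω ⊢
      rw [abs_mul, abs_of_pos (inv_pos.2 hs), inv_mul_eq_div, le_div_iff₀ hs] at hω
      exact hω
    · congr 1
      rw [Fintype.card_fin, mul_pow, Real.sq_sqrt (Nat.cast_nonneg _), ← hv]
      have : (n : ℝ) ≠ 0 := Nat.cast_ne_zero.2 hn.ne'
      field_simp
  rw [ENNReal.tendsto_nhds_zero]
  intro τ hτ
  obtain ⟨m, hm, hmτ⟩ : ∃ m : ℝ, 0 < m ∧ ENNReal.ofReal (v / m ^ 2) ≤ τ / 2 := by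
    have h2 : Tendsto (fun m : ℝ => ENNReal.ofReal (v / m ^ 2)) atTop (𝓝 0) := by
      rw [← ENNReal.ofReal_zero]
      exact ENNReal.tendsto_ofReal (Tendsto.const_div_atTop (tendsto_pow_atTop two_ne_zero) v)
    obtain ⟨m, h3, h4⟩ := ((ENNReal.tendsto_nhds_zero.1 h2 (τ / 2) (ENNReal.half_pos hτ.ne')).and
      (eventually_gt_atTop 0)).exists
    exact ⟨m, h4, h3⟩
  have hsum := ((hN (ε * p / 4) (by positivity)).add (hD (p / 2) (by positivity))).add
    (hD (ε * p / (4 * m)) (by positivity))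
  simp only [add_zero] at hsum
  filter_upwards [ENNReal.tendsto_nhds_zero.1 hsum (τ / 2) (ENNReal.half_pos hτ.ne')] with n hn
  set R : Ω' → ℝ := fun ω => √(n : ℝ) * (N n ω - Δ * D n ω)
    - p * ((√(n : ℝ))⁻¹ * ∑ i ∈ Finset.range n, ψ (W i ω)) with hR
  set S : Ω' → ℝ := fun ω => (√(n : ℝ))⁻¹ * ∑ i ∈ Finset.range n, ψ (W i ω) with hS
  -- the remainder of the ratio is `{R - (D - p) S} / D`, with `D > p / 2` and `|S| < m` off small sets
  calc μ {ω | ε ≤ |√(n : ℝ) * (N n ω / D n ω - Δ) - S ω|}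
      ≤ μ ((({ω | ε * p / 4 ≤ |R ω|} ∪ {ω | p / 2 ≤ |D n ω - p|})
          ∪ {ω | ε * p / (4 * m) ≤ |D n ω - p|}) ∪ {ω | m ≤ |S ω|}) := by
        refine measure_mono fun ω hω => ?_
        by_contra hcon
        simp only [Set.mem_union, Set.mem_ofPred_eq, not_or, not_le] at hcon hω
        obtain ⟨⟨⟨c1, c2⟩, c3⟩, c4⟩ := hcon
        have hDpos : p / 2 < D n ω := by linarith [(abs_lt.1 c2).1]
        have hD0 : 0 < D n ω := by linarith
        have e : √(n : ℝ) * (N n ω / D n ω - Δ) - S ω = (R ω - (D n ω - p) * S ω) / D n ω := by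
          have hRS : R ω = √(n : ℝ) * (N n ω - Δ * D n ω) - p * S ω := rfl
          rw [hRS]
          generalize S ω = σ
          field_simp
          ring
        rw [e, abs_div, abs_of_pos hD0, le_div_iff₀ hD0] at hω
        have h5 : |R ω - (D n ω - p) * S ω| ≤ |R ω| + |D n ω - p| * |S ω| := by
          rw [← abs_mul]; exact abs_sub _ _
        have h6 : |D n ω - p| * |S ω| ≤ ε * p / (4 * m) * m :=
          mul_le_mul c3.le c4.le (abs_nonneg _) (by positivity)
        have h7 : ε * p / (4 * m) * m = ε * p / 4 := by field_simp
        nlinarith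
    _ ≤ μ {ω | ε * p / 4 ≤ |R ω|} + μ {ω | p / 2 ≤ |D n ω - p|}
          + μ {ω | ε * p / (4 * m) ≤ |D n ω - p|} + μ {ω | m ≤ |S ω|} :=
        (measure_union_le _ _).trans (add_le_add_left ((measure_union_le _ _).trans
          (add_le_add_left (measure_union_le _ _) _)) _)
    _ ≤ τ / 2 + τ / 2 := add_le_add hn ((hbdd m hm n).trans hmτ)
    _ = τ := ENNReal.add_halves τ

end Ratio

section Limit

variable {Ω' 𝒰 𝒵 : Type*} [MeasurableSpace Ω'] [MeasurableSpace 𝒰] [MeasurableSpace 𝒵]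
  {μ : Measure Ω'} [IsProbabilityMeasure μ] {ν : Measure (Obs 𝒰 𝒵)}

/-- The central limit theorem and Slutsky's theorem for an estimator with an influence function. -/
lemma HasInfluenceFunction.hasAsymptoticVariance {W : ℕ → Ω' → Obs 𝒰 𝒵}
    (hW : ∀ i, Measurable (W i)) (hind : iIndepFun W μ) (hlaw : ∀ i, μ.map (W i) = ν)
    {est : ℕ → Ω' → ℝ} {Δ : ℝ} {ψ : Obs 𝒰 𝒵 → ℝ} (h : HasInfluenceFunction μ W est Δ ψ)
    (hest : ∀ n, Measurable (est n)) (hψm : Measurable ψ) (hψ : MemLp ψ 2 ν)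
    (hψ0 : ∫ o, ψ o ∂ν = 0) :
    HasAsymptoticVariance μ est Δ (∫ o, ψ o ^ 2 ∂ν).toNNReal := by
  have hident : ∀ i, IdentDistrib (fun ω => ψ (W i ω)) (fun ω => ψ (W 0 ω)) μ μ := fun i =>
    (IdentDistrib.mk (hW i).aemeasurable (hW 0).aemeasurable
      ((hlaw i).trans (hlaw 0).symm)).comp hψm
  have hL : MemLp (fun ω => ψ (W 0 ω)) 2 μ :=
    (memLp_map_measure_iff hψm.aestronglyMeasurable (hW 0).aemeasurable).1 ((hlaw 0).symm ▸ hψ)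
  have h0 : ∫ ω, ψ (W 0 ω) ∂μ = 0 := by
    rw [← integral_map (hW 0).aemeasurable hψm.aestronglyMeasurable, hlaw 0, hψ0]
  have hv : variance (fun ω => ψ (W 0 ω)) μ = ∫ o, ψ o ^ 2 ∂ν := by
    have hm : Measurable fun ω => ψ (W 0 ω) := hψm.comp (hW 0)
    rw [variance_eq_integral hm.aemeasurable, h0, ← hlaw 0,
      integral_map (hW 0).aemeasurable (hψm.pow_const 2).aestronglyMeasurable]
    simp
  have hY : HasLaw (fun z : ℝ => z)
      (gaussianReal 0 (variance (fun ω => ψ (W 0 ω)) μ).toNNReal)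
      (gaussianReal 0 (∫ o, ψ o ^ 2 ∂ν).toNNReal) := by
    rw [hv]; exact HasLaw.id
  have hclt := tendstoInDistribution_inv_sqrt_mul_sum_sub (X := fun i ω => ψ (W i ω)) hY hL
    (hind.comp (fun _ => ψ) fun _ => hψm) hident
  have hm : ∀ n : ℕ, Measurable fun ω => (√(n : ℝ))⁻¹ * ∑ i ∈ Finset.range n, ψ (W i ω) := fun n =>
    measurable_const.mul (Finset.measurable_sum _ fun i _ => hψm.comp (hW i))
  have := hclt.add_of_tendstoInMeasure_const h fun n =>
    ((measurable_const.mul ((hest n).sub measurable_const)).sub (hm n)).aemeasurable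
  unfold HasAsymptoticVariance
  convert! this using 2
  · ext ω
    simp only [Pi.add_apply, h0]
    ring
  · simp

end Limit

/-! ### Cross-fitting -/

section CrossFit

variable {Ω' 𝒰 𝒵 : Type*} [MeasurableSpace Ω'] [MeasurableSpace 𝒰] [MeasurableSpace 𝒵]
  {μ : Measure Ω'} [IsProbabilityMeasure μ] {ν : Measure (Obs 𝒰 𝒵)} [IsProbabilityMeasure ν]

/-- Products of the residual with a function of the covariates dominated by `ε * Env`: they are
centered, because the residual is centered given `X`, with second moment of order `ε ^ 2`. -/
lemma resid_mul_moments {ρ : Obs 𝒰 𝒵 → ℝ} (hρm : Measurable ρ) {C : ℝ}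
    (hρ : ∀ᵐ o ∂ν, |ρ o| ≤ C) (hρ0 : ν[ρ|sigmaX 𝒰 𝒵] =ᵐ[ν] 0) {Env : 𝒰 × 𝒵 → ℝ}
    (hEnv : MemLp (fun o => Env (obsX o)) 2 ν) {ε : ℝ} {g : 𝒰 × 𝒵 → ℝ} (hg : Measurable g)
    (hb : ∀ᵐ x ∂(ν.map obsX), |g x| ≤ ε * Env x) :
    MemLp (fun o => ρ o * g (obsX o)) 2 ν ∧ ∫ o, ρ o * g (obsX o) ∂ν = 0 ∧
      ∫ o, (ρ o * g (obsX o)) ^ 2 ∂ν ≤ C ^ 2 * ε ^ 2 * ∫ o, Env (obsX o) ^ 2 ∂ν := by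
  have hb' : ∀ᵐ o ∂ν, |g (obsX o)| ≤ ε * Env (obsX o) :=
    ae_of_ae_map measurable_obsX.aemeasurable hb
  have hgm : Measurable fun o : Obs 𝒰 𝒵 => g (obsX o) := hg.comp measurable_obsX
  have hbound : ∀ᵐ o ∂ν, |ρ o * g (obsX o)| ≤ C * (ε * Env (obsX o)) := by
    filter_upwards [hρ, hb'] with o h1 h2
    rw [abs_mul]
    exact mul_le_mul h1 h2 (abs_nonneg _) ((abs_nonneg _).trans h1)
  have hL : MemLp (fun o => ρ o * g (obsX o)) 2 ν := by
    refine MemLp.mono ((hEnv.const_mul ε).const_mul C) (hρm.mul hgm).aestronglyMeasurable ?_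
    filter_upwards [hbound] with o ho
    exact ho.trans (le_abs_self _)
  have hρi : Integrable ρ ν := Integrable.of_bound hρm.aestronglyMeasurable C hρ
  refine ⟨hL, ?_, ?_⟩
  · have hi := hL.integrable one_le_two
    simp only [mul_comm (ρ _)] at hi ⊢
    have hgs : Measurable[sigmaX 𝒰 𝒵] fun o : Obs 𝒰 𝒵 => g (obsX o) :=
      hg.comp (comap_measurable obsX)
    rw [← integral_mul_condExp sigmaX_le hgs.stronglyMeasurable.aestronglyMeasurable hi hρi,
      integral_congr_ae (hρ0.mono fun o ho => by rw [ho, Pi.zero_apply, mul_zero])]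
    exact integral_zero _ _
  · rw [← integral_const_mul]
    refine integral_mono_ae hL.integrable_sq (hEnv.integrable_sq.const_mul _) ?_
    filter_upwards [hbound] with o ho
    calc (ρ o * g (obsX o)) ^ 2 = |ρ o * g (obsX o)| ^ 2 := (sq_abs _).symm
      _ ≤ (C * (ε * Env (obsX o))) ^ 2 := pow_le_pow_left₀ (abs_nonneg _) ho 2
      _ = _ := by ring

/-- Replacing a nuisance function `r` by its cross-fitted estimate does not change the first order
behaviour of a sum in which it is multiplied by the residual: no rate of convergence is needed,
since given the data outside a fold, the errors in that fold are independent and centered. -/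
lemma tendstoInMeasure_crossFit {ρ : Obs 𝒰 𝒵 → ℝ} (hρm : Measurable ρ) {C : ℝ}
    (hρ : ∀ᵐ o ∂ν, |ρ o| ≤ C) (hρ0 : ν[ρ|sigmaX 𝒰 𝒵] =ᵐ[ν] 0)
    {W : ℕ → Ω' → Obs 𝒰 𝒵} (hW : ∀ i, Measurable (W i)) (hind : iIndepFun W μ)
    (hlaw : ∀ i, μ.map (W i) = ν) {K : ℕ} {fold : (n : ℕ) → Ω' → Fin n → Fin K}
    (hfold : ∀ n, Measurable (fold n))
    (hfoldind : ∀ n, IndepFun (fold n) (fun ω i => W i ω) μ)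
    {L : Learner 𝒰 𝒵} {η₀ : Nuisance (𝒰 × 𝒵)}
    (hLcons : ∀ (k : Fin K) (ε : ℝ), 0 < ε →
      Tendsto (fun n : ℕ => μ {ω | ¬ ∀ᵐ x ∂(ν.map obsX),
        (crossFit L (fold n ω) (fun i => W i ω) k).Close η₀ ε x}) atTop (𝓝 0))
    {h : Nuisance (𝒰 × 𝒵) → 𝒰 × 𝒵 → ℝ} {r Env : 𝒰 × 𝒵 → ℝ}
    (hh : ∀ (n : ℕ) (s : Finset (Fin n)),
      Measurable fun q : (s → Obs 𝒰 𝒵) × (𝒰 × 𝒵) => h (L n s q.1) q.2)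
    (hr : Measurable r) (hEnvm : Measurable Env) (hEnv : MemLp (fun o => Env (obsX o)) 2 ν)
    {ε₀ : ℝ} (hε₀ : 0 < ε₀)
    (hmod : ∀ᵐ x ∂(ν.map obsX), ∀ ε, 0 < ε → ε ≤ ε₀ → ∀ η : Nuisance (𝒰 × 𝒵),
      η.Close η₀ ε x → |h η x - r x| ≤ ε * Env x) :
    TendstoInMeasure μ (fun (n : ℕ) ω => (√(n : ℝ))⁻¹ * ∑ i : Fin n, ρ (W i ω) *
      (h (crossFit L (fold n ω) (fun i => W i ω) (fold n ω i)) (obsX (W i ω))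
        - r (obsX (W i ω)))) atTop fun _ => 0 := by
  have hpX : IsProbabilityMeasure (ν.map obsX) :=
    Measure.isProbabilityMeasure_map measurable_obsX.aemeasurable
  rw [tendstoInMeasure_zero_iff]
  intro δ hδ
  set v := ∫ o, Env (obsX o) ^ 2 ∂ν with hv
  have hv0 : 0 ≤ v := integral_nonneg fun o => sq_nonneg _
  -- the bound for a fixed accuracy `ε` of the nuisance estimates
  have key : ∀ ε, 0 < ε → ε ≤ ε₀ → ∀ n : ℕ, μ {ω | δ ≤ |(√(n : ℝ))⁻¹ * ∑ i : Fin n, ρ (W i ω) *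
      (h (crossFit L (fold n ω) (fun i => W i ω) (fold n ω i)) (obsX (W i ω))
        - r (obsX (W i ω)))|}
      ≤ (∑ k : Fin K, μ {ω | ¬ ∀ᵐ x ∂(ν.map obsX),
          (crossFit L (fold n ω) (fun i => W i ω) k).Close η₀ ε x})
        + ∑ _ : Fin K, ENNReal.ofReal (C ^ 2 * ε ^ 2 * v * ((K + 1) / δ) ^ 2) := by
    intro ε hε hεε n
    rcases Nat.eq_zero_or_pos n with rfl | hn
    · -- at `n = 0` the statistic is zero
      have : ∀ ω : Ω', ¬ δ ≤ |(√((0 : ℕ) : ℝ))⁻¹ * ∑ i : Fin 0, ρ (W i ω) *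
          (h (crossFit L (fold 0 ω) (fun i => W i ω) (fold 0 ω i)) (obsX (W i ω))
            - r (obsX (W i ω)))| := fun ω => by simpa using hδ
      simp only [this]
      simp
    have hn0 : (0 : ℝ) < n := Nat.cast_pos.2 hn
    have hs : 0 < √(n : ℝ) := Real.sqrt_pos.2 hn0
    set B : Fin K → Set Ω' := fun k => {ω | ¬ ∀ᵐ x ∂(ν.map obsX),
          (crossFit L (fold n ω) (fun i => W i ω) k).Close η₀ ε x} with hB
    -- the training data that give accurate estimates
    let G : (k : Fin K) → (F : Fin n → Fin K) → Set (trainSet F k → Obs 𝒰 𝒵) := fun k F =>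
      {s | ∀ᵐ x ∂(ν.map obsX), |h (L n (trainSet F k) s) x - r x| ≤ ε * Env x}
    have hdm : ∀ (k : Fin K) (F : Fin n → Fin K), Measurable fun q : (trainSet F k → Obs 𝒰 𝒵) × (𝒰 × 𝒵) =>
        h (L n (trainSet F k) q.1) q.2 - r q.2 := fun k F =>
      (hh n _).sub (hr.comp measurable_snd)
    have hG : ∀ k F, MeasurableSet (G k F) := by
      intro k F
      have h1 : MeasurableSet {q : (trainSet F k → Obs 𝒰 𝒵) × (𝒰 × 𝒵) |
          ¬ |h (L n (trainSet F k) q.1) q.2 - r q.2| ≤ ε * Env q.2} :=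
        (measurableSet_le (hdm k F).abs
          (measurable_const.mul (hEnvm.comp measurable_snd))).compl
      exact measurable_measure_prodMk_left (ν := ν.map obsX) h1 (measurableSet_singleton 0)
    -- the summands, set to zero unless the estimate is accurate
    let ψ : (k : Fin K) → (F : Fin n → Fin K) → (trainSet F k → Obs 𝒰 𝒵) → Obs 𝒰 𝒵 → ℝ :=
      fun k F s o => (G k F).indicator
        (fun s => ρ o * (h (L n (trainSet F k) s) (obsX o) - r (obsX o))) s
    have hψm : ∀ k F, Measurable (Function.uncurry (ψ k F)) := by
      intro k F
      have h1 : Measurable fun q : (trainSet F k → Obs 𝒰 𝒵) × Obs 𝒰 𝒵 =>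
          ρ q.2 * (h (L n (trainSet F k) q.1) (obsX q.2) - r (obsX q.2)) :=
        (hρm.comp measurable_snd).mul ((hdm k F).comp
          (measurable_fst.prodMk (measurable_obsX.comp measurable_snd)))
      exact h1.indicator (measurable_fst (hG k F))
    have hmom : ∀ k F s, MemLp (ψ k F s) 2 ν ∧ ∫ o, ψ k F s o ∂ν = 0 ∧
        ∫ o, ψ k F s o ^ 2 ∂ν ≤ C ^ 2 * ε ^ 2 * v := by
      intro k F s
      by_cases hsG : s ∈ G k F
      · have e : ψ k F s = fun o => ρ o * (h (L n (trainSet F k) s) (obsX o) - r (obsX o)) :=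
          funext fun o => Set.indicator_of_mem hsG _
        rw [e]
        exact resid_mul_moments hρm hρ hρ0 hEnv
          (g := fun x => h (L n (trainSet F k) s) x - r x)
          ((hdm k F).comp measurable_prodMk_left) hsG
      · have e : ψ k F s = fun _ => 0 := funext fun o => Set.indicator_of_notMem hsG _
        rw [e]
        refine ⟨MemLp.zero', by simp, ?_⟩
        simp only [ne_eq, OfNat.ofNat_ne_zero, not_false_eq_true, zero_pow, integral_zero]
        positivity
    -- the denominator `K + 1` keeps the threshold positive when there are no folds, and makes the sum
    -- of `K` terms below it strictly smaller than `δ * √n`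
    set A : Fin K → Set Ω' := fun k =>
      {ω | δ * √(n : ℝ) / (K + 1) ≤ |∑ i with fold n ω i = k,
        ψ k (fold n ω) (fun j => W j ω) (W i ω)|} with hA
    have hAle : ∀ k, μ (A k) ≤ ENNReal.ofReal (C ^ 2 * ε ^ 2 * v * ((K + 1) / δ) ^ 2) := by
      intro k
      refine (measure_abs_fold_sum_ge_le hW hind hlaw (hfold n) (hfoldind n) k (hψm k)
        (fun F s => (hmom k F s).1) (fun F s => (hmom k F s).2.1) (fun F s => (hmom k F s).2.2)
        (by positivity) (by positivity)).trans_eq ?_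
      congr 1
      rw [div_pow, mul_pow, Real.sq_sqrt hn0.le]
      field_simp
    have hsub : {ω | δ ≤ |(√(n : ℝ))⁻¹ * ∑ i : Fin n, ρ (W i ω) *
        (h (crossFit L (fold n ω) (fun i => W i ω) (fold n ω i)) (obsX (W i ω))
          - r (obsX (W i ω)))|} ⊆ (⋃ k, B k) ∪ ⋃ k, A k := by
      intro ω hω
      by_contra hcon
      simp only [Set.mem_union, Set.mem_iUnion, not_or, not_exists] at hcon
      obtain ⟨hc1, hc2⟩ := hcon
      have hgood : ∀ k, (fun j : trainSet (fold n ω) k => W j ω) ∈ G k (fold n ω) := by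
        intro k
        have := hc1 k
        simp only [hB, Set.mem_ofPred_eq, not_not] at this
        filter_upwards [this, hmod] with x h1 h2
        exact h2 ε hε hεε _ h1
      have hsplit : ∑ i : Fin n, ρ (W i ω) *
          (h (crossFit L (fold n ω) (fun i => W i ω) (fold n ω i)) (obsX (W i ω))
            - r (obsX (W i ω)))
          = ∑ k, ∑ i with fold n ω i = k, ψ k (fold n ω) (fun j => W j ω) (W i ω) := by
        rw [← Finset.sum_fiberwise Finset.univ (fold n ω)]
        refine Finset.sum_congr rfl fun k _ => Finset.sum_congr rfl fun i hi => ?_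
        rw [(Finset.mem_filter.1 hi).2]
        exact (Set.indicator_of_mem (hgood k) fun s => ρ (W i ω) *
          (h (L n (trainSet (fold n ω) k) s) (obsX (W i ω)) - r (obsX (W i ω)))).symm
      have h1 : |∑ k, ∑ i with fold n ω i = k, ψ k (fold n ω) (fun j => W j ω) (W i ω)|
          ≤ ∑ _ : Fin K, δ * √(n : ℝ) / (K + 1) :=
        (Finset.abs_sum_le_sum_abs _ _).trans (Finset.sum_le_sum fun k _ => by
          have := hc2 k
          simp only [hA, Set.mem_ofPred_eq, not_le] at this
          exact this.le)
      have h2 : δ ≤ (√(n : ℝ))⁻¹ * (K * (δ * √(n : ℝ) / (K + 1))) := by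
        rw [Set.mem_ofPred_eq, abs_mul, abs_of_pos (inv_pos.2 hs), hsplit] at hω
        refine hω.trans (mul_le_mul_of_nonneg_left (h1.trans_eq ?_) (inv_nonneg.2 hs.le))
        simp
      have h3 : (√(n : ℝ))⁻¹ * (K * (δ * √(n : ℝ) / (K + 1))) = δ * (K / (K + 1)) := by
        field_simp
      have h4 : (K : ℝ) / (K + 1) < 1 := by
        rw [div_lt_one (by positivity)]; linarith
      rw [h3] at h2
      nlinarith
    calc _ ≤ μ ((⋃ k, B k) ∪ ⋃ k, A k) := measure_mono hsub
      _ ≤ μ (⋃ k, B k) + μ (⋃ k, A k) := measure_union_le _ _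
      _ ≤ ∑ k, μ (B k) + ∑ k, μ (A k) :=
        add_le_add (measure_iUnion_fintype_le _ _) (measure_iUnion_fintype_le _ _)
      _ ≤ _ := add_le_add le_rfl (Finset.sum_le_sum fun k _ => hAle k)
  rw [ENNReal.tendsto_nhds_zero]
  intro τ hτ
  have hlim : Tendsto (fun ε : ℝ => ∑ _ : Fin K,
      ENNReal.ofReal (C ^ 2 * ε ^ 2 * v * ((K + 1) / δ) ^ 2)) (𝓝[>] 0) (𝓝 0) := by
    have h1 : Continuous fun ε : ℝ => ∑ _ : Fin K,
        ENNReal.ofReal (C ^ 2 * ε ^ 2 * v * ((K + 1) / δ) ^ 2) :=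
      continuous_finsetSum _ fun _ _ => ENNReal.continuous_ofReal.comp (by fun_prop)
    have h2 := h1.tendsto 0
    simp only [ne_eq, OfNat.ofNat_ne_zero, not_false_eq_true, zero_pow, mul_zero, zero_mul,
      ENNReal.ofReal_zero, Finset.sum_const_zero] at h2
    exact h2.mono_left nhdsWithin_le_nhds
  obtain ⟨ε, hε1, hε2⟩ := ((ENNReal.tendsto_nhds_zero.1 hlim (τ / 2)
    (ENNReal.half_pos hτ.ne')).and (Ioc_mem_nhdsGT hε₀)).exists
  have hbad := tendsto_finsetSum Finset.univ fun k (_ : k ∈ Finset.univ) => hLcons k ε hε2.1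
  simp only [Finset.sum_const_zero] at hbad
  filter_upwards [ENNReal.tendsto_nhds_zero.1 hbad (τ / 2) (ENNReal.half_pos hτ.ne')] with n hn
  exact (key ε hε2.1 hε2.2 n).trans ((add_le_add hn hε1).trans_eq (ENNReal.add_halves τ))

end CrossFit

/-! ### The regression function as a functional of the nuisances -/

section Regression

/-- The multiplier of the residual in the estimating function, as a functional of the nuisances:
`B⁻¹ {w (α m₁ + β) + (1 - w) α e₃}`. It is taken at `(α, β) = (1, 0)` in the numerator of the
estimator, at `(0, 1)` in its denominator, and at `(1, -Δ)` in the estimating equation. -/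
def Nuisance.reg {𝒳 : Type*} (η : Nuisance 𝒳) (α β : ℝ) (x : 𝒳) : ℝ :=
  (η.B x)⁻¹ * (η.w x * (α * η.m1 x + β) + (1 - η.w x) * (α * η.e3 x))

variable {𝒳 : Type*}

lemma Nuisance.reg_eq_div (η : Nuisance 𝒳) (α β : ℝ) {x : 𝒳} (h : η.e1 x ≠ 0) :
    η.reg α β x = ((η.e1 x - 1) * (α * η.m1 x + β) + α * η.e3 x) / η.e2 x := by
  unfold Nuisance.reg Nuisance.B Nuisance.w
  rw [sub_sub_cancel, mul_inv, inv_inv, div_eq_mul_inv]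
  generalize (η.e2 x)⁻¹ = b
  field_simp

lemma Nuisance.reg_sub_mul (η : Nuisance 𝒳) (Δ : ℝ) (x : 𝒳) :
    η.reg 1 0 x - Δ * η.reg 0 1 x = η.reg 1 (-Δ) x := by
  unfold Nuisance.reg
  ring

/-- The Lipschitz constant of `Nuisance.reg` at nuisances with `1 ≤ e₁ ≤ c⁻¹` and `c ≤ e₂`. -/
def Nuisance.lip (η : Nuisance 𝒳) (c α β : ℝ) (x : 𝒳) : ℝ :=
  2 * c⁻¹ * (|α * η.m1 x + β| + |α| * (2 + c⁻¹))
    + 2 * c⁻¹ ^ 2 * (c⁻¹ * |α * η.m1 x + β| + |α| * |η.e3 x|)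

lemma Nuisance.Close.abs_reg_sub_le {η η₀ : Nuisance 𝒳} {ε c : ℝ} {x : 𝒳}
    (h : η.Close η₀ ε x) (hc : 0 < c) (hc2 : c ≤ 1) (hεc : ε ≤ c / 2)
    (h1 : 1 ≤ η₀.e1 x) (h1' : η₀.e1 x ≤ c⁻¹) (h2 : c ≤ η₀.e2 x) (α β : ℝ) :
    |η.reg α β x - η₀.reg α β x| ≤ ε * η₀.lip c α β x := by
  obtain ⟨d1, d2, d3, d4⟩ := h
  have hε : 0 ≤ ε := (abs_nonneg _).trans d1
  have hε1 : ε ≤ 1 := by linarith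
  have p1 : 0 < η.e1 x := by linarith [(abs_le.1 d1).1]
  have p2 : c / 2 ≤ η.e2 x := by linarith [(abs_le.1 d2).1]
  have q2 : 0 < η.e2 x := by linarith
  have q2' : 0 < η₀.e2 x := by linarith
  rw [Nuisance.reg_eq_div η α β p1.ne', Nuisance.reg_eq_div η₀ α β (by linarith), Nuisance.lip]
  set M := α * η₀.m1 x + β with hM
  set M' := α * η.m1 x + β with hM'
  have hMM : |M' - M| ≤ |α| * ε := by
    rw [hM, hM', show α * η.m1 x + β - (α * η₀.m1 x + β) = α * (η.m1 x - η₀.m1 x) by ring, abs_mul]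
    exact mul_le_mul_of_nonneg_left d4 (abs_nonneg _)
  have hMle : |M'| ≤ |M| + |α| := by
    have e : |M'| ≤ |M| + |M' - M| := by
      have := abs_add_le M (M' - M); rwa [add_sub_cancel] at this
    have := mul_le_mul_of_nonneg_left hε1 (abs_nonneg α)
    linarith
  have hci : 0 < c⁻¹ := inv_pos.2 hc
  have he : |η₀.e1 x - 1| ≤ c⁻¹ := by rw [abs_of_nonneg (by linarith)]; linarith
  set N := (η₀.e1 x - 1) * M + α * η₀.e3 x with hN
  set N' := (η.e1 x - 1) * M' + α * η.e3 x with hN'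
  have hNN : |N' - N| ≤ ε * (|M| + |α| * (2 + c⁻¹)) := by
    have e : N' - N = (η.e1 x - η₀.e1 x) * M' + (η₀.e1 x - 1) * (M' - M)
        + α * (η.e3 x - η₀.e3 x) := by rw [hN, hN']; ring
    have a1 : |(η.e1 x - η₀.e1 x) * M'| ≤ ε * (|M| + |α|) := by
      rw [abs_mul]; exact mul_le_mul d1 hMle (abs_nonneg _) hε
    have a2 : |(η₀.e1 x - 1) * (M' - M)| ≤ c⁻¹ * (|α| * ε) := by
      rw [abs_mul]; exact mul_le_mul he hMM (abs_nonneg _) hci.le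
    have a3 : |α * (η.e3 x - η₀.e3 x)| ≤ |α| * ε := by
      rw [abs_mul]; exact mul_le_mul_of_nonneg_left d3 (abs_nonneg _)
    have a4 := abs_add_le ((η.e1 x - η₀.e1 x) * M' + (η₀.e1 x - 1) * (M' - M))
      (α * (η.e3 x - η₀.e3 x))
    have a5 := abs_add_le ((η.e1 x - η₀.e1 x) * M') ((η₀.e1 x - 1) * (M' - M))
    rw [e]
    linarith
  have hNle : |N| ≤ c⁻¹ * |M| + |α| * |η₀.e3 x| := by
    refine (abs_add_le _ _).trans (add_le_add ?_ (abs_mul _ _).le)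
    rw [abs_mul]
    exact mul_le_mul_of_nonneg_right he (abs_nonneg _)
  have hi : (η.e2 x)⁻¹ ≤ 2 * c⁻¹ := by
    have := inv_anti₀ (by positivity) p2
    rwa [inv_div, div_eq_mul_inv] at this
  have hi0 : (η₀.e2 x)⁻¹ ≤ c⁻¹ := inv_anti₀ hc h2
  have hip := inv_pos.2 q2
  have hip0 := inv_pos.2 q2'
  have e : N' / η.e2 x - N / η₀.e2 x
      = (η.e2 x)⁻¹ * (N' - N) - (η.e2 x)⁻¹ * (η₀.e2 x)⁻¹ * (N * (η.e2 x - η₀.e2 x)) := by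
    field_simp
    ring
  have b1 : |(η.e2 x)⁻¹ * (N' - N)| ≤ 2 * c⁻¹ * (ε * (|M| + |α| * (2 + c⁻¹))) := by
    rw [abs_mul, abs_of_pos hip]
    exact mul_le_mul hi hNN (abs_nonneg _) (by positivity)
  have b2 : |(η.e2 x)⁻¹ * (η₀.e2 x)⁻¹ * (N * (η.e2 x - η₀.e2 x))|
      ≤ 2 * c⁻¹ * c⁻¹ * ((c⁻¹ * |M| + |α| * |η₀.e3 x|) * ε) := by
    rw [abs_mul, abs_of_pos (mul_pos hip hip0), abs_mul]
    exact mul_le_mul (mul_le_mul hi hi0 hip0.le (by positivity))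
      (mul_le_mul hNle d2 (abs_nonneg _) (by positivity)) (by positivity) (by positivity)
  rw [e]
  refine (abs_sub _ _).trans ((add_le_add b1 b2).trans_eq ?_)
  ring

variable {𝒰 𝒵 : Type*} [MeasurableSpace 𝒰] [MeasurableSpace 𝒵]

lemma Learner.Meas.measurable_reg {L : Learner 𝒰 𝒵} (hL : L.Meas) (α β : ℝ) (n : ℕ)
    (s : Finset (Fin n)) :
    Measurable fun q : (s → Obs 𝒰 𝒵) × (𝒰 × 𝒵) => (L n s q.1).reg α β q.2 := by
  obtain ⟨h1, h2, h3, h4⟩ := hL n s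
  have hw : Measurable fun q : (s → Obs 𝒰 𝒵) × (𝒰 × 𝒵) => (L n s q.1).w q.2 :=
    measurable_const.sub h1.inv
  have hB : Measurable fun q : (s → Obs 𝒰 𝒵) × (𝒰 × 𝒵) => (L n s q.1).B q.2 :=
    (measurable_const.sub hw).mul h2
  exact hB.inv.mul ((hw.mul ((measurable_const.mul h4).add measurable_const)).add
    ((measurable_const.sub hw).mul (measurable_const.mul h3)))

lemma deltaEff_eq (ps : ℝ → 𝒰 → ℝ) (L : Learner 𝒰 𝒵) {n K : ℕ} (fold : Fin n → Fin K)
    (s : Fin n → Obs 𝒰 𝒵) : deltaEff ps L fold s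
      = ((n : ℝ)⁻¹ * ∑ i, (resid ps (s i) * (s i).2.1
          - resid ps (s i) * (crossFit L fold s (fold i)).reg 1 0 (obsX (s i))))
        / ((n : ℝ)⁻¹ * ∑ i, (ind (s i).1
          - resid ps (s i) * (crossFit L fold s (fold i)).reg 0 1 (obsX (s i)))) := by
  unfold deltaEff Nuisance.reg obsX
  congr 2
  · refine Finset.sum_congr rfl fun i _ => ?_
    rw [one_div]; ring
  · refine Finset.sum_congr rfl fun i _ => ?_
    rw [div_eq_mul_inv]; ring

variable {Ω' : Type*} [MeasurableSpace Ω']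

lemma measurable_deltaAlt {ps : ℝ → 𝒰 → ℝ} (hps : Measurable fun q : ℝ × 𝒰 => ps q.1 q.2)
    (hps01 : ∀ y u, 0 < ps y u ∧ ps y u < 1) {W : ℕ → Ω' → Obs 𝒰 𝒵} (hW : ∀ i, Measurable (W i))
    (n : ℕ) : Measurable fun ω => deltaAlt ps n fun i => W i ω := by
  unfold deltaAlt
  simp only [ipw_eq_resid_mul hps01]
  refine (measurable_const.mul (Finset.measurable_sum _ fun i _ => ?_)).div
    (measurable_const.mul (Finset.measurable_sum _ fun i _ => ?_))
  · exact ((measurable_resid hps).mul measurable_snd.fst).comp (hW i)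
  · exact (measurable_ind.comp measurable_fst).comp (hW i)

lemma measurable_crossFit_reg {L : Learner 𝒰 𝒵} (hL : L.Meas) {K n : ℕ} (F : Fin n → Fin K)
    {W : ℕ → Ω' → Obs 𝒰 𝒵} (hW : ∀ i, Measurable (W i)) (i : Fin n) (α β : ℝ) :
    Measurable fun ω => (crossFit L F (fun i => W i ω) (F i)).reg α β (obsX (W i ω)) := by
  have h1 : Measurable fun ω => ((fun j : trainSet F (F i) => W j ω), obsX (W i ω)) :=
    (measurable_pi_lambda _ fun j => hW _).prodMk (measurable_obsX.comp (hW i))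
  have h2 := (hL.measurable_reg α β n (trainSet F (F i))).comp h1
  exact h2

lemma measurable_deltaEff_of_fold {ps : ℝ → 𝒰 → ℝ} (hps : Measurable fun q : ℝ × 𝒰 => ps q.1 q.2)
    {W : ℕ → Ω' → Obs 𝒰 𝒵} (hW : ∀ i, Measurable (W i)) {L : Learner 𝒰 𝒵} (hL : L.Meas) {K n : ℕ}
    (F : Fin n → Fin K) : Measurable fun ω => deltaEff ps L F fun i => W i ω := by
  have hr : Measurable (resid ps : Obs 𝒰 𝒵 → ℝ) := measurable_resid hps
  have h1 : ∀ i : Fin n, Measurable fun ω => resid ps (W i ω) * (W i ω).2.1 := fun i =>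
    (hr.mul measurable_snd.fst).comp (hW i)
  have h2 : ∀ i : Fin n, Measurable fun ω => resid ps (W i ω) := fun i => hr.comp (hW i)
  have h3 : ∀ i : Fin n, Measurable fun ω => ind (W i ω).1 := fun i =>
    (measurable_ind.comp measurable_fst).comp (hW i)
  simp only [deltaEff_eq]
  exact (measurable_const.mul (Finset.measurable_sum _ fun i _ =>
      (h1 i).sub ((h2 i).mul (measurable_crossFit_reg hL F hW i 1 0)))).div
    (measurable_const.mul (Finset.measurable_sum _ fun i _ =>
      (h3 i).sub ((h2 i).mul (measurable_crossFit_reg hL F hW i 0 1))))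

lemma measurable_deltaEff {ps : ℝ → 𝒰 → ℝ} (hps : Measurable fun q : ℝ × 𝒰 => ps q.1 q.2)
    {W : ℕ → Ω' → Obs 𝒰 𝒵} (hW : ∀ i, Measurable (W i)) {L : Learner 𝒰 𝒵} (hL : L.Meas) {K n : ℕ}
    {fold : Ω' → Fin n → Fin K} (hfold : Measurable fold) :
    Measurable fun ω => deltaEff ps L (fold ω) fun i => W i ω := by
  let g : (Fin n → Fin K) × Ω' → ℝ := fun q => deltaEff ps L q.1 fun i => W i q.2
  have h : Measurable g :=
    measurable_from_prod_countable_right (measurable_deltaEff_of_fold hps hW hL)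
  have h2 : Measurable fun ω => g (fold ω, ω) := h.comp (hfold.prodMk measurable_id)
  exact h2

end Regression

/-! ### The two estimators -/

section Estimation

lemma tendstoInMeasure_zero_of_abs_le {Ω' : Type*} [MeasurableSpace Ω'] {μ : Measure Ω'}
    [IsProbabilityMeasure μ] {f g : ℕ → Ω' → ℝ}
    (hf : TendstoInMeasure μ f atTop fun _ => 0) (h : ∀ n ω, |g n ω| ≤ |f n ω|) :
    TendstoInMeasure μ g atTop fun _ => 0 := by
  rw [tendstoInMeasure_zero_iff] at *
  intro ε hε
  refine tendsto_of_tendsto_of_tendsto_of_le_of_le tendsto_const_nhds (hf ε hε)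
    (fun _ => zero_le) fun n => measure_mono fun ω hω => ?_
  rw [Set.mem_ofPred_eq] at hω ⊢
  exact hω.trans (h n ω)

namespace Setting

variable {Ω Ω' 𝒰 𝒵 : Type*} [MeasurableSpace Ω] [MeasurableSpace Ω'] [MeasurableSpace 𝒰]
  [MeasurableSpace 𝒵]
  {P : Measure Ω} [IsProbabilityMeasure P] {D : FullData Ω 𝒰 𝒵} {ps : ℝ → 𝒰 → ℝ} {c : ℝ}
  {μ : Measure Ω'} [IsProbabilityMeasure μ] {W : ℕ → Ω' → Obs 𝒰 𝒵}

/-- The true value of the regression function `Nuisance.reg`. -/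
def _root_.ATT.FullData.reg (D : FullData Ω 𝒰 𝒵) (P : Measure Ω) [IsFiniteMeasure P]
    (ps : ℝ → 𝒰 → ℝ) (α β : ℝ) (x : 𝒰 × 𝒵) : ℝ :=
  (D.B P ps x)⁻¹ * (D.w P x * (α * (D.nuisance P ps).m1 x + β)
    + (1 - D.w P x) * (α * (D.nuisance P ps).e3 x))

lemma measurable_reg (H : Setting P D ps c) (α β : ℝ) : Measurable (D.reg P ps α β) := by
  have hw := measurable_w (P := P) D
  exact H.measurable_B.inv.mul
    ((hw.mul ((measurable_const.mul (measurable_m1 (P := P) (ps := ps) D)).add measurable_const)).add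
      ((measurable_const.sub hw).mul (measurable_const.mul H.measurable_e3)))

/-- `p φ` is the estimating function at the true nuisances. -/
lemma p_mul_phi (H : Setting P D ps c) (o : Obs 𝒰 𝒵) : D.p P * phi D P ps o
    = resid ps o * o.2.1 - D.att P * ind o.1 - resid ps o * D.reg P ps 1 (-D.att P) (obsX o) := by
  have e : D.E00 P (fun y => ps y o.2.2.1 ^ 2 / (1 - ps y o.2.2.1) ^ 2 * y) o.2.2
      = (D.nuisance P ps).e3 o.2.2 := by
    change D.E00 P _ _ = D.E00 P _ _
    congr 1
    ext y
    ring
  unfold phi FullData.reg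
  simp only [e]
  change D.p P * ((D.p P)⁻¹ * (_ - _ * _ * (_ * (D.nuisance P ps).m1 o.2.2 + _) - _)) = _
  rw [mul_inv_cancel_left₀ H.p_pos.ne']
  unfold obsX
  rw [one_div]
  ring

/-- Bounds on the true nuisances at almost every `x`, and the relations that identify `w` and `B`. -/
lemma ae_nuisance (H : Setting P D ps c) : ∀ᵐ x ∂(P.map D.X),
    1 ≤ (D.nuisance P ps).e1 x ∧ (D.nuisance P ps).e1 x ≤ c⁻¹ ∧ c ≤ (D.nuisance P ps).e2 x ∧
      ∀ α β, (D.nuisance P ps).reg α β x = D.reg P ps α β x := by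
  have h : ∀ᵐ x ∂(P.map D.X), (c ≤ D.w P x ∧ D.w P x ≤ 1 - c) ∧ c ≤ D.B P ps x ∧
      (1 - D.w P x) * (D.nuisance P ps).e1 x = 1 ∧
      (1 - D.w P x) * (D.nuisance P ps).e2 x = D.B P ps x := by
    have hw := measurable_w (P := P) D
    refine (ae_map_iff H.measurable_X.aemeasurable ?_).2 ?_
    · exact ((measurableSet_le measurable_const hw).inter
        (measurableSet_le hw measurable_const)).inter
        ((measurableSet_le measurable_const H.measurable_B).inter
        ((measurableSet_eq_fun ((measurable_const.sub hw).mul H.measurable_e1)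
          measurable_const).inter
        (measurableSet_eq_fun ((measurable_const.sub hw).mul H.measurable_e2) H.measurable_B)))
    · filter_upwards [H.w_mem, H.c_le_B, H.one_sub_w_mul_e1, H.one_sub_w_mul_e2] with ω a1 a2 a3 a4
      exact ⟨a1, a2, a3, a4⟩
  filter_upwards [h] with x ⟨⟨w1, w2⟩, hB, he1, he2⟩
  have hc := H.hc
  have hw : 0 < 1 - D.w P x := by linarith
  have e1 : (D.nuisance P ps).e1 x = (1 - D.w P x)⁻¹ := eq_inv_of_mul_eq_one_right he1
  refine ⟨?_, ?_, ?_, fun α β => ?_⟩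
  · rw [e1]; exact (one_le_inv₀ hw).2 (by linarith)
  · rw [e1]; exact inv_anti₀ hc (by linarith)
  · have : 0 < (D.nuisance P ps).e2 x := by
      by_contra hneg
      have := mul_nonpos_of_nonneg_of_nonpos hw.le (not_lt.1 hneg)
      linarith
    nlinarith
  · have hw' : (D.nuisance P ps).w x = D.w P x := by
      rw [Nuisance.w, e1, inv_inv, sub_sub_cancel]
    have hB' : (D.nuisance P ps).B x = D.B P ps x := by
      rw [Nuisance.B, hw', he2]
    rw [Nuisance.reg, FullData.reg, hw', hB']

lemma measurable_lip (H : Setting P D ps c) (α β : ℝ) :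
    Measurable ((D.nuisance P ps).lip c α β) := by
  have h1 := measurable_m1 (P := P) (ps := ps) D
  have h3 := H.measurable_e3
  unfold Nuisance.lip
  fun_prop

lemma memLp_lip (H : Setting P D ps c) (α β : ℝ) :
    MemLp (fun o => (D.nuisance P ps).lip c α β (obsX o)) 2 (P.map D.W) := by
  refine (memLp_map_measure_iff ((H.measurable_lip α β).comp measurable_obsX).aestronglyMeasurable
    H.measurable_W.aemeasurable).2 ?_
  have hM : MemLp (fun ω => |α * (D.nuisance P ps).m1 (D.X ω) + β|) 2 P :=
    ((H.memLp_m1.const_mul α).add (memLp_const β)).abs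
  have h3 : MemLp (fun ω => |(D.nuisance P ps).e3 (D.X ω)|) 2 P := H.memLp_e3.abs
  exact ((hM.add (memLp_const (|α| * (2 + c⁻¹)))).const_mul (2 * c⁻¹)).add
    (((hM.const_mul c⁻¹).add (h3.const_mul |α|)).const_mul (2 * c⁻¹ ^ 2))

lemma c_lt_one (H : Setting P D ps c) : c < 1 := by
  have := H.c_lt_half
  linarith

/-- Cross-fitting the regression function has no first order effect. -/
lemma tendstoInMeasure_crossFit_reg (H : Setting P D ps c)
    (hW : ∀ i, Measurable (W i)) (hind : iIndepFun W μ) (hlaw : ∀ i, μ.map (W i) = P.map D.W)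
    {K : ℕ} {fold : (n : ℕ) → Ω' → Fin n → Fin K} (hfold : ∀ n, Measurable (fold n))
    (hfoldind : ∀ n, IndepFun (fold n) (fun ω i => W i ω) μ)
    {L : Learner 𝒰 𝒵} (hL : L.Meas)
    (hLcons : ∀ (k : Fin K) (ε : ℝ), 0 < ε →
      Tendsto (fun n : ℕ => μ {ω | ¬ ∀ᵐ x ∂(P.map D.X),
        (crossFit L (fold n ω) (fun i => W i ω) k).Close (D.nuisance P ps) ε x}) atTop (𝓝 0))
    (α β : ℝ) :
    TendstoInMeasure μ (fun (n : ℕ) ω => (√(n : ℝ))⁻¹ * ∑ i : Fin n, resid ps (W i ω) *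
      ((crossFit L (fold n ω) (fun i => W i ω) (fold n ω i)).reg α β (obsX (W i ω))
        - D.reg P ps α β (obsX (W i ω)))) atTop fun _ => 0 := by
  have := H.isProbabilityMeasure_law
  have hc := H.hc
  refine tendstoInMeasure_crossFit (ν := P.map D.W) (h := fun η => η.reg α β)
    (Env := (D.nuisance P ps).lip c α β) (η₀ := D.nuisance P ps) (ε₀ := c / 2) (C := c⁻¹)
    (measurable_resid H.hps) H.abs_resid_le H.condExp_resid hW hind hlaw hfold hfoldind ?_
    (hL.measurable_reg α β) (H.measurable_reg α β) (H.measurable_lip α β) (H.memLp_lip α β)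
    (half_pos hc) ?_
  · rw [H.map_obsX]; exact hLcons
  · rw [H.map_obsX]
    filter_upwards [H.ae_nuisance] with x ⟨h1, h1', h2, h3⟩ ε _ hεc η hη
    rw [← h3]
    exact hη.abs_reg_sub_le hc H.c_lt_one.le hεc h1 h1' h2 α β

lemma integral_ind (H : Setting P D ps c) : ∫ o, ind o.1 ∂(P.map D.W) = D.p P := by
  have hm : Measurable fun o : Obs 𝒰 𝒵 => ind o.1 := measurable_ind.comp measurable_fst
  rw [integral_map H.measurable_W.aemeasurable hm.aestronglyMeasurable, H.p_eq_integral_treat]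
  rfl

lemma integrable_ind (H : Setting P D ps c) :
    Integrable (fun o : Obs 𝒰 𝒵 => ind o.1) (P.map D.W) :=
  (integrable_map_measure (measurable_ind.comp measurable_fst).aestronglyMeasurable
    H.measurable_W.aemeasurable).2 H.integrable_treat

/-- The denominator of the efficient estimator is centered at `p`. -/
lemma integral_ind_sub_resid_mul_reg (H : Setting P D ps c) :
    Integrable (fun o => ind o.1 - resid ps o * D.reg P ps 0 1 (obsX o)) (P.map D.W) ∧
      ∫ o, (ind o.1 - resid ps o * D.reg P ps 0 1 (obsX o)) ∂(P.map D.W) = D.p P := by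
  have := H.isProbabilityMeasure_law
  have hm := H.measurable_reg 0 1
  have hb : ∀ᵐ o ∂(P.map D.W), |D.reg P ps 0 1 (obsX o)| ≤ c⁻¹ := by
    refine H.ae_law_of_ae_X (p := fun x => |D.reg P ps 0 1 x| ≤ c⁻¹) ?_
      (measurableSet_le hm.abs measurable_const)
    filter_upwards [H.w_mem, H.c_le_B] with ω h1 h2
    have hc := H.hc
    have e : D.reg P ps 0 1 (D.X ω) = (D.B P ps (D.X ω))⁻¹ * D.w P (D.X ω) := by
      rw [FullData.reg]; ring
    have hB : 0 < D.B P ps (D.X ω) := hc.trans_le h2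
    rw [e, abs_of_nonneg (mul_nonneg (inv_nonneg.2 hB.le) (hc.le.trans h1.1))]
    have := mul_le_mul (inv_anti₀ hc h2) (show D.w P (D.X ω) ≤ 1 by linarith) (hc.le.trans h1.1)
      (inv_nonneg.2 hc.le)
    rwa [mul_one] at this
  have hE : MemLp (fun o => |D.reg P ps 0 1 (obsX o)|) 2 (P.map D.W) := by
    refine (MemLp.of_bound (hm.comp measurable_obsX).aestronglyMeasurable c⁻¹ hb).abs
  obtain ⟨m1, m2, -⟩ := resid_mul_moments (ν := P.map D.W) (ε := 1) (measurable_resid H.hps)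
    H.abs_resid_le H.condExp_resid hE hm (ae_of_all _ fun x => (one_mul _).ge)
  have m3 := m1.integrable one_le_two
  exact ⟨H.integrable_ind.sub m3, by rw [integral_sub H.integrable_ind m3, m2, H.integral_ind, sub_zero]⟩

lemma sqrt_mul_inv_mul (n : ℕ) (x : ℝ) : √(n : ℝ) * ((n : ℝ)⁻¹ * x) = (√(n : ℝ))⁻¹ * x := by
  rw [← mul_assoc, ← div_eq_mul_inv, Real.sqrt_div_self]

theorem hasInfluenceFunction_deltaAlt (H : Setting P D ps c)
    (hW : ∀ i, Measurable (W i)) (hind : iIndepFun W μ) (hlaw : ∀ i, μ.map (W i) = P.map D.W) :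
    HasInfluenceFunction μ W (fun n ω => deltaAlt ps n fun i => W i ω) (D.att P)
      (phiAlt D P ps) := by
  have := H.isProbabilityMeasure_law
  refine tendstoInMeasure_ratio hW hind hlaw H.measurable_phiAlt H.memLp_phiAlt H.integral_phiAlt
    H.p_pos (N := fun n ω => (n : ℝ)⁻¹ * ∑ i : Fin n, ipw ps (W i ω))
    (D := fun n ω => (n : ℝ)⁻¹ * ∑ i : Fin n, ind (W i ω).1) ?_ ?_
  · have e : ∀ (n : ℕ) (ω : Ω'), √(n : ℝ) * ((n : ℝ)⁻¹ * ∑ i : Fin n, ipw ps (W i ω)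
        - D.att P * ((n : ℝ)⁻¹ * ∑ i : Fin n, ind (W i ω).1))
        - D.p P * ((√(n : ℝ))⁻¹ * ∑ i ∈ Finset.range n, phiAlt D P ps (W i ω)) = 0 := by
      intro n ω
      have e1 : D.p P * ∑ i ∈ Finset.range n, phiAlt D P ps (W i ω)
          = ∑ i : Fin n, ipw ps (W i ω) - D.att P * ∑ i : Fin n, ind (W i ω).1 := by
        rw [← Fin.sum_univ_eq_sum_range (fun i => phiAlt D P ps (W i ω)) n, Finset.mul_sum,
          Finset.mul_sum, ← Finset.sum_sub_distrib]
        refine Finset.sum_congr rfl fun i _ => ?_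
        rw [phiAlt, mul_inv_cancel_left₀ H.p_pos.ne']
        ring
      have e2 := sqrt_mul_inv_mul n (∑ i : Fin n, ipw ps (W i ω)
        - D.att P * ∑ i : Fin n, ind (W i ω).1)
      linear_combination e2 - (√(n : ℝ))⁻¹ * e1
    simp only [e]
    rw [tendstoInMeasure_zero_iff]
    intro ε hε
    simp [hε.not_ge]
  · have h := tendstoInMeasure_average hW hind hlaw (f := fun o : Obs 𝒰 𝒵 => ind o.1)
      (measurable_ind.comp measurable_fst) H.integrable_ind
    rw [H.integral_ind] at h
    refine tendstoInMeasure_zero_of_abs_le h fun n ω => le_of_eq ?_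
    rw [Fin.sum_univ_eq_sum_range (fun i => ind (W i ω).1) n]

theorem hasInfluenceFunction_deltaEff (H : Setting P D ps c)
    (hW : ∀ i, Measurable (W i)) (hind : iIndepFun W μ) (hlaw : ∀ i, μ.map (W i) = P.map D.W)
    {K : ℕ} {fold : (n : ℕ) → Ω' → Fin n → Fin K} (hfold : ∀ n, Measurable (fold n))
    (hfoldind : ∀ n, IndepFun (fold n) (fun ω i => W i ω) μ)
    {L : Learner 𝒰 𝒵} (hL : L.Meas)
    (hLcons : ∀ (k : Fin K) (ε : ℝ), 0 < ε →
      Tendsto (fun n : ℕ => μ {ω | ¬ ∀ᵐ x ∂(P.map D.X),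
        (crossFit L (fold n ω) (fun i => W i ω) k).Close (D.nuisance P ps) ε x}) atTop (𝓝 0)) :
    HasInfluenceFunction μ W (fun n ω => deltaEff ps L (fold n ω) fun i => W i ω) (D.att P)
      (phi D P ps) := by
  have := H.isProbabilityMeasure_law
  have hX := H.tendstoInMeasure_crossFit_reg hW hind hlaw hfold hfoldind hL hLcons
  unfold HasInfluenceFunction
  simp only [deltaEff_eq]
  refine tendstoInMeasure_ratio hW hind hlaw H.measurable_phi H.memLp_phi H.integral_phi
    H.p_pos ?_ ?_
  · -- the remainder is the effect of cross-fitting on the estimating equation at the true `Δ`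
    refine tendstoInMeasure_zero_of_abs_le (hX 1 (-D.att P)) fun n ω => ?_
    have e1 : D.p P * ∑ i ∈ Finset.range n, phi D P ps (W i ω)
        = ∑ i : Fin n, D.p P * phi D P ps (W i ω) := by
      rw [← Fin.sum_univ_eq_sum_range (fun i => phi D P ps (W i ω)) n, Finset.mul_sum]
    have e3 := fun x : ℝ => sqrt_mul_inv_mul n x
    rw [← abs_neg ((√(n : ℝ))⁻¹ * _)]
    refine le_of_eq (congrArg _ ?_)
    rw [mul_sub, mul_left_comm (√(n : ℝ)) (D.att P), e3, e3, mul_left_comm (D.p P), e1,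
      mul_left_comm (D.att P), ← mul_sub, ← mul_sub, ← mul_neg, Finset.mul_sum,
      ← Finset.sum_sub_distrib, ← Finset.sum_sub_distrib, ← Finset.sum_neg_distrib]
    refine congrArg _ (Finset.sum_congr rfl fun i _ => ?_)
    rw [H.p_mul_phi, ← Nuisance.reg_sub_mul]
    ring
  · obtain ⟨hi, hmean⟩ := H.integral_ind_sub_resid_mul_reg
    have hav := tendstoInMeasure_average hW hind hlaw
      (f := fun o : Obs 𝒰 𝒵 => ind o.1 - resid ps o * D.reg P ps 0 1 (obsX o))
      ((measurable_ind.comp measurable_fst).sub ((measurable_resid H.hps).mul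
        ((H.measurable_reg 0 1).comp measurable_obsX))) hi
    rw [hmean] at hav
    have hrem : TendstoInMeasure μ (fun (n : ℕ) ω => -((n : ℝ)⁻¹ * ∑ i : Fin n,
        resid ps (W i ω) *
        ((crossFit L (fold n ω) (fun i => W i ω) (fold n ω i)).reg 0 1 (obsX (W i ω))
          - D.reg P ps 0 1 (obsX (W i ω))))) atTop fun _ => 0 := by
      refine tendstoInMeasure_zero_of_abs_le (hX 0 1) fun n ω => ?_
      rw [abs_neg, abs_mul, abs_mul]
      refine mul_le_mul_of_nonneg_right ?_ (abs_nonneg _)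
      rw [abs_of_nonneg (by positivity), abs_of_nonneg (by positivity)]
      rcases Nat.eq_zero_or_pos n with rfl | hn
      · simp
      · have h1 : (1 : ℝ) ≤ n := by exact_mod_cast hn
        exact inv_anti₀ (Real.sqrt_pos.2 (by linarith)) (Real.sqrt_le_iff.2 ⟨by linarith, by nlinarith⟩)
    refine tendstoInMeasure_zero_of_abs_le (tendstoInMeasure_add_zero hav hrem) fun n ω => le_of_eq ?_
    congr 1
    rw [← Fin.sum_univ_eq_sum_range
      (fun i => ind (W i ω).1 - resid ps (W i ω) * D.reg P ps 0 1 (obsX (W i ω))) n]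
    rw [sub_add_eq_add_sub, ← sub_eq_add_neg, ← mul_sub, ← Finset.sum_sub_distrib]
    refine congrArg (fun s => (n : ℝ)⁻¹ * s - D.p P) (Finset.sum_congr rfl fun i _ => ?_)
    ring

end Setting

end Estimation

/-! ### Comparison of the second moments -/

namespace Setting

variable {Ω 𝒰 𝒵 : Type*} [MeasurableSpace Ω] [MeasurableSpace 𝒰] [MeasurableSpace 𝒵]
  {P : Measure Ω} [IsProbabilityMeasure P] {D : FullData Ω 𝒰 𝒵} {ps : ℝ → 𝒰 → ℝ} {c : ℝ}

/-- Pythagoras' theorem for `φ_alt = φ + φ_perp`. -/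
lemma integral_phiAlt_sq (H : Setting P D ps c) :
    ∫ o, phiAlt D P ps o ^ 2 ∂(P.map D.W)
      = ∫ o, phi D P ps o ^ 2 ∂(P.map D.W) + ∫ o, phiPerp D P ps o ^ 2 ∂(P.map D.W) := by
  have := H.isProbabilityMeasure_law
  obtain ⟨a, b, r, -, hb, hr, -, hbΛ, hrΛ, -⟩ := H.exists_projections
  have h0 : ∫ o, phi D P ps o * phiPerp D P ps o ∂(P.map D.W) = 0 := by
    have h := Submodule.inner_right_of_mem_orthogonal hbΛ hrΛ
    rw [Hilb.inner_eq] at h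
    rw [← h]
    refine integral_congr_ae ?_
    filter_upwards [hb, hr] with o h1 h2
    rw [h1, h2]
  have i1 := H.memLp_phi.integrable_sq
  have i2 := H.memLp_phiPerp.integrable_sq
  have i3 : Integrable (fun o => 2 * (phi D P ps o * phiPerp D P ps o)) (P.map D.W) :=
    (H.memLp_phi.integrable_mul H.memLp_phiPerp).const_mul 2
  have e : ∀ o, phiAlt D P ps o ^ 2 = phi D P ps o ^ 2 + phiPerp D P ps o ^ 2
      + 2 * (phi D P ps o * phiPerp D P ps o) := fun o => by
    rw [phi_add_phiPerp P D H.hps01]; ring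
  have i12 : Integrable (fun o => phi D P ps o ^ 2 + phiPerp D P ps o ^ 2) (P.map D.W) := i1.add i2
  simp only [e]
  rw [integral_add i12 i3, integral_add i1 i2, integral_const_mul, h0]
  ring

lemma integral_phi_sq_lt_iff (H : Setting P D ps c) :
    ∫ o, phi D P ps o ^ 2 ∂(P.map D.W) < ∫ o, phiAlt D P ps o ^ 2 ∂(P.map D.W)
      ↔ ¬ D.V P ps =ᵐ[P.map D.X] 0 := by
  have h := integral_eq_zero_iff_of_nonneg (f := fun o => phiPerp D P ps o ^ 2)
    (fun o => sq_nonneg _) H.memLp_phiPerp.integrable_sq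
  have h0 : 0 ≤ ∫ o, phiPerp D P ps o ^ 2 ∂(P.map D.W) := integral_nonneg fun o => sq_nonneg _
  have h1 : (fun o => phiPerp D P ps o ^ 2) =ᵐ[P.map D.W] 0 ↔ phiPerp D P ps =ᵐ[P.map D.W] 0 :=
    eventually_congr (ae_of_all _ fun o => pow_eq_zero_iff two_ne_zero)
  rw [H.integral_phiAlt_sq, lt_add_iff_pos_right, ← H.phiPerp_ae_eq_zero_iff, ← h1, ← h,
    h0.lt_iff_ne, ne_comm]

end Setting

end ATT

end

theorem mainTheorem5
    {Ω Ω' 𝒰 𝒵 : Type*} [MeasurableSpace Ω] [MeasurableSpace Ω']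
    [MeasurableSpace 𝒰] [MeasurableSpace 𝒵]
    -- the population
    (P : Measure Ω) [IsProbabilityMeasure P] (D : ATT.FullData Ω 𝒰 𝒵)
    (hT : Measurable D.T) (hY0 : Measurable D.Y0) (hY1 : Measurable D.Y1)
    (hU : Measurable D.U) (hZ : Measurable D.Z)
    (hY2 : MemLp D.Y 2 P)
    -- the parametric model for the treatment assignment, with `θ⁰` known
    {d : ℕ} (π : EuclideanSpace ℝ (Fin d) → ℝ → 𝒰 → ℝ) (θ₀ : EuclideanSpace ℝ (Fin d))
    (hπ : Measurable fun q : ℝ × 𝒰 => π θ₀ q.1 q.2)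
    (hπ01 : ∀ y u, 0 < π θ₀ y u ∧ π θ₀ y u < 1)
    (hassign : P[(D.ev true).indicator (fun _ => (1 : ℝ)) |
        MeasurableSpace.comap (fun ω => (D.Y0 ω, D.X ω)) inferInstance]
      =ᵐ[P] fun ω => π θ₀ (D.Y0 ω) (D.U ω))
    (c : ℝ) (hc : 0 < c)
    (hoverlap : ∀ᵐ ω ∂P, c < π θ₀ (D.Y0 ω) (D.U ω) ∧ π θ₀ (D.Y0 ω) (D.U ω) < 1 - c)
    -- the independent and identically distributed sample
    (μ : Measure Ω') [IsProbabilityMeasure μ] (W : ℕ → Ω' → ATT.Obs 𝒰 𝒵)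
    (hW : ∀ i, Measurable (W i)) (hWind : iIndepFun W μ) (hWlaw : ∀ i, μ.map (W i) = P.map D.W)
    -- the random partition into `K` folds and the nuisance estimators, uniformly consistent
    {K : ℕ} (fold : (n : ℕ) → Ω' → Fin n → Fin K) (hfold : ∀ n, Measurable (fold n))
    (hfoldind : ∀ n, IndepFun (fold n) (fun ω i => W i ω) μ)
    (L : ATT.Learner 𝒰 𝒵) (hL : L.Meas)
    (hLcons : ∀ (k : Fin K) (ε : ℝ), 0 < ε →
      Tendsto (fun n : ℕ => μ {ω | ¬ ∀ᵐ x ∂(P.map D.X),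
        (ATT.crossFit L (fold n ω) (fun i => W i ω) k).Close (D.nuisance P (π θ₀)) ε x})
        atTop (𝓝 0)) :
    -- `φ_alt = φ + φ_perp`, with `φ` the projection of `φ_alt` on `Λ`, `φ_perp` that on `Λ^⊥`
    (∃ a b r : ATT.Hilb (P.map D.W),
      ((a : Lp ℝ 2 (P.map D.W)) : ATT.Obs 𝒰 𝒵 → ℝ) =ᵐ[P.map D.W] ATT.phiAlt D P (π θ₀) ∧
      ((b : Lp ℝ 2 (P.map D.W)) : ATT.Obs 𝒰 𝒵 → ℝ) =ᵐ[P.map D.W] ATT.phi D P (π θ₀) ∧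
      ((r : Lp ℝ 2 (P.map D.W)) : ATT.Obs 𝒰 𝒵 → ℝ) =ᵐ[P.map D.W] ATT.phiPerp D P (π θ₀) ∧
      a = b + r ∧
      (ATT.nuisanceTangent (π θ₀) (P.map D.W)).starProjection a = b ∧
      (ATT.nuisanceTangent (π θ₀) (P.map D.W))ᗮ.starProjection a = r ∧
      (r ≠ 0 ↔ ¬ D.V P (π θ₀) =ᵐ[P.map D.X] 0) ∧
      (a ∉ ATT.nuisanceTangent (π θ₀) (P.map D.W) ↔ ¬ D.V P (π θ₀) =ᵐ[P.map D.X] 0)) ∧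
    -- comparison of the second moments
    (∫ o, ATT.phiAlt D P (π θ₀) o ^ 2 ∂(P.map D.W)
      = ∫ o, ATT.phi D P (π θ₀) o ^ 2 ∂(P.map D.W)
        + ∫ o, ATT.phiPerp D P (π θ₀) o ^ 2 ∂(P.map D.W)) ∧
    (∫ o, ATT.phi D P (π θ₀) o ^ 2 ∂(P.map D.W) < ∫ o, ATT.phiAlt D P (π θ₀) o ^ 2 ∂(P.map D.W)
      ↔ ¬ D.V P (π θ₀) =ᵐ[P.map D.X] 0) ∧
    -- influence functions and asymptotic variances of the two estimators
    ATT.HasInfluenceFunction μ W (fun n ω => ATT.deltaAlt (π θ₀) n fun i => W i ω) (D.att P)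
      (ATT.phiAlt D P (π θ₀)) ∧
    ATT.HasInfluenceFunction μ W
      (fun n ω => ATT.deltaEff (π θ₀) L (fold n ω) fun i => W i ω) (D.att P)
      (ATT.phi D P (π θ₀)) ∧
    ATT.HasAsymptoticVariance μ (fun n ω => ATT.deltaAlt (π θ₀) n fun i => W i ω) (D.att P)
      (∫ o, ATT.phiAlt D P (π θ₀) o ^ 2 ∂(P.map D.W)).toNNReal ∧
    ATT.HasAsymptoticVariance μ
      (fun n ω => ATT.deltaEff (π θ₀) L (fold n ω) fun i => W i ω) (D.att P)
      (∫ o, ATT.phi D P (π θ₀) o ^ 2 ∂(P.map D.W)).toNNReal ∧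
    -- strictly smaller efficiency, as soon as the projection on `Λ^⊥` is nonzero
    (¬ D.V P (π θ₀) =ᵐ[P.map D.X] 0 →
      ATT.LessEfficient μ (fun n ω => ATT.deltaAlt (π θ₀) n fun i => W i ω)
        (fun n ω => ATT.deltaEff (π θ₀) L (fold n ω) fun i => W i ω) (D.att P)) ∧
    -- a sufficient condition for that
    (∫ ω, D.Y0 ω * (π θ₀ (D.Y0 ω) (D.U ω) / (1 - π θ₀ (D.Y0 ω) (D.U ω))) ∂P ≠ 0 →
      ¬ D.V P (π θ₀) =ᵐ[P.map D.X] 0) := by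
  have H : ATT.Setting P D (π θ₀) c := ⟨hT, hY0, hY1, hU, hZ, hY2, hπ, hπ01, hassign, hc, hoverlap⟩
  have := H.isProbabilityMeasure_law
  have hAlt := H.hasInfluenceFunction_deltaAlt hW hWind hWlaw
  have hEff := H.hasInfluenceFunction_deltaEff hW hWind hWlaw hfold hfoldind hL hLcons
  have vAlt := hAlt.hasAsymptoticVariance hW hWind hWlaw (ATT.measurable_deltaAlt hπ hπ01 hW)
    H.measurable_phiAlt H.memLp_phiAlt H.integral_phiAlt
  have vEff := hEff.hasAsymptoticVariance hW hWind hWlaw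
    (fun n => ATT.measurable_deltaEff hπ hW hL (hfold n))
    H.measurable_phi H.memLp_phi H.integral_phi
  refine ⟨?_, H.integral_phiAlt_sq, H.integral_phi_sq_lt_iff, hAlt, hEff, vAlt, vEff,
    fun hV => ⟨_, _, vAlt, vEff, ?_⟩, H.V_ne_zero_of_integral_ne_zero⟩
  · obtain ⟨a, b, r, ha, hb, hr, hsum, hbΛ, hrΛ, hr0⟩ := H.exists_projections
    have hproj : (ATT.nuisanceTangent (π θ₀) (P.map D.W)).starProjection a = b :=
      Submodule.eq_starProjection_of_mem_orthogonal' hbΛ hrΛ hsum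
    have hr0' : r ≠ 0 ↔ ¬ D.V P (π θ₀) =ᵐ[P.map D.X] 0 := not_congr hr0
    refine ⟨a, b, r, ha, hb, hr, hsum, hproj, ?_, hr0', ?_⟩
    · rw [Submodule.starProjection_orthogonal_val, hproj, hsum, add_sub_cancel_left]
    · rw [← hr0', ← Submodule.starProjection_eq_self_iff, hproj, hsum, left_eq_add]
  · have h := H.integral_phi_sq_lt_iff.2 hV
    exact (Real.toNNReal_lt_toNNReal_iff_of_nonneg (integral_nonneg fun o => sq_nonneg _)).2 h
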